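/- Let $T>0$, $\omega=2\pi/T$, and let $A_{ind},A_{dep}\in\mathbb R^{n\times n}$, $B_{ind},B_{dep}\in\mathbb R^{n\times m}$ be constant. Consider the bilinear affine system with scalar control $s$ and exogenous input $w$, $$\dot x=A(s)x+B(s)w,\qquad A(s)=A_{ind}+sA_{dep},\quad B(s)=B_{ind}+sB_{dep}.$$ For a signal $f$ put $\mathcal F_T(f)(t)=(f_k(t))_{k\in\mathbb Z}$ with $f_k(t)=\frac1T\int_{t-T}^{t}f(\tau)e^{-j\omega k\tau}d\tau$, and let $\mathcal T_T(f)(t)=(f_{k-l}(t))_{k,l\in\mathbb Z}$ be the associated block Toeplitz matrix; both are constant in $t$ if $f$ is $T$-periodic. Put $\mathcal N=\mathrm{diag}(j\omega k\,\mathrm{Id}_n)_{k\in\mathbb Z}$ and, for $S\in\ell^2(\mathbb C)$ with Toeplitz matrix $\mathcal S=(S_{k-l})_{k,l}$, put $\mathcal A(S)=\mathcal T_T(A_{ind})+\mathcal S\otimes A_{dep}$ and $\mathcal B(S)=\mathcal T_T(B_{ind})+\mathcal S\otimes B_{dep}$. The harmonic model is $$\dot X=(\mathcal A(S)-\mathcal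 N)X+\mathcal B(S)W .$$ Its trajectories on $[t_0,\infty)$ are the pairs $X=\mathcal F_T(x)$, $S=\mathcal F_T(s)$, with $x,s$ of class $L^2_{loc}$ on $[t_0-T,\infty)$, that satisfy it componentwise almost everywhere on $[t_0,\infty)$. Let $w$ be real, $T$-periodic and of class $L^2$, and $W=\mathcal F_T(w)$. Let $s^e$ be real, $T$-periodic and of class $L^2$, $S^e=\mathcal F_T(s^e)$, and let $X^e\in\ell^2(\mathbb C^n)$ satisfy $0=(\mathcal A(S^e)-\mathcal N)X^e+\mathcal B(S^e)W$. Assume that $\mathcal A(S^e)-\mathcal N$ is Hurwitz, i.e. as an operator on $\ell^2(\mathbb C^n)$ with its maximal domain it has its spectrum in $\{\mathrm{Re}\,z<0\}$. Let $\gamma:\mathbb R\to\mathbb R$ and $Q:\mathbb R\to\mathbb R^{n\times n}$ be $T$-periodic and of class $L^\infty$, with $\gamma(t)>0$ and $Q(t)$ symmetric positive definite for almost every $t$; put $\Gamma=\mathcal T_T(\gamma)$, $\mathcal Q=\mathcal T_T(Q)$. Then the Lyapunov equation $$(\mathcal A(S^e)-\mathcal N)^*\mathcal P+\mathcal P(\mathcal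 A(S^e)-\mathcal N)+\mathcal Q=0$$ (an identity of sesquilinear forms on the domain of $\mathcal A(S^e)-\mathcal N$) has exactly one bounded Hermitian positive definite solution $\mathcal P$ on $\ell^2(\mathbb C^n)$, and: 1. The state feedback $$S(t)=S^e-\Gamma\,\mathcal G^*(\mathcal X(t))\,\mathcal P\,(X(t)-X^e),\qquad \mathcal G(\mathcal X)=\mathcal T_T(A_{dep})\mathcal X+\mathcal T_T(B_{dep})\mathcal T_T(w),\quad \mathcal X(t)=\mathcal T_T(x)(t)=(X_{k-l}(t))_{k,l},$$ globally asymptotically stabilizes the harmonic model towards $X^e$: for every $t_0$ and every $\xi\in\mathbb C^n$ there is a closed-loop trajectory on $[t_0,\infty)$ whose representative $x$ is continuous with $x(t_0-T)=\xi$; a trajectory is determined by $X(t_0)$; for every $\varepsilon>0$ there is $\delta>0$ such that, for all $t_0$ and all closed-loop trajectories on $[t_0,\infty)$, $\|X(t_0)-X^e\|_{\ell^2}<\delta$ implies $\|X(t)-X^e\|_{\ell^2}<\varepsilon$ for all $t\ge t_0$; and every closed-loop trajectory satisfies $X(t)\to X^e$ in $\ell^2$ as $t\to\infty$. 2. There are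 a continuous $T$-periodic $P:\mathbb R\to\mathbb R^{n\times n}$ with symmetric positive definite values and $\mathcal P=\mathcal T_T(P)$, and a continuous $T$-periodic $x^e:\mathbb R\to\mathbb R^n$ with $X^e=\mathcal F_T(x^e)$, which solves $\dot x^e=A(s^e)x^e+B(s^e)w$. The state feedback $$s(t)=s^e(t)-\gamma(t)\,g(x(t))'P(t)(x(t)-x^e(t)),\qquad g(x(t))=A_{dep}x(t)+B_{dep}w(t),$$ globally asymptotically stabilizes the bilinear affine system towards $x^e$: for all $t_0$ and $x(t_0)\in\mathbb R^n$ the closed loop has exactly one Carathéodory solution on $[t_0,\infty)$; for every $\varepsilon>0$ there is $\delta>0$ such that, for all $t_0$, $|x(t_0)-x^e(t_0)|<\delta$ implies $|x(t)-x^e(t)|<\varepsilon$ for all $t\ge t_0$; and $x(t)-x^e(t)\to0$ as $t\to\infty$ for every solution. -/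

import Mathlib

open MeasureTheory Filter Topology

noncomputable section

namespace HarmonicControl

/-! ### Sequences, infinite block matrices and the sliding Fourier decomposition -/

/-- `ℓ²(ℂ^ι)`: square summable two-sided sequences with values in the Hermitian space `ℂ^ι`. -/
abbrev Ell2 (ι : Type) [Fintype ι] : Type := lp (fun _ : ℤ => EuclideanSpace ℂ ι) 2

/-- The underlying sequence of coordinate vectors of an element of `ℓ²(ℂ^ι)`. -/
def Ell2.coords {ι : Type} [Fintype ι] (X : Ell2 ι) : ℤ → ι → ℂ := fun k i => X k i

/-- Infinite matrices, indexed by `ℤ × ℤ`, whose entries are `ι × κ` complex blocks. -/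
abbrev BlockMatrix (ι κ : Type) : Type := ℤ → ℤ → Matrix ι κ ℂ

/-- The conjugate transpose of an infinite block matrix. -/
def BlockMatrix.adj {ι κ : Type} (M : BlockMatrix ι κ) : BlockMatrix κ ι :=
  fun k l => (M l k).conjTranspose

/-- The product of two infinite block matrices. -/
def BlockMatrix.mul {ι κ μ : Type} [Fintype κ] (M : BlockMatrix ι κ) (N : BlockMatrix κ μ) :
    BlockMatrix ι μ :=
  fun k l => ∑' p : ℤ, M k p * N p l

/-- The product of an infinite block matrix and a two-sided sequence of vectors. -/
def BlockMatrix.act {ι κ : Type} [Fintype κ] (M : BlockMatrix ι κ) (V : ℤ → κ → ℂ) :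
    ℤ → ι → ℂ :=
  fun k => ∑' l : ℤ, (M k l).mulVec (V l)

/-- The block Toeplitz matrix with `(k, l)` block `V (k - l)`. -/
def toeplitzOfSeq {ι κ : Type} (V : ℤ → Matrix ι κ ℂ) : BlockMatrix ι κ := fun k l => V (k - l)

/-- The `k`-th phasor of a scalar signal:
`(1/T) ∫_{t-T}^t f(τ) exp(-j ω k τ) dτ` with `ω = 2π/T`. -/
def phasor (T : ℝ) (f : ℝ → ℂ) (t : ℝ) (k : ℤ) : ℂ :=
  (1 / (T : ℂ)) * ∫ τ in (t - T)..t,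
    f τ * Complex.exp (-(Complex.I * ((2 * Real.pi / T : ℝ) : ℂ) * (k : ℂ) * (τ : ℂ)))

/-- The sliding Fourier decomposition of a vector signal at time `t`. -/
def slidingFourier {ι : Type} (T : ℝ) (x : ℝ → ι → ℂ) (t : ℝ) : ℤ → ι → ℂ :=
  fun k i => phasor T (fun τ => x τ i) t k

/-- The block Toeplitz matrix of a matrix signal at time `t`. -/
def toeplitz {ι κ : Type} (T : ℝ) (A : ℝ → Matrix ι κ ℂ) (t : ℝ) : BlockMatrix ι κ :=
  toeplitzOfSeq fun k => Matrix.of fun i j => phasor T (fun τ => A τ i j) t k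

/-- The complex matrix with the entries of a real matrix. -/
def cMat {ι κ : Type} (A : Matrix ι κ ℝ) : Matrix ι κ ℂ := A.map fun a => (a : ℂ)

/-- The complex vector with the entries of a real vector. -/
def cVec {ι : Type} (v : ι → ℝ) : ι → ℂ := fun i => (v i : ℂ)

/-- A scalar seen as a `1 × 1` matrix. -/
def scalarMat (a : ℂ) : Matrix Unit Unit ℂ := Matrix.of fun _ _ => a

/-! ### The unbounded operator `M - N`, with `N = diag(j ω k Id, k ∈ ℤ)` -/

/-- The graph of the operator `M - N` on `ℓ²` with its maximal domain
`{X ∈ ℓ² : (M - N) X ∈ ℓ²}`. -/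
def HarmGraph {ι : Type} [Fintype ι] (T : ℝ) (M : BlockMatrix ι ι) (X Y : Ell2 ι) : Prop :=
  ∀ (k : ℤ) (i : ι), Y k i =
    M.act X.coords k i - Complex.I * ((2 * Real.pi / T : ℝ) : ℂ) * (k : ℂ) * X k i

/-- `z` is in the resolvent set of `M - N`: the operator `z - (M - N)` is a bijection from its
domain onto `ℓ²`, with bounded inverse. -/
def InResolventSet {ι : Type} [Fintype ι] (T : ℝ) (M : BlockMatrix ι ι) (z : ℂ) : Prop :=
  (∀ X Y : Ell2 ι, HarmGraph T M X Y → z • X - Y = 0 → X = 0) ∧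
  ∃ C : ℝ, ∀ Z : Ell2 ι, ∃ X Y : Ell2 ι, HarmGraph T M X Y ∧ z • X - Y = Z ∧ ‖X‖ ≤ C * ‖Z‖

/-- `M - N` is Hurwitz: its spectrum lies in the open left half plane. -/
def IsHurwitz {ι : Type} [Fintype ι] (T : ℝ) (M : BlockMatrix ι ι) : Prop :=
  ∀ z : ℂ, 0 ≤ z.re → InResolventSet T M z

/-- `P` is a bounded Hermitian positive definite solution of the harmonic Lyapunov equation
`(M - N)^* P + P (M - N) + Q = 0`, the equation being understood as an identity of sesquilinear
forms on the domain of `M - N`. -/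
structure IsLyapunovSolution {ι : Type} [Fintype ι] (T : ℝ) (M Q : BlockMatrix ι ι)
    (P : Ell2 ι →L[ℂ] Ell2 ι) : Prop where
  hermitian : IsSelfAdjoint P
  posDef : ∀ X : Ell2 ι, X ≠ 0 → 0 < (inner ℂ X (P X)).re
  equation : ∀ X X' Y Y' : Ell2 ι, HarmGraph T M X X' → HarmGraph T M Y Y' →
    inner ℂ X' (P Y) + inner ℂ X (P Y')
      + ∑' k : ℤ, ∑ i : ι, star (X k i) * Q.act Y.coords k i = 0

/-! ### The bilinear affine system and its harmonic model -/

/-- The constant matrices of `A(s) = A_ind + s A_dep` and `B(s) = B_ind + s B_dep`. -/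
structure BilinearData (n m : ℕ) where
  Aind : Matrix (Fin n) (Fin n) ℝ
  Adep : Matrix (Fin n) (Fin n) ℝ
  Bind : Matrix (Fin n) (Fin m) ℝ
  Bdep : Matrix (Fin n) (Fin m) ℝ

namespace BilinearData

variable {n m : ℕ} (σ : BilinearData n m)

/-- The right-hand side `A(s) x + B(s) w`. -/
def field (s : ℝ) (w : Fin m → ℝ) (x : Fin n → ℝ) : Fin n → ℝ :=
  (σ.Aind + s • σ.Adep).mulVec x + (σ.Bind + s • σ.Bdep).mulVec w

/-- The vector `g(x) = A_dep x + B_dep w`. -/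
def g (w : Fin m → ℝ) (x : Fin n → ℝ) : Fin n → ℝ := σ.Adep.mulVec x + σ.Bdep.mulVec w

/-- The harmonic matrix `𝒜(S) = 𝒯(A_ind) + 𝒮 ⊗ A_dep`, where `𝒮` is the Toeplitz matrix of the
sequence `S`. -/
def calA (T : ℝ) (S : Ell2 Unit) : BlockMatrix (Fin n) (Fin n) := fun k l =>
  toeplitz T (fun _ => cMat σ.Aind) 0 k l + S (k - l) () • cMat σ.Adep

/-- The harmonic matrix `ℬ(S) = 𝒯(B_ind) + 𝒮 ⊗ B_dep`. -/
def calB (T : ℝ) (S : Ell2 Unit) : BlockMatrix (Fin n) (Fin m) := fun k l =>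
  toeplitz T (fun _ => cMat σ.Bind) 0 k l + S (k - l) () • cMat σ.Bdep

/-- The `k`-th component of `(𝒜(S) - N) X + ℬ(S) W`. -/
def harmonicField (T : ℝ) (W : ℤ → Fin m → ℂ) (S : Ell2 Unit) (X : Ell2 (Fin n)) (k : ℤ) :
    Fin n → ℂ := fun i =>
  (σ.calA T S).act X.coords k i
    - Complex.I * ((2 * Real.pi / T : ℝ) : ℂ) * (k : ℂ) * X k i
    + (σ.calB T S).act W k i

/-- `(X, S, W)` is an equilibrium of the harmonic model. -/
def IsHarmonicEquilibrium (T : ℝ) (W : ℤ → Fin m → ℂ) (S : Ell2 Unit) (X : Ell2 (Fin n)) :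
    Prop :=
  ∀ k : ℤ, σ.harmonicField T W S X k = 0

/-- The matrix `𝒢(𝒳) = 𝒜_dep 𝒳 + ℬ_dep 𝒲`, with `𝒳` and `𝒲` the Toeplitz matrices (with
column blocks) of the sequences `X` and `W`. When `X = ℱ_T(x)(t)`, `𝒳` is `𝒯_T(x)(t)`. -/
def calG (T : ℝ) (W : ℤ → Fin m → ℂ) (X : Ell2 (Fin n)) : BlockMatrix (Fin n) Unit := fun k l =>
  (toeplitz T (fun _ => cMat σ.Adep) 0).mul
      (toeplitzOfSeq fun p => Matrix.replicateCol Unit (X.coords p)) k l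
    + (toeplitz T (fun _ => cMat σ.Bdep) 0).mul
      (toeplitzOfSeq fun p => Matrix.replicateCol Unit (W p)) k l

/-- The harmonic state feedback `S^e - Γ 𝒢(𝒳)^* 𝒫 (X - X^e)`. -/
def harmonicFeedback (T : ℝ) (W : ℤ → Fin m → ℂ) (Γ : BlockMatrix Unit Unit)
    (P : Ell2 (Fin n) →L[ℂ] Ell2 (Fin n)) (Se : Ell2 Unit) (Xe X : Ell2 (Fin n)) :
    ℤ → Unit → ℂ := fun k u =>
  Se k u - Γ.act ((σ.calG T W X).adj.act (P (X - Xe)).coords) k u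

/-- The closed-loop trajectories of the harmonic model on `[t₀, ∞)`: the state `X` and the control
`S` are sliding Fourier decompositions of `L²_loc` signals `x` and `s` defined on `[t₀ - T, ∞)`,
the phasors of `X` (which are absolutely continuous, being integrals) satisfy the harmonic
differential equation almost everywhere, and `S` is given by the state feedback `law`. -/
structure IsHarmonicTrajectory (T : ℝ) (W : ℤ → Fin m → ℂ)
    (law : Ell2 (Fin n) → ℤ → Unit → ℂ) (t₀ : ℝ)
    (x : ℝ → Fin n → ℂ) (s : ℝ → ℂ) (X : ℝ → Ell2 (Fin n)) (S : ℝ → Ell2 Unit) : Prop where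
  memLp_state : ∀ b : ℝ, MemLp x 2 (volume.restrict (Set.Icc (t₀ - T) b))
  memLp_control : ∀ b : ℝ, MemLp s 2 (volume.restrict (Set.Icc (t₀ - T) b))
  state_eq : ∀ t, t₀ ≤ t → (X t).coords = slidingFourier T x t
  control_eq : ∀ t, t₀ ≤ t → (S t).coords = slidingFourier T (fun τ _ => s τ) t
  dynamics : ∀ k : ℤ, ∀ᵐ t : ℝ, t₀ < t →
    HasDerivAt (fun r => (X r).coords k) (σ.harmonicField T W (S t) (X t) k) t
  feedback : ∀ t, t₀ ≤ t → (S t).coords = law (X t)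

/-- The feedback `law` globally asymptotically stabilizes the harmonic model towards `Xe`.
As the state has to be a sliding Fourier decomposition of a signal `x` that solves the system on
`[t₀ - T, ∞)`, the admissible initial states at time `t₀` are parametrized by `x (t₀ - T)`. -/
structure HarmonicGAS (T : ℝ) (W : ℤ → Fin m → ℂ)
    (law : Ell2 (Fin n) → ℤ → Unit → ℂ) (Xe : Ell2 (Fin n)) : Prop where
  exists_trajectory : ∀ (t₀ : ℝ) (ξ : Fin n → ℂ), ∃ x s X S,
    σ.IsHarmonicTrajectory T W law t₀ x s X S ∧
      ContinuousOn x (Set.Ici (t₀ - T)) ∧ x (t₀ - T) = ξ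
  unique_trajectory : ∀ t₀ x s X S y r Y R, σ.IsHarmonicTrajectory T W law t₀ x s X S →
    σ.IsHarmonicTrajectory T W law t₀ y r Y R → X t₀ = Y t₀ → ∀ t, t₀ ≤ t → X t = Y t
  stable : ∀ ε > 0, ∃ δ > 0, ∀ t₀ x s X S, σ.IsHarmonicTrajectory T W law t₀ x s X S →
    ‖X t₀ - Xe‖ < δ → ∀ t, t₀ ≤ t → ‖X t - Xe‖ < ε
  attractive : ∀ t₀ x s X S, σ.IsHarmonicTrajectory T W law t₀ x s X S →
    Tendsto X atTop (𝓝 Xe)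

/-- The time-domain state feedback `s^e(t) - γ(t) g(x)' P(t) (x - x^e(t))`. -/
def feedback (w : ℝ → Fin m → ℝ) (γ : ℝ → ℝ) (P : ℝ → Matrix (Fin n) (Fin n) ℝ)
    (se : ℝ → ℝ) (xe : ℝ → Fin n → ℝ) (t : ℝ) (x : Fin n → ℝ) : ℝ :=
  se t - γ t * dotProduct (σ.g (w t) x) ((P t).mulVec (x - xe t))

end BilinearData

/-! ### Carathéodory solutions and stability in the time domain -/

/-- `x` is a Carathéodory solution of `ẋ = f(t, x)` on `[t₀, ∞)`, in integral form. -/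
def IsForwardSolution {n : ℕ} (f : ℝ → (Fin n → ℝ) → Fin n → ℝ) (t₀ : ℝ) (x : ℝ → Fin n → ℝ) :
    Prop :=
  ∀ t, t₀ ≤ t → IntervalIntegrable (fun r => f r (x r)) volume t₀ t ∧
    x t = x t₀ + ∫ r in t₀..t, f r (x r)

/-- The trajectory `xe` of `ẋ = f(t, x)` is globally asymptotically stable. -/
structure IsGAS {n : ℕ} (f : ℝ → (Fin n → ℝ) → Fin n → ℝ) (xe : ℝ → Fin n → ℝ) : Prop where
  exists_solution : ∀ (t₀ : ℝ) (ξ : Fin n → ℝ), ∃ x, IsForwardSolution f t₀ x ∧ x t₀ = ξ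
  unique_solution : ∀ t₀ x y, IsForwardSolution f t₀ x → IsForwardSolution f t₀ y →
    x t₀ = y t₀ → ∀ t, t₀ ≤ t → x t = y t
  stable : ∀ ε > 0, ∃ δ > 0, ∀ t₀ x, IsForwardSolution f t₀ x → ‖x t₀ - xe t₀‖ < δ →
    ∀ t, t₀ ≤ t → ‖x t - xe t‖ < ε
  attractive : ∀ t₀ x, IsForwardSolution f t₀ x → Tendsto (fun t => x t - xe t) atTop (𝓝 0)

end HarmonicControl

end

/-! The whole statement is moved to the time domain. On each window `(t - T, t]` Parseval and
Riesz–Fischer identify `ℓ²` with square integrable signals. Block Toeplitz matrices become pointwise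
multiplication (`toeplitz_act`), and the operator `𝒜 - N` on its maximal domain becomes `x ↦ A x -
ẋ` on absolutely continuous signals with equal values at the two ends of the window
(`harmGraph_of_primitive`, `HarmGraph.exists_primitive`). The coefficient `A = A(s^e)` is only `L²`,
so derivatives are taken in the sense of indefinite Lebesgue integrals (`IsPrimitiveOn`).

Linear part. Let `Φ` be the fundamental matrix of `A`. An eigenvalue `μ` of `Φ T` with `|μ| ≥ 1`
would yield a Floquet solution in the kernel of `z - (𝒜 - N)` with `z = log μ / T` and `Re z ≥ 0`;
the Hurwitz assumption excludes it, so `Φ T ^ k → 0` (`IsFundamental.tendsto_pow`). Hence the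
discrete Lyapunov equation for `Φ T` is solvable, and transporting its solution along the flow gives
a periodic positive definite `P` with `Ṗ = -(AᵀP + PA + Q)`
(`IsFundamental.exists_periodic_lyapunov`). Multiplication by `P` solves the harmonic equation,
because the derivative of `x^* P y` integrates to zero over a period. For uniqueness, the difference
`D` of two solutions is tested on windowed solutions `φ(t - τ) Φ(t) v`: on these the generator is
differentiation in `τ`, so `⟨X_τ, D Y_τ⟩` is constant in `τ`, while it tends to zero along `τ = jT`;
such elements are total in `ℓ²` (`eq_zero_of_homogeneous_lyapunov`). Since `0` is in the resolvent
set, `X^e` must be the decomposition of the periodic solution `x^e` given by variation of constants.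

Nonlinear part. The error `e = x - x^e` of the closed loop solves `ė = A e - γ (g^* P e) g`, and `V
= e^* P e` satisfies `V̇ = -e^* Q e - 2γ |g^* P e|²` (`isPrimitiveOn_hermForm`). So `V` decreases,
which bounds `e` uniformly. As `Q` need not be bounded below, the decay rate is a positive periodic
function `κ` with `κ P ≤ Q` almost everywhere; its integral diverges, and Grönwall gives `e → 0`.
The a priori bound also turns the local Lipschitz property of the feedback into global existence and
uniqueness, by truncating the feedback outside a ball that no solution leaves.

Harmonic part. If the phasors of `x` solve the harmonic equation, comparing their derivative, which
is a jump `x(t) - x(t - T)`, with integration by parts shows that `x` is almost everywhere a genuine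
solution on `[t₀ - T, ∞)` (`exists_primitive_of_phasor`). The harmonic feedback is the decomposition
of the time-domain feedback, so both closed loops have the same error system, with complex values in
the harmonic case. Stability in `ℓ²` follows by integrating the pointwise estimates over a window.
-/

namespace HarmonicControl

/-! ### Indefinite Lebesgue integrals -/

section Primitive

open Set AbsolutelyContinuousOnInterval

variable {E : Type*} [NormedAddCommGroup E] [NormedSpace ℝ E]

/-- On the set `s`, the function `u` is an indefinite Lebesgue integral of `u'`. -/
def IsPrimitiveOn (s : Set ℝ) (u u' : ℝ → E) : Prop :=
  ∀ a ∈ s, ∀ b ∈ s, IntervalIntegrable u' volume a b ∧ u b - u a = ∫ r in a..b, u' r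

/-- The variation sums of `f` are at most `C` times those of `g`. This serves both for vector-valued
integrals (`g` a scalar integral) and for Lipschitz functions of absolutely continuous ones. -/
theorem absolutelyContinuousOnInterval_of_dist_le {X Y : Type*} [PseudoMetricSpace X]
    [PseudoMetricSpace Y] {f : ℝ → X} {g : ℝ → Y} {a b C : ℝ}
    (hg : AbsolutelyContinuousOnInterval g a b)
    (h : ∀ x ∈ uIcc a b, ∀ y ∈ uIcc a b, dist (f x) (f y) ≤ C * dist (g x) (g y)) :
    AbsolutelyContinuousOnInterval f a b := by
  have h0 : Tendsto (fun E : ℕ × (ℕ → ℝ × ℝ) =>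
      C * ∑ i ∈ Finset.range E.1, dist (g (E.2 i).1) (g (E.2 i).2))
      (totalLengthFilter ⊓ 𝓟 (disjWithin a b)) (𝓝 0) := by
    simpa using Tendsto.const_mul C hg
  refine squeeze_zero' (Eventually.of_forall fun t => Finset.sum_nonneg fun i _ => dist_nonneg)
    ?_ h0
  have : ∀ᶠ E in totalLengthFilter ⊓ 𝓟 (disjWithin a b), E ∈ disjWithin a b :=
    mem_inf_of_right (mem_principal_self _)
  filter_upwards [this] with E hE
  rw [Finset.mul_sum]
  refine Finset.sum_le_sum fun i hi => ?_
  have := hE.1 i hi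
  exact h _ this.1 _ this.2

/-- Reduces to the scalar case: increments of `∫ f` are dominated by increments of `∫ ‖f‖`. -/
theorem absolutelyContinuousOnInterval_integral {f : ℝ → E} {a b : ℝ}
    (h : IntervalIntegrable f volume a b) :
    AbsolutelyContinuousOnInterval (fun x => ∫ v in a..x, f v) a b := by
  refine absolutelyContinuousOnInterval_of_dist_le (C := 1)
    (h.norm.absolutelyContinuousOnInterval_intervalIntegral (c := a) left_mem_uIcc) ?_
  intro x hx y hy
  have hax : IntervalIntegrable f volume a x :=
    h.mono_set (uIcc_subset_uIcc left_mem_uIcc hx)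
  have hay : IntervalIntegrable f volume a y :=
    h.mono_set (uIcc_subset_uIcc left_mem_uIcc hy)
  rw [one_mul, dist_eq_norm, dist_eq_norm, intervalIntegral.integral_interval_sub_left hax hay,
    intervalIntegral.integral_interval_sub_left hax.norm hay.norm]
  exact intervalIntegral.norm_integral_le_abs_integral_norm

/-- `F - ∫ f` is absolutely continuous with zero derivative almost everywhere, hence constant.
Through this criterion the product and exponential rules below follow from the pointwise ones. -/
theorem sub_eq_integral_of_ae_hasDerivAt [CompleteSpace E] {F f : ℝ → E} {a b : ℝ}
    (hF : AbsolutelyContinuousOnInterval F a b) (hf : IntervalIntegrable f volume a b)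
    (hd : ∀ᵐ x, x ∈ uIcc a b → HasDerivAt F (f x) x) :
    F b - F a = ∫ r in a..b, f r := by
  have h1 := hF.sub (absolutelyContinuousOnInterval_integral hf)
  obtain ⟨C, hC⟩ := h1.const_of_ae_hasDerivAt_zero (by
    filter_upwards [hd, hf.ae_hasDerivAt_integral] with x hx hx' hxab
    simpa using (hx hxab).sub (hx' hxab a left_mem_uIcc))
  have ha := hC a left_mem_uIcc
  have hb := hC b right_mem_uIcc
  simp only [Pi.sub_apply, intervalIntegral.integral_same, sub_zero] at ha hb
  rw [ha, ← hb]; abel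

namespace IsPrimitiveOn

variable {s t : Set ℝ} {u u' v v' : ℝ → E}

theorem mono (h : IsPrimitiveOn s u u') (hst : t ⊆ s) : IsPrimitiveOn t u u' :=
  fun a ha b hb => h a (hst ha) b (hst hb)

theorem intervalIntegrable (h : IsPrimitiveOn s u u') {a b : ℝ} (ha : a ∈ s) (hb : b ∈ s) :
    IntervalIntegrable u' volume a b := (h a ha b hb).1

theorem sub_eq (h : IsPrimitiveOn s u u') {a b : ℝ} (ha : a ∈ s) (hb : b ∈ s) :
    u b - u a = ∫ r in a..b, u' r := (h a ha b hb).2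

theorem eq_add (h : IsPrimitiveOn s u u') {a b : ℝ} (ha : a ∈ s) (hb : b ∈ s) :
    u b = u a + ∫ r in a..b, u' r := by rw [← h.sub_eq ha hb]; abel

theorem of_base {a : ℝ} (h : ∀ b ∈ s, IntervalIntegrable u' volume a b ∧
    u b = u a + ∫ r in a..b, u' r) : IsPrimitiveOn s u u' := by
  intro b hb c hc
  refine ⟨(h b hb).1.symm.trans (h c hc).1, ?_⟩
  rw [(h b hb).2, (h c hc).2, ← intervalIntegral.integral_interval_sub_left (h c hc).1 (h b hb).1]
  abel

theorem congr [s.OrdConnected] (h : IsPrimitiveOn s u u') (hu : ∀ t ∈ s, u t = v t)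
    (hu' : ∀ᵐ t, t ∈ s → u' t = v' t) : IsPrimitiveOn s v v' := by
  intro a ha b hb
  have hab : uIoc a b ⊆ s := uIoc_subset_uIcc.trans (OrdConnected.uIcc_subset ‹_› ha hb)
  have h1 : ∀ᵐ t, t ∈ uIoc a b → u' t = v' t := by
    filter_upwards [hu'] with t ht hts using ht (hab hts)
  refine ⟨(h a ha b hb).1.congr_ae ((ae_restrict_iff' measurableSet_uIoc).2 h1), ?_⟩
  rw [← hu a ha, ← hu b hb, ← intervalIntegral.integral_congr_ae h1]
  exact (h a ha b hb).2

theorem congr_deriv [s.OrdConnected] (h : IsPrimitiveOn s u u')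
    (hu' : ∀ t ∈ s, u' t = v' t) : IsPrimitiveOn s u v' :=
  h.congr (fun _ _ => rfl) (Eventually.of_forall hu')

theorem absolutelyContinuousOnInterval [s.OrdConnected] (h : IsPrimitiveOn s u u') {a b : ℝ}
    (ha : a ∈ s) (hb : b ∈ s) : AbsolutelyContinuousOnInterval u a b := by
  have hab := OrdConnected.uIcc_subset ‹_› ha hb
  refine absolutelyContinuousOnInterval_of_dist_le (C := 1)
    (absolutelyContinuousOnInterval_integral (h a ha b hb).1) ?_
  intro x hx y hy
  rw [h.eq_add ha (hab hx), h.eq_add ha (hab hy)]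
  simp

theorem ae_hasDerivAt [CompleteSpace E] [s.OrdConnected] (h : IsPrimitiveOn s u u') {a b : ℝ}
    (ha : a ∈ s) (hb : b ∈ s) : ∀ᵐ x, x ∈ uIcc a b → HasDerivAt u (u' x) x := by
  -- Nothing is known about `u` outside `s`, so the two endpoints, which may have no neighbourhood
  -- in `s`, are discarded.
  have h1 : ∀ᵐ x, x ≠ min a b := by simp [ae_iff, measure_singleton]
  have h2 : ∀ᵐ x, x ≠ max a b := by simp [ae_iff, measure_singleton]
  filter_upwards [(h a ha b hb).1.ae_hasDerivAt_integral, h1, h2] with x hx h1 h2 hxab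
  have h3 := (hx hxab a left_mem_uIcc).const_add (u a)
  refine h3.congr_of_eventuallyEq ?_
  have : Icc (min a b) (max a b) ∈ 𝓝 x :=
    Icc_mem_nhds (lt_of_le_of_ne hxab.1 (Ne.symm h1)) (lt_of_le_of_ne hxab.2 h2)
  filter_upwards [this] with y hy
  exact h.eq_add ha (OrdConnected.uIcc_subset ‹_› ha hb hy)

theorem of_hasDerivAt [CompleteSpace E] (hu : ∀ t, HasDerivAt u (u' t) t) (hc : Continuous u') :
    IsPrimitiveOn s u u' := fun a _ b _ =>
  ⟨hc.intervalIntegrable a b, (intervalIntegral.integral_eq_sub_of_hasDerivAt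
    (fun x _ => hu x) (hc.intervalIntegrable a b)).symm⟩

theorem const (c : E) : IsPrimitiveOn s (fun _ => c) (fun _ => 0) :=
  fun a _ b _ => ⟨by simp, by simp⟩

theorem add (hu : IsPrimitiveOn s u u') (hv : IsPrimitiveOn s v v') :
    IsPrimitiveOn s (fun t => u t + v t) (fun t => u' t + v' t) := fun a ha b hb => by
  refine ⟨(hu a ha b hb).1.add (hv a ha b hb).1, ?_⟩
  rw [intervalIntegral.integral_add (hu a ha b hb).1 (hv a ha b hb).1, ← hu.sub_eq ha hb,
    ← hv.sub_eq ha hb]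
  exact add_sub_add_comm _ _ _ _

theorem neg (hu : IsPrimitiveOn s u u') : IsPrimitiveOn s (fun t => -u t) (fun t => -u' t) :=
  fun a ha b hb => by
  refine ⟨(hu a ha b hb).1.neg, ?_⟩
  rw [intervalIntegral.integral_neg, ← hu.sub_eq ha hb]
  exact (neg_sub' _ _).symm

theorem sub (hu : IsPrimitiveOn s u u') (hv : IsPrimitiveOn s v v') :
    IsPrimitiveOn s (fun t => u t - v t) (fun t => u' t - v' t) := by
  simpa [sub_eq_add_neg] using hu.add hv.neg

theorem sum {ι : Type*} (S : Finset ι) {u u' : ι → ℝ → E}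
    (h : ∀ i ∈ S, IsPrimitiveOn s (u i) (u' i)) :
    IsPrimitiveOn s (fun t => ∑ i ∈ S, u i t) (fun t => ∑ i ∈ S, u' i t) := fun a ha b hb => by
  refine ⟨by simpa only [Finset.sum_fn] using
    IntervalIntegrable.sum S fun i hi => (h i hi a ha b hb).1, ?_⟩
  rw [intervalIntegral.integral_finsetSum fun i hi => (h i hi a ha b hb).1,
    ← Finset.sum_sub_distrib]
  exact Finset.sum_congr rfl fun i hi => (h i hi).sub_eq ha hb

theorem clm_comp [CompleteSpace E] {F : Type*} [NormedAddCommGroup F] [NormedSpace ℝ F]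
    [CompleteSpace F]
    (L : E →L[ℝ] F) (hu : IsPrimitiveOn s u u') :
    IsPrimitiveOn s (fun t => L (u t)) (fun t => L (u' t)) := fun a ha b hb => by
  have hi := (hu a ha b hb).1
  refine ⟨⟨L.integrable_comp hi.1, L.integrable_comp hi.2⟩, ?_⟩
  rw [L.intervalIntegral_comp_comm hi, ← hu.sub_eq ha hb, map_sub]

theorem continuousOn [s.OrdConnected] (h : IsPrimitiveOn s u u') : ContinuousOn u s := by
  intro x hx
  by_cases h1 : ∃ a ∈ s, a < x
  · obtain ⟨a, has, hax⟩ := h1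
    by_cases h2 : ∃ b ∈ s, x < b
    · obtain ⟨b, hbs, hxb⟩ := h2
      have := (h.absolutelyContinuousOnInterval has hbs).continuousOn
      exact (this.continuousAt (by
        rw [uIcc_of_le (hax.trans hxb).le]; exact Icc_mem_nhds hax hxb)).continuousWithinAt
    · push Not at h2
      have := (h.absolutelyContinuousOnInterval has hx).continuousOn x right_mem_uIcc
      rw [uIcc_of_le hax.le] at this
      refine this.mono_of_mem_nhdsWithin ?_
      filter_upwards [self_mem_nhdsWithin, mem_nhdsWithin_of_mem_nhds (Ioi_mem_nhds hax)]
        with y hy hy' using ⟨le_of_lt hy', h2 y hy⟩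
  · push Not at h1
    by_cases h2 : ∃ b ∈ s, x < b
    · obtain ⟨b, hbs, hxb⟩ := h2
      have := (h.absolutelyContinuousOnInterval hx hbs).continuousOn x left_mem_uIcc
      rw [uIcc_of_le hxb.le] at this
      refine this.mono_of_mem_nhdsWithin ?_
      filter_upwards [self_mem_nhdsWithin, mem_nhdsWithin_of_mem_nhds (Iio_mem_nhds hxb)]
        with y hy hy' using ⟨h1 y hy, le_of_lt hy'⟩
    · push Not at h2
      have : s ⊆ {x} := fun y hy => le_antisymm (h2 y hy) (h1 y hy)
      exact (continuousWithinAt_singleton).mono this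

theorem continuous (h : IsPrimitiveOn univ u u') : Continuous u :=
  continuousOn_univ.1 h.continuousOn

theorem mul {𝕜 : Type*} [RCLike 𝕜] {u u' v v' : ℝ → 𝕜} [s.OrdConnected]
    (hu : IsPrimitiveOn s u u') (hv : IsPrimitiveOn s v v') :
    IsPrimitiveOn s (fun t => u t * v t) (fun t => u' t * v t + u t * v' t) := by
  intro a ha b hb
  have hau := hu.absolutelyContinuousOnInterval ha hb
  have hav := hv.absolutelyContinuousOnInterval ha hb
  have hi : IntervalIntegrable (fun t => u' t * v t + u t * v' t) volume a b :=
    ((hu a ha b hb).1.mul_continuousOn hav.continuousOn).add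
      ((hv a ha b hb).1.continuousOn_mul hau.continuousOn)
  refine ⟨hi, sub_eq_integral_of_ae_hasDerivAt (hau.smul hav) hi ?_⟩
  filter_upwards [hu.ae_hasDerivAt ha hb, hv.ae_hasDerivAt ha hb] with x hx hx' hxab
  exact (hx hxab).mul (hx' hxab)

theorem exp {u u' : ℝ → ℝ} [s.OrdConnected] (hu : IsPrimitiveOn s u u') :
    IsPrimitiveOn s (fun t => Real.exp (u t)) (fun t => Real.exp (u t) * u' t) := by
  intro a ha b hb
  have hau := hu.absolutelyContinuousOnInterval ha hb
  have hi : IntervalIntegrable (fun t => Real.exp (u t) * u' t) volume a b :=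
    (hu a ha b hb).1.continuousOn_mul (Real.continuous_exp.comp_continuousOn hau.continuousOn)
  -- The exponential is Lipschitz on the bounded range of `u`, so the composition remains absolutely
  -- continuous.
  obtain ⟨R, hR⟩ := hau.exists_bound
  obtain ⟨K, hK⟩ := (Real.contDiff_exp (n := 1)).contDiffOn.exists_lipschitzOnWith
    (s := Icc (-R) R) (by decide) (convex_Icc _ _) isCompact_Icc
  have hac : AbsolutelyContinuousOnInterval (fun t => Real.exp (u t)) a b :=
    absolutelyContinuousOnInterval_of_dist_le (C := K) hau fun x hx y hy =>
      hK.dist_le_mul _ (abs_le.1 (hR x hx)) _ (abs_le.1 (hR y hy))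
  refine ⟨hi, sub_eq_integral_of_ae_hasDerivAt hac hi ?_⟩
  filter_upwards [hu.ae_hasDerivAt ha hb] with x hx hxab
  exact (hx hxab).exp

theorem of_integral {a : ℝ} (h : ∀ b ∈ s, IntervalIntegrable u' volume a b) (c : E) :
    IsPrimitiveOn s (fun t => c + ∫ r in a..t, u' r) u' :=
  of_base (a := a) fun b hb => ⟨h b hb, by simp⟩

theorem antitoneOn {u u' : ℝ → ℝ} [s.OrdConnected] (hu : IsPrimitiveOn s u u')
    (h : ∀ᵐ t, t ∈ s → u' t ≤ 0) : AntitoneOn u s := by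
  intro a ha b hb hab
  have hs : Icc a b ⊆ s := OrdConnected.out ‹_› ha hb
  have h2 : u b - u a ≤ 0 := by
    rw [hu.sub_eq ha hb]
    have := intervalIntegral.integral_mono_ae_restrict (g := fun _ => (0 : ℝ)) hab
      (hu a ha b hb).1 (by simp)
      ((ae_restrict_iff' measurableSet_Icc).2 (by
        filter_upwards [h] with t ht htm using ht (hs htm)))
    simpa using this
  linarith

/-- Grönwall's inequality for indefinite Lebesgue integrals. -/
theorem le_mul_exp {u u' k : ℝ → ℝ} [s.OrdConnected] (hu : IsPrimitiveOn s u u') {a b : ℝ}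
    (ha : a ∈ s) (hb : b ∈ s) (hab : a ≤ b) (hk : ∀ c ∈ s, IntervalIntegrable k volume a c)
    (h : ∀ᵐ t, t ∈ s → u' t ≤ k t * u t) : u b ≤ u a * Real.exp (∫ r in a..b, k r) := by
  have hK : IsPrimitiveOn s (fun t => 0 + ∫ r in a..t, k r) k := of_integral hk 0
  simp only [zero_add] at hK
  -- The integrating factor: `u exp(-∫ k)` has derivative `(u' - k u) exp(-∫ k) ≤ 0`.
  have hW := hu.mul hK.neg.exp
  have hanti := hW.antitoneOn (by
    filter_upwards [h] with t ht hts
    have := ht hts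
    have he := Real.exp_pos (-∫ r in a..t, k r)
    nlinarith) ha hb hab
  simp only [intervalIntegral.integral_same, neg_zero, Real.exp_zero, mul_one] at hanti
  have he := Real.exp_pos (∫ r in a..b, k r)
  calc u b = u b * Real.exp (-∫ r in a..b, k r) * Real.exp (∫ r in a..b, k r) := by
        rw [mul_assoc, ← Real.exp_add]; simp
    _ ≤ _ := by gcongr

end IsPrimitiveOn

end Primitive

end HarmonicControl

namespace HarmonicControl

/-! ### Carathéodory differential equations -/

section Caratheodory

open Set

variable {E : Type*} [NormedAddCommGroup E] [NormedSpace ℝ E]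

/-- To the right of `a` the weight `ρ = exp(2 |∫ k|)` satisfies `ρ' = 2kρ`, so the integral is `(ρ -
1)/2`; the left side is symmetric. The factor `1/2` becomes the contraction constant of the Picard
operator. -/
theorem abs_integral_mul_exp_abs_le {k : ℝ → ℝ} (hk : ∀ a b, IntervalIntegrable k volume a b)
    (hk0 : ∀ t, 0 ≤ k t) (a t : ℝ) :
    |∫ r in a..t, k r * Real.exp (2 * |∫ q in a..r, k q|)| ≤
      Real.exp (2 * |∫ q in a..t, k q|) / 2 := by
  have hK : IsPrimitiveOn univ (fun t => 0 + ∫ r in a..t, k r) k :=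
    IsPrimitiveOn.of_integral (fun b _ => hk a b) 0
  simp only [zero_add] at hK
  rcases le_total a t with hat | hat
  · have h0 : ∀ r, a ≤ r → |∫ q in a..r, k q| = ∫ q in a..r, k q := fun r hr =>
      abs_of_nonneg (intervalIntegral.integral_nonneg hr fun u _ => hk0 u)
    have h1 := (hK.add hK).exp.sub_eq (mem_univ a) (mem_univ t)
    have h2 : ∫ r in a..t, k r * Real.exp (2 * |∫ q in a..r, k q|) =
        (∫ r in a..t, Real.exp ((∫ q in a..r, k q) + ∫ q in a..r, k q) * (k r + k r)) / 2 := by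
      rw [← intervalIntegral.integral_div]
      refine intervalIntegral.integral_congr fun r hr => ?_
      rw [uIcc_of_le hat] at hr
      simp only [h0 r hr.1, ← two_mul]
      ring
    rw [h2, ← h1, h0 t hat, ← two_mul]
    simp only [intervalIntegral.integral_same, add_zero, Real.exp_zero]
    have h3 : 1 ≤ Real.exp (2 * ∫ q in a..t, k q) := by
      rw [Real.one_le_exp_iff, ← h0 t hat]; positivity
    rw [abs_of_nonneg (by linarith)]
    linarith
  · have h0 : ∀ r, r ≤ a → |∫ q in a..r, k q| = -∫ q in a..r, k q := fun r hr => by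
      rw [intervalIntegral.integral_symm, abs_neg, neg_neg]
      exact abs_of_nonneg (intervalIntegral.integral_nonneg hr fun u _ => hk0 u)
    have h1 := (hK.add hK).neg.exp.sub_eq (mem_univ a) (mem_univ t)
    have h2 : ∫ r in a..t, k r * Real.exp (2 * |∫ q in a..r, k q|) =
        -(∫ r in a..t, Real.exp (-((∫ q in a..r, k q) + ∫ q in a..r, k q)) * -(k r + k r)) / 2 := by
      rw [← intervalIntegral.integral_neg, ← intervalIntegral.integral_div]
      refine intervalIntegral.integral_congr fun r hr => ?_
      rw [uIcc_of_ge hat] at hr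
      simp only [h0 r hr.2, ← two_mul, mul_neg]
      ring
    rw [h2, ← h1, h0 t hat, ← two_mul]
    simp only [intervalIntegral.integral_same, add_zero, neg_zero, Real.exp_zero, mul_neg]
    have h3 : 1 ≤ Real.exp (-(2 * ∫ q in a..t, k q)) := by
      rw [Real.one_le_exp_iff, ← mul_neg, ← h0 t hat]; positivity
    rw [abs_of_nonpos (by linarith)]
    linarith

/-- Global existence for a Carathéodory differential equation whose right-hand side is globally
Lipschitz in the state with a locally integrable constant. -/
theorem exists_primitive_of_lipschitz [CompleteSpace E] {f : ℝ → E → E} {k : ℝ → ℝ}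
    (hk : ∀ a b, IntervalIntegrable k volume a b) (hk0 : ∀ t, 0 ≤ k t)
    (hlip : ∀ᵐ t, ∀ x y, ‖f t x - f t y‖ ≤ k t * ‖x - y‖)
    (hzero : ∀ᵐ t, ‖f t 0‖ ≤ k t)
    (hmeas : ∀ u : ℝ → E, Continuous u → AEStronglyMeasurable (fun t => f t (u t)) volume)
    (a : ℝ) (ξ : E) :
    ∃ x : ℝ → E, x a = ξ ∧ IsPrimitiveOn univ x (fun t => f t (x t)) := by
  -- A weighted sup norm: the solution is sought as `ρ u` with `u` bounded and continuous. In this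
  -- norm the Picard operator contracts on the whole line at once, so no continuation argument is
  -- needed.
  set ρ : ℝ → ℝ := fun t => Real.exp (2 * |∫ q in a..t, k q|) with hρ
  have hρc : Continuous ρ := by
    have : Continuous fun t => ∫ q in a..t, k q := intervalIntegral.continuous_primitive hk a
    fun_prop
  have hρ1 : ∀ t, 1 ≤ ρ t := fun t => by rw [hρ]; simp only [Real.one_le_exp_iff]; positivity
  have hρ0 : ∀ t, 0 < ρ t := fun t => lt_of_lt_of_le one_pos (hρ1 t)
  have hkρ : ∀ c b, IntervalIntegrable (fun r => k r * ρ r) volume c b := fun c b =>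
    (hk c b).mul_continuousOn hρc.continuousOn
  have hint : ∀ u : BoundedContinuousFunction ℝ E, ∀ c b,
      IntervalIntegrable (fun r => f r (ρ r • u r)) volume c b := by
    intro u c b
    refine IntervalIntegrable.mono_fun ((hkρ c b).mul_const (1 + ‖u‖))
      (hmeas _ (hρc.smul u.continuous)).restrict (ae_restrict_of_ae ?_)
    filter_upwards [hlip, hzero] with t h1 h2
    have h3 := h1 (ρ t • u t) 0
    rw [sub_zero, norm_smul, Real.norm_of_nonneg (hρ0 t).le] at h3
    have h4 : ‖f t (ρ t • u t)‖ ≤ ‖f t (ρ t • u t) - f t 0‖ + ‖f t 0‖ := by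
      simpa using norm_add_le (f t (ρ t • u t) - f t 0) (f t 0)
    have h5 := u.norm_coe_le_norm t
    rw [Real.norm_of_nonneg (mul_nonneg (mul_nonneg (hk0 t) (hρ0 t).le) (by positivity))]
    calc _ ≤ k t * (ρ t * ‖u t‖) + k t := h4.trans (add_le_add h3 h2)
      _ ≤ k t * (ρ t * ‖u‖) + k t * ρ t := by
        have := hk0 t; have := (hρ0 t).le
        gcongr; exact le_mul_of_one_le_right (hk0 t) (hρ1 t)
      _ = _ := by ring
  have hcont : ∀ u : BoundedContinuousFunction ℝ E,
      Continuous fun t => (ρ t)⁻¹ • (ξ + ∫ r in a..t, f r (ρ r • u r)) := fun u =>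
    (hρc.inv₀ fun t => (hρ0 t).ne').smul
      (continuous_const.add (intervalIntegral.continuous_primitive (hint u) a))
  have hdiff : ∀ u v : BoundedContinuousFunction ℝ E, ∀ t,
      ‖(∫ r in a..t, f r (ρ r • u r)) - ∫ r in a..t, f r (ρ r • v r)‖ ≤
        ρ t / 2 * ‖u - v‖ := by
    intro u v t
    rw [← intervalIntegral.integral_sub (hint u a t) (hint v a t)]
    have h1 : ‖∫ r in a..t, (f r (ρ r • u r) - f r (ρ r • v r))‖ ≤
        |∫ r in a..t, k r * ρ r * ‖u - v‖| := by
      refine intervalIntegral.norm_integral_le_abs_of_norm_le (ae_restrict_of_ae ?_)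
        ((hkρ a t).mul_const _)
      filter_upwards [hlip] with r h
      refine (h _ _).trans ?_
      rw [← smul_sub, norm_smul, Real.norm_of_nonneg (hρ0 r).le, ← mul_assoc]
      have := hk0 r; have := (hρ0 r).le
      gcongr
      exact (u - v).norm_coe_le_norm r
    refine h1.trans ?_
    rw [intervalIntegral.integral_mul_const, abs_mul, abs_of_nonneg (norm_nonneg (u - v))]
    gcongr
    exact abs_integral_mul_exp_abs_le hk hk0 a t
  have hbound0 : ∃ C, ∀ t, ‖(ρ t)⁻¹ • (ξ + ∫ r in a..t, f r (ρ r • (0 : ℝ → E) r))‖ ≤ C := by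
    refine ⟨‖ξ‖ + 1 / 2, fun t => ?_⟩
    have h1 : ‖∫ r in a..t, f r (ρ r • (0 : ℝ → E) r)‖ ≤ |∫ r in a..t, k r * ρ r| := by
      refine intervalIntegral.norm_integral_le_abs_of_norm_le (ae_restrict_of_ae ?_) (hkρ a t)
      filter_upwards [hzero] with r h
      simpa using h.trans (le_mul_of_one_le_right (hk0 r) (hρ1 r))
    have h2 := h1.trans (abs_integral_mul_exp_abs_le hk hk0 a t)
    rw [norm_smul, norm_inv, Real.norm_of_nonneg (hρ0 t).le, inv_mul_le_iff₀ (hρ0 t)]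
    refine (norm_add_le _ _).trans ?_
    have h3 : ‖ξ‖ ≤ ρ t * ‖ξ‖ := le_mul_of_one_le_left (norm_nonneg _) (hρ1 t)
    change _ ≤ ρ t / 2 at h2
    linarith
  have hdiff' : ∀ u v : BoundedContinuousFunction ℝ E, ∀ t,
      ‖(ρ t)⁻¹ • (ξ + ∫ r in a..t, f r (ρ r • u r)) -
        (ρ t)⁻¹ • (ξ + ∫ r in a..t, f r (ρ r • v r))‖ ≤ 1 / 2 * ‖u - v‖ := by
    intro u v t
    rw [← smul_sub, add_sub_add_left_eq_sub, norm_smul, norm_inv,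
      Real.norm_of_nonneg (hρ0 t).le, inv_mul_le_iff₀ (hρ0 t)]
    exact (hdiff u v t).trans_eq (by ring)
  obtain ⟨C, hC⟩ := hbound0
  -- The Picard operator in the variable `u`; its values are bounded because `Ψ 0` is, and `Ψ u`
  -- differs from it by at most `‖u‖ / 2`.
  let Ψ : BoundedContinuousFunction ℝ E → BoundedContinuousFunction ℝ E := fun u =>
    BoundedContinuousFunction.ofNormedAddCommGroup _ (hcont u) (C + 1 / 2 * ‖u - 0‖) fun t => by
      have h1 := hdiff' u 0 t
      have h2 := hC t
      rw [norm_sub_rev] at h1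
      simp only [BoundedContinuousFunction.coe_zero] at h1
      exact (norm_le_norm_add_norm_sub _ _).trans (add_le_add h2 h1)
  have hΨ : ContractingWith (1 / 2) Ψ := by
    refine ⟨by rw [← NNReal.coe_lt_coe]; norm_num, LipschitzWith.of_dist_le_mul fun u v => ?_⟩
    rw [BoundedContinuousFunction.dist_le (by positivity)]
    intro t
    rw [dist_eq_norm, dist_eq_norm]
    exact (hdiff' u v t).trans_eq (by norm_num)
  obtain ⟨u, hu⟩ : ∃ u, Ψ u = u := ⟨_, hΨ.fixedPoint_isFixedPt⟩
  have hu' : ∀ t, ρ t • u t = ξ + ∫ r in a..t, f r (ρ r • u r) := fun t => by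
    have : (Ψ u) t = u t := by rw [hu]
    rw [← this]
    exact smul_inv_smul₀ (hρ0 t).ne' _
  have ha : ρ a • u a = ξ := by rw [hu']; simp
  refine ⟨fun t => ρ t • u t, ha, IsPrimitiveOn.of_base (a := a) fun b _ => ⟨hint u a b, ?_⟩⟩
  simp only [ha]
  exact hu' b

/-- Grönwall is applied to `U = ∫ k ‖d‖` rather than to `‖d‖`: it dominates `‖d‖`, satisfies `U' ≤ k
U`, and starts at zero. -/
theorem IsPrimitiveOn.eq_zero_of_norm_le [CompleteSpace E] {s : Set ℝ} [s.OrdConnected]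
    {d d' : ℝ → E} {k : ℝ → ℝ}
    (hd : IsPrimitiveOn s d d') {a b : ℝ} (ha : a ∈ s) (hb : b ∈ s) (hab : a ≤ b)
    (hk : IntervalIntegrable k volume a b) (hk0 : ∀ t, 0 ≤ k t)
    (h : ∀ᵐ t, t ∈ s → ‖d' t‖ ≤ k t * ‖d t‖) (h0 : d a = 0) : d b = 0 := by
  have hs : Icc a b ⊆ s := OrdConnected.out ‹_› ha hb
  have hdc : ContinuousOn d (Icc a b) := hd.continuousOn.mono hs
  have hi : IntervalIntegrable (fun t => k t * ‖d t‖) volume a b :=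
    hk.mul_continuousOn (by rw [uIcc_of_le hab]; exact hdc.norm)
  have hsub : ∀ c ∈ Icc a b, uIcc a c ⊆ uIcc a b := fun c hc =>
    uIcc_subset_uIcc left_mem_uIcc (by rwa [uIcc_of_le hab])
  have hU : IsPrimitiveOn (Icc a b) (fun t => 0 + ∫ r in a..t, k r * ‖d r‖)
      (fun t => k t * ‖d t‖) := IsPrimitiveOn.of_integral (fun c hc => hi.mono_set (hsub c hc)) 0
  simp only [zero_add] at hU
  have hle : ∀ t ∈ Icc a b, ‖d t‖ ≤ ∫ r in a..t, k r * ‖d r‖ := by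
    intro t ht
    have h1 := hd.eq_add ha (hs ht)
    rw [h0, zero_add] at h1
    rw [h1]
    refine intervalIntegral.norm_integral_le_of_norm_le ht.1 ?_ (hi.mono_set (hsub t ht))
    filter_upwards [h] with r hr hrt using hr (hs ⟨hrt.1.le, hrt.2.trans ht.2⟩)
  have h2 := hU.le_mul_exp (left_mem_Icc.2 hab) (right_mem_Icc.2 hab) hab (k := k)
    (fun c hc => hk.mono_set (hsub c hc))
    (Eventually.of_forall fun t ht => mul_le_mul_of_nonneg_left (hle t ht) (hk0 t))
  simp only [intervalIntegral.integral_same, zero_mul] at h2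
  exact norm_le_zero_iff.1 ((hle b (right_mem_Icc.2 hab)).trans h2)

end Caratheodory

end HarmonicControl

namespace HarmonicControl

/-! ### Fourier analysis on a sliding window -/

section Fourier

open Set

variable {T : ℝ}

/-- The scalar signal `f` is square integrable on the window `(t - T, t]`. -/
abbrev WindowL2 (T t : ℝ) (f : ℝ → ℂ) : Prop :=
  MemLp f 2 (volume.restrict (Ioc (t - T) t))

/-- The exponential `exp (-j ω k τ)`. -/
noncomputable def expo (T : ℝ) (k : ℤ) (τ : ℝ) : ℂ :=
  Complex.exp (-(Complex.I * ((2 * Real.pi / T : ℝ) : ℂ) * (k : ℂ) * (τ : ℂ)))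

theorem phasor_def (T : ℝ) (f : ℝ → ℂ) (t : ℝ) (k : ℤ) :
    phasor T f t k = (1 / (T : ℂ)) * ∫ τ in (t - T)..t, f τ * expo T k τ := rfl

theorem continuous_expo (T : ℝ) (k : ℤ) : Continuous (expo T k) := by
  unfold expo; fun_prop

theorem hasDerivAt_expo (T : ℝ) (k : ℤ) (τ : ℝ) :
    HasDerivAt (expo T k)
      (-(Complex.I * ((2 * Real.pi / T : ℝ) : ℂ) * (k : ℂ)) * expo T k τ) τ := by
  have h1 : HasDerivAt (fun τ : ℝ => -(Complex.I * ((2 * Real.pi / T : ℝ) : ℂ) * (k : ℂ) * (τ : ℂ)))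
      (-(Complex.I * ((2 * Real.pi / T : ℝ) : ℂ) * (k : ℂ) * 1)) τ :=
    ((Complex.ofRealCLM.hasDerivAt (x := τ)).const_mul _).neg
  have := h1.cexp
  rw [mul_one, mul_comm (Complex.exp _)] at this
  exact this

theorem expo_zero (T : ℝ) (τ : ℝ) : expo T 0 τ = 1 := by simp [expo]

theorem expo_sub (T : ℝ) (k l : ℤ) (τ : ℝ) :
    expo T (k - l) τ = expo T k τ * star (expo T l τ) := by
  have h : star (expo T l τ) =
      Complex.exp (Complex.I * ((2 * Real.pi / T : ℝ) : ℂ) * (l : ℂ) * (τ : ℂ)) := by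
    rw [expo, RCLike.star_def, ← Complex.exp_conj]
    simp only [map_neg, map_mul, Complex.conj_I, Complex.conj_ofReal, map_intCast, neg_mul, neg_neg]
  rw [h, expo, expo, ← Complex.exp_add]
  congr 1
  push_cast
  ring

theorem expo_periodic (hT : T ≠ 0) (k : ℤ) : Function.Periodic (expo T k) T := by
  intro τ
  have h1 : -(Complex.I * ((2 * Real.pi / T : ℝ) : ℂ) * (k : ℂ) * ((τ + T : ℝ) : ℂ)) =
      -(Complex.I * ((2 * Real.pi / T : ℝ) : ℂ) * (k : ℂ) * (τ : ℂ)) -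
        k * (2 * Real.pi * Complex.I) := by
    have : (T : ℂ) ≠ 0 := by exact_mod_cast hT
    push_cast
    field_simp
    ring
  rw [expo, h1, expo]
  exact Complex.exp_periodic.sub_int_mul_eq k

theorem phasor_congr_ae {f g : ℝ → ℂ} {t : ℝ} (hT : 0 ≤ T)
    (h : ∀ᵐ τ, τ ∈ Ioc (t - T) t → f τ = g τ) (k : ℤ) : phasor T f t k = phasor T g t k := by
  rw [phasor_def, phasor_def]
  congr 1
  refine intervalIntegral.integral_congr_ae ?_
  rw [uIoc_of_le (by linarith)]
  filter_upwards [h] with τ hτ hm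
  rw [hτ hm]

theorem phasor_eq_of_periodic {f : ℝ → ℂ} (hT : T ≠ 0) (hf : Function.Periodic f T) (t s : ℝ)
    (k : ℤ) : phasor T f t k = phasor T f s k := by
  rw [phasor_def, phasor_def]
  congr 1
  have := (hf.mul (expo_periodic hT k)).intervalIntegral_add_eq (t - T) (s - T)
  simpa using this

theorem intervalIntegrable_mul_expo {f : ℝ → ℂ} {a b : ℝ} (hf : IntervalIntegrable f volume a b)
    (k : ℤ) : IntervalIntegrable (fun τ => f τ * expo T k τ) volume a b :=
  hf.mul_continuousOn (continuous_expo T k).continuousOn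

theorem phasor_add {f g : ℝ → ℂ} {t : ℝ} (hf : IntervalIntegrable f volume (t - T) t)
    (hg : IntervalIntegrable g volume (t - T) t) (k : ℤ) :
    phasor T (fun τ => f τ + g τ) t k = phasor T f t k + phasor T g t k := by
  simp only [phasor_def, add_mul]
  rw [intervalIntegral.integral_add (intervalIntegrable_mul_expo hf k)
    (intervalIntegrable_mul_expo hg k), mul_add]

theorem phasor_const_mul (c : ℂ) (f : ℝ → ℂ) (t : ℝ) (k : ℤ) :
    phasor T (fun τ => c * f τ) t k = c * phasor T f t k := by
  simp only [phasor_def, mul_assoc, intervalIntegral.integral_const_mul]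
  ring

theorem phasor_sub {f g : ℝ → ℂ} {t : ℝ} (hf : IntervalIntegrable f volume (t - T) t)
    (hg : IntervalIntegrable g volume (t - T) t) (k : ℤ) :
    phasor T (fun τ => f τ - g τ) t k = phasor T f t k - phasor T g t k := by
  simp only [phasor_def, sub_mul]
  rw [intervalIntegral.integral_sub (intervalIntegrable_mul_expo hf k)
    (intervalIntegrable_mul_expo hg k), mul_sub]

theorem phasor_sum {ι : Type*} (S : Finset ι) {f : ι → ℝ → ℂ} {t : ℝ}
    (hf : ∀ i ∈ S, IntervalIntegrable (f i) volume (t - T) t) (k : ℤ) :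
    phasor T (fun τ => ∑ i ∈ S, f i τ) t k = ∑ i ∈ S, phasor T (f i) t k := by
  simp only [phasor_def, Finset.sum_mul]
  rw [intervalIntegral.integral_finsetSum
    fun i hi => intervalIntegrable_mul_expo (hf i hi) k, Finset.mul_sum]

theorem star_phasor (f : ℝ → ℂ) (t : ℝ) (k : ℤ) :
    star (phasor T f t k) = (1 / (T : ℂ)) * ∫ τ in (t - T)..t, star (f τ) * star (expo T k τ) := by
  rw [phasor_def, star_mul', RCLike.star_def, ← intervalIntegral_conj]
  simp
where
  intervalIntegral_conj {a b : ℝ} {f : ℝ → ℂ} :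
    ∫ x in a..b, (starRingEnd ℂ) (f x) = (starRingEnd ℂ) (∫ x in a..b, f x) := by
    simp only [intervalIntegral.intervalIntegral_eq_integral_uIoc, integral_conj]
    split_ifs <;> simp

theorem phasor_conj (f : ℝ → ℂ) (t : ℝ) (k : ℤ) :
    phasor T (fun τ => star (f τ)) t k = star (phasor T f t (-k)) := by
  rw [star_phasor, phasor_def]
  congr 1
  refine intervalIntegral.integral_congr fun τ _ => ?_
  have := expo_sub T 0 (-k) τ
  rw [expo_zero, one_mul, sub_neg_eq_add, zero_add] at this
  simp only [this]

/-- The window is wrapped around the circle of length `T`, where the exponentials form a Hilbert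
basis. The signal itself need not be periodic. -/
theorem phasor_eq_fourierCoeff [hT : Fact (0 < T)] (f : ℝ → ℂ) (t : ℝ) (k : ℤ) :
    phasor T f t k = fourierCoeff (AddCircle.liftIoc T (t - T) f) k := by
  rw [fourierCoeff_eq_intervalIntegral _ _ (t - T), sub_add_cancel, phasor_def, Complex.real_smul]
  congr 1
  · push_cast; rfl
  refine intervalIntegral.integral_congr_ae (Eventually.of_forall fun τ hτ => ?_)
  rw [uIoc_of_le (by linarith [hT.out])] at hτ
  rw [AddCircle.liftIoc_coe_apply (by rwa [sub_add_cancel]), fourier_coe_apply, smul_eq_mul,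
    mul_comm, expo]
  congr 2
  push_cast
  ring

theorem WindowL2.toCircle [Fact (0 < T)] {f : ℝ → ℂ} {t : ℝ} (hf : WindowL2 T t f) :
    MemLp (AddCircle.liftIoc T (t - T) f) 2 (AddCircle.haarAddCircle (T := T)) := by
  refine MemLp.haarAddCircle (MemLp.memLp_liftIoc ?_)
  rwa [sub_add_cancel]

theorem fourierCoeff_toLp_toCircle [Fact (0 < T)] {f : ℝ → ℂ} {t : ℝ} (hf : WindowL2 T t f)
    (k : ℤ) : fourierBasis.repr (hf.toCircle.toLp _) k = phasor T f t k := by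
  rw [fourierBasis_repr, phasor_eq_fourierCoeff]
  exact congrFun (fourierCoeff_congr_ae hf.toCircle.coeFn_toLp) k

/-- Parseval's identity. -/
theorem hasSum_star_phasor_mul (hT : 0 < T) {f g : ℝ → ℂ} {t : ℝ} (hf : WindowL2 T t f)
    (hg : WindowL2 T t g) :
    HasSum (fun k => star (phasor T f t k) * phasor T g t k)
      ((1 / (T : ℂ)) * ∫ τ in (t - T)..t, star (f τ) * g τ) := by
  have : Fact (0 < T) := ⟨hT⟩
  have h1 := (fourierBasis (T := T)).hasSum_inner_mul_inner (hf.toCircle.toLp _)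
    (hg.toCircle.toLp _)
  have h2 : inner ℂ (hf.toCircle.toLp _) (hg.toCircle.toLp _) =
      (1 / (T : ℂ)) * ∫ τ in (t - T)..t, star (f τ) * g τ := by
    rw [L2.inner_def]
    have : ∫ a, inner ℂ (hf.toCircle.toLp _ a) (hg.toCircle.toLp _ a)
          ∂(AddCircle.haarAddCircle (T := T)) =
        ∫ a, AddCircle.liftIoc T (t - T) (fun τ => star (f τ) * g τ) a
          ∂(AddCircle.haarAddCircle (T := T)) := by
      refine integral_congr_ae ?_
      filter_upwards [hf.toCircle.coeFn_toLp, hg.toCircle.coeFn_toLp] with a ha hb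
      rw [ha, hb, RCLike.inner_apply, mul_comm]
      rfl
    rw [this, AddCircle.integral_haarAddCircle, AddCircle.integral_liftIoc_eq_intervalIntegral,
      sub_add_cancel, Complex.real_smul]
    simp
  rw [h2] at h1
  convert! h1 using 2 with k
  rw [← fourierCoeff_toLp_toCircle hf, ← fourierCoeff_toLp_toCircle hg,
    HilbertBasis.repr_apply_apply, HilbertBasis.repr_apply_apply, RCLike.star_def,
    inner_conj_symm]

theorem WindowL2.star {f : ℝ → ℂ} {t : ℝ} (hf : WindowL2 T t f) :
    WindowL2 T t (fun τ => Star.star (f τ)) := MemLp.star hf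

theorem WindowL2.mul_continuousOn {f g : ℝ → ℂ} {t : ℝ} (hf : WindowL2 T t f)
    (hg : ContinuousOn g (Icc (t - T) t)) : WindowL2 T t (fun τ => g τ * f τ) := by
  obtain ⟨C, hC⟩ := isCompact_Icc.exists_bound_of_continuousOn hg
  refine MemLp.of_le_mul (c := C) hf
    (((hg.mono Ioc_subset_Icc_self).aestronglyMeasurable measurableSet_Ioc).mul hf.1) ?_
  refine (ae_restrict_iff' measurableSet_Ioc).2 (Eventually.of_forall fun τ hτ => ?_)
  rw [norm_mul]
  gcongr
  exact hC τ (Ioc_subset_Icc_self hτ)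

theorem WindowL2.of_continuousOn {f : ℝ → ℂ} {t : ℝ} (hf : ContinuousOn f (Icc (t - T) t)) :
    WindowL2 T t f := by
  have : WindowL2 T t (fun _ => (1 : ℂ)) := memLp_const 1
  simpa using this.mul_continuousOn hf

theorem WindowL2.integrable_mul {f g : ℝ → ℂ} {t : ℝ} (hT : 0 ≤ T) (hf : WindowL2 T t f)
    (hg : WindowL2 T t g) : IntervalIntegrable (fun τ => f τ * g τ) volume (t - T) t := by
  rw [intervalIntegrable_iff_integrableOn_Ioc_of_le (by linarith)]
  exact MemLp.integrable_mul hf hg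

theorem WindowL2.intervalIntegrable {f : ℝ → ℂ} {t : ℝ} (hT : 0 ≤ T) (hf : WindowL2 T t f) :
    IntervalIntegrable f volume (t - T) t := by
  rw [intervalIntegrable_iff_integrableOn_Ioc_of_le (by linarith)]
  exact hf.integrable (by norm_num)

theorem hasSum_norm_sq_phasor (hT : 0 < T) {f : ℝ → ℂ} {t : ℝ} (hf : WindowL2 T t f) :
    HasSum (fun k => ‖phasor T f t k‖ ^ 2) ((1 / T) * ∫ τ in (t - T)..t, ‖f τ‖ ^ 2) := by
  have h := hasSum_star_phasor_mul hT hf hf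
  have h2 : ∀ z : ℂ, Star.star z * z = ((‖z‖ ^ 2 : ℝ) : ℂ) := fun z => by
    rw [RCLike.star_def, Complex.conj_mul']; push_cast; rfl
  simp only [h2, intervalIntegral.integral_ofReal] at h
  rw [← Complex.hasSum_ofReal]
  simpa using h

/-- A square integrable signal with vanishing Fourier coefficients vanishes. -/
theorem ae_eq_zero_of_phasor_eq_zero (hT : 0 < T) {f : ℝ → ℂ} {t : ℝ} (hf : WindowL2 T t f)
    (h : ∀ k, phasor T f t k = 0) : ∀ᵐ τ, τ ∈ Ioc (t - T) t → f τ = 0 := by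
  have h1 := hasSum_norm_sq_phasor hT hf
  simp only [h, norm_zero, ne_eq, OfNat.ofNat_ne_zero, not_false_eq_true, zero_pow] at h1
  have h2 := h1.unique hasSum_zero
  have h3 : ∫ τ in (t - T)..t, ‖f τ‖ ^ 2 = 0 := by
    rcases mul_eq_zero.1 h2 with h | h
    · exact absurd h (by positivity)
    · exact h
  rw [intervalIntegral.integral_of_le (by linarith)] at h3
  rw [integral_eq_zero_iff_of_nonneg (fun _ => by positivity)
    (by simpa using hf.integrable_norm_pow (by norm_num))] at h3
  rw [← ae_restrict_iff' measurableSet_Ioc]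
  filter_upwards [h3] with τ hτ
  simpa using hτ

theorem ae_eq_of_phasor_eq (hT : 0 < T) {f g : ℝ → ℂ} {t : ℝ} (hf : WindowL2 T t f)
    (hg : WindowL2 T t g) (h : ∀ k, phasor T f t k = phasor T g t k) :
    ∀ᵐ τ, τ ∈ Ioc (t - T) t → f τ = g τ := by
  have := ae_eq_zero_of_phasor_eq_zero hT (MemLp.sub hf hg) fun k =>
    (phasor_sub (hf.intervalIntegrable hT.le) (hg.intervalIntegrable hT.le) k).trans
      (sub_eq_zero.2 (h k))
  filter_upwards [this] with τ hτ hm using sub_eq_zero.1 (hτ hm)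

/-- The Fourier coefficients of a product. -/
theorem hasSum_phasor_mul (hT : 0 < T) {f g : ℝ → ℂ} {t : ℝ} (hf : WindowL2 T t f)
    (hg : WindowL2 T t g) (k : ℤ) :
    HasSum (fun l => phasor T f t (k - l) * phasor T g t l)
      (phasor T (fun τ => f τ * g τ) t k) := by
  -- The `k`-th coefficient of `f g` is the inner product of `conj(expo k · f)` with `g`, so
  -- Parseval yields the convolution; conjugation turns the `l`-th coefficient of the first factor
  -- into the one of `f` of index `k - l`.
  have hf' : WindowL2 T t (fun τ => Star.star (expo T k τ) * Star.star (f τ)) :=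
    hf.star.mul_continuousOn (continuous_star.comp (continuous_expo T k)).continuousOn
  have h := hasSum_star_phasor_mul hT hf' hg
  convert h using 2 with l
  · congr 1
    rw [star_phasor, phasor_def]
    congr 1
    refine intervalIntegral.integral_congr fun τ _ => ?_
    simp only [star_mul', star_star, expo_sub]
    ring
  · rw [phasor_def]
    congr 1
    refine intervalIntegral.integral_congr fun τ _ => ?_
    simp only [star_mul', star_star]
    ring

/-- The Riesz-Fischer theorem. -/
theorem exists_periodic_signal (hT : 0 < T) (c : lp (fun _ : ℤ => ℂ) 2) :
    ∃ f : ℝ → ℂ, Function.Periodic f T ∧ (∀ t, WindowL2 T t f) ∧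
      ∀ t k, phasor T f t k = c k := by
  have : Fact (0 < T) := ⟨hT⟩
  set F := (fourierBasis (T := T)).repr.symm c with hF
  have hper : Function.Periodic (fun τ : ℝ => F (τ : AddCircle T)) T := fun τ => by simp
  refine ⟨fun τ => F (τ : AddCircle T), hper, fun t => ?_, fun t k => ?_⟩
  · have h1 : MemLp F 2 (volume : Measure (AddCircle T)) := (Lp.memLp F).of_haarAddCircle
    have h2 := h1.comp_measurePreserving (AddCircle.measurePreserving_mk T (t - T))
    rwa [sub_add_cancel] at h2
  · have h1 : AddCircle.liftIoc T (t - T) (fun τ : ℝ => F (τ : AddCircle T)) = F := by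
      refine AddCircle.Ioc_ext T (t - T) fun τ hτ => ?_
      rw [AddCircle.liftIoc_coe_apply hτ]
    rw [phasor_eq_fourierCoeff, h1, ← fourierBasis_repr, hF]
    simp

/-- Integration by parts for Fourier coefficients. -/
theorem phasor_deriv (hT : 0 < T) {u u' : ℝ → ℂ} {t : ℝ}
    (hu : IsPrimitiveOn (Icc (t - T) t) u u') (k : ℤ) :
    phasor T u' t k = (1 / (T : ℂ)) * ((u t - u (t - T)) * expo T k t) +
      Complex.I * ((2 * Real.pi / T : ℝ) : ℂ) * (k : ℂ) * phasor T u t k := by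
  have hmem1 : t - T ∈ Icc (t - T) t := ⟨le_rfl, by linarith⟩
  have hmem2 : t ∈ Icc (t - T) t := ⟨by linarith, le_rfl⟩
  have he : IsPrimitiveOn (Icc (t - T) t) (expo T k)
      (fun τ => -(Complex.I * ((2 * Real.pi / T : ℝ) : ℂ) * (k : ℂ)) * expo T k τ) :=
    IsPrimitiveOn.of_hasDerivAt (hasDerivAt_expo T k)
      (continuous_const.mul (continuous_expo T k))
  have h1 := (hu.mul he).sub_eq hmem1 hmem2
  have hi := hu.intervalIntegrable hmem1 hmem2
  have hc : IntervalIntegrable u volume (t - T) t := by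
    refine ContinuousOn.intervalIntegrable ?_
    rw [uIcc_of_le hmem1.2]
    exact hu.continuousOn
  have h2 : (∫ r in (t - T)..t, (u' r * expo T k r +
      u r * (-(Complex.I * ((2 * Real.pi / T : ℝ) : ℂ) * (k : ℂ)) * expo T k r))) =
      (∫ r in (t - T)..t, u' r * expo T k r) +
      -(Complex.I * ((2 * Real.pi / T : ℝ) : ℂ) * (k : ℂ)) *
        ∫ r in (t - T)..t, u r * expo T k r := by
    rw [← intervalIntegral.integral_const_mul, ← intervalIntegral.integral_add
      (intervalIntegrable_mul_expo hi k) ((intervalIntegrable_mul_expo hc k).const_mul _)]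
    refine intervalIntegral.integral_congr fun τ _ => ?_
    ring
  -- The exponential takes equal values at both ends of the window, so the boundary term is just the
  -- jump of `u`.
  have h3 : expo T k (t - T) = expo T k t := (expo_periodic hT.ne' k).sub_eq t
  rw [h2, h3] at h1
  rw [phasor_def, phasor_def, eq_sub_iff_add_eq.2 h1.symm]
  ring

theorem freq_ne_zero (hT : 0 < T) {k : ℤ} (hk : k ≠ 0) :
    Complex.I * ((2 * Real.pi / T : ℝ) : ℂ) * (k : ℂ) ≠ 0 := by
  refine mul_ne_zero (mul_ne_zero Complex.I_ne_zero ?_) (by exact_mod_cast hk)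
  have : (2 * Real.pi / T : ℝ) ≠ 0 := by positivity
  exact_mod_cast this

/-- For `k ≠ 0`, integration by parts applied to a constant has no boundary term and no derivative
term, which leaves a nonzero multiple of the phasor equal to zero. -/
theorem phasor_const (hT : 0 < T) (c : ℂ) (t : ℝ) (k : ℤ) :
    phasor T (fun _ => c) t k = if k = 0 then c else 0 := by
  split_ifs with hk
  · subst hk
    have : (T : ℂ) ≠ 0 := by exact_mod_cast hT.ne'
    simp [phasor_def, expo_zero, this]
  · have h := phasor_deriv hT (IsPrimitiveOn.const (s := Icc (t - T) t) c) k
    have h0 : phasor T (fun _ => (0 : ℂ)) t k = 0 := by simp [phasor_def]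
    rw [h0, sub_self, zero_mul, mul_zero, zero_add, eq_comm] at h
    rcases mul_eq_zero.1 h with h | h
    · exact absurd h (freq_ne_zero hT hk)
    · exact h

/-- A signal whose Fourier coefficients are those of an indefinite integral of `y` is an
indefinite integral of `y`. -/
theorem exists_ae_eq_add_integral (hT : 0 < T) {f y : ℝ → ℂ} {t : ℝ} {d : ℂ}
    (hf : WindowL2 T t f) (hy : IntervalIntegrable y volume (t - T) t)
    (h : ∀ k : ℤ, phasor T y t k = (1 / (T : ℂ)) * (d * expo T k t) +
      Complex.I * ((2 * Real.pi / T : ℝ) : ℂ) * (k : ℂ) * phasor T f t k) :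
    ∫ r in (t - T)..t, y r = d ∧
      ∃ c, ∀ᵐ τ, τ ∈ Ioc (t - T) t → f τ = c + ∫ r in (t - T)..τ, y r := by
  have hTc : (T : ℂ) ≠ 0 := by exact_mod_cast hT.ne'
  have hY : IsPrimitiveOn (Icc (t - T) t) (fun τ => 0 + ∫ r in (t - T)..τ, y r) y :=
    IsPrimitiveOn.of_integral (fun b hb => hy.mono_set (uIcc_subset_uIcc left_mem_uIcc
      (by rwa [uIcc_of_le (by linarith)]))) 0
  simp only [zero_add] at hY
  have h1 := fun k => phasor_deriv hT hY k
  simp only [intervalIntegral.integral_same, sub_zero] at h1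
  -- The hypothesis at `k = 0` involves no phasor of `f` and identifies `d` as the total integral.
  -- For the other `k` it determines the phasor of `f`, and `c` absorbs the remaining zeroth one.
  have hd : ∫ r in (t - T)..t, y r = d := by
    have h2 := h1 0
    rw [h 0] at h2
    simp only [expo_zero, mul_one, Int.cast_zero, mul_zero, zero_mul, add_zero] at h2
    exact (mul_left_cancel₀ (one_div_ne_zero hTc) h2).symm
  refine ⟨hd, phasor T f t 0 - phasor T (fun τ => ∫ r in (t - T)..τ, y r) t 0, ?_⟩
  have hYw : WindowL2 T t (fun τ => ∫ r in (t - T)..τ, y r) := WindowL2.of_continuousOn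
    hY.continuousOn
  set c := phasor T f t 0 - phasor T (fun τ => ∫ r in (t - T)..τ, y r) t 0 with hc
  have hcw : WindowL2 T t (fun _ => c) := memLp_const c
  refine ae_eq_of_phasor_eq hT hf (MemLp.add hcw hYw) fun k => ?_
  refine Eq.trans ?_ (phasor_add (hcw.intervalIntegrable hT.le) (hYw.intervalIntegrable hT.le)
    k).symm
  rw [phasor_const hT]
  split_ifs with hk
  · rw [hk, hc]; ring
  · have h2 := h k
    rw [h1 k, hd] at h2
    have h3 := add_left_cancel h2
    rw [zero_add]
    exact (mul_left_cancel₀ (freq_ne_zero hT hk) h3).symm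

end Fourier

end HarmonicControl

namespace HarmonicControl

/-! ### Vector signals and their sequences of Fourier coefficients -/

section VectorFourier

open Set

variable {T : ℝ} {ι κ : Type} [Fintype ι] [Fintype κ]

/-- The vector signal `x` is square integrable on the window `(t - T, t]`. -/
abbrev VecL2 {ι : Type} (T t : ℝ) (x : ℝ → ι → ℂ) : Prop := ∀ i, WindowL2 T t fun τ => x τ i

/-- The matrix signal `A` is square integrable on the window `(t - T, t]`. -/
abbrev MatL2 {ι κ : Type} (T t : ℝ) (A : ℝ → Matrix ι κ ℂ) : Prop :=
  ∀ i j, WindowL2 T t fun τ => A τ i j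

theorem slidingFourier_apply {ι : Type} (T : ℝ) (x : ℝ → ι → ℂ) (t : ℝ) (k : ℤ) (i : ι) :
    slidingFourier T x t k i = phasor T (fun τ => x τ i) t k := rfl

theorem Ell2.ext_coords {X Y : Ell2 ι} (h : X.coords = Y.coords) : X = Y := by
  ext k i
  exact congrFun (congrFun h k) i

theorem slidingFourier_eq_of_periodic {ι : Type} {x : ℝ → ι → ℂ} (hT : T ≠ 0)
    (hx : Function.Periodic x T) (t s : ℝ) : slidingFourier T x t = slidingFourier T x s := by
  ext k i
  exact phasor_eq_of_periodic hT (fun τ => by simp [hx τ]) t s k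

theorem toeplitz_eq_of_periodic {ι κ : Type} {A : ℝ → Matrix ι κ ℂ} (hT : T ≠ 0)
    (hA : Function.Periodic A T) (t s : ℝ) : toeplitz T A t = toeplitz T A s := by
  ext k l i j
  exact phasor_eq_of_periodic hT (fun τ => by simp [hA τ]) t s (k - l)

theorem slidingFourier_congr_ae {ι : Type} {x y : ℝ → ι → ℂ} {t : ℝ} (hT : 0 ≤ T)
    (h : ∀ᵐ τ, τ ∈ Ioc (t - T) t → x τ = y τ) :
    slidingFourier T x t = slidingFourier T y t := by
  ext k i
  refine phasor_congr_ae hT ?_ k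
  filter_upwards [h] with τ hτ hm
  rw [hτ hm]

/-- Parseval's identity for vector signals. -/
theorem hasSum_star_slidingFourier (hT : 0 < T) {x y : ℝ → ι → ℂ} {t : ℝ} (hx : VecL2 T t x)
    (hy : VecL2 T t y) :
    HasSum (fun k => ∑ i, star (slidingFourier T x t k i) * slidingFourier T y t k i)
      ((1 / (T : ℂ)) * ∫ τ in (t - T)..t, star (x τ) ⬝ᵥ y τ) := by
  have h := hasSum_sum (s := Finset.univ) fun (i : ι) _ =>
    hasSum_star_phasor_mul hT (hx i) (hy i)
  rw [← Finset.mul_sum, ← intervalIntegral.integral_finsetSum fun i _ =>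
    WindowL2.integrable_mul hT.le (hx i).star (hy i)] at h
  exact h

theorem summable_norm_sq_slidingFourier (hT : 0 < T) {x : ℝ → ι → ℂ} {t : ℝ}
    (hx : VecL2 T t x) :
    HasSum (fun k => ∑ i, ‖slidingFourier T x t k i‖ ^ 2)
      ((1 / T) * ∫ τ in (t - T)..t, ∑ i, ‖x τ i‖ ^ 2) := by
  have h := hasSum_sum (s := Finset.univ) fun (i : ι) _ => hasSum_norm_sq_phasor hT (hx i)
  rw [← Finset.mul_sum, ← intervalIntegral.integral_finsetSum fun i _ => ?_] at h
  · exact h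
  · rw [intervalIntegrable_iff_integrableOn_Ioc_of_le (by linarith)]
    exact (hx i).integrable_norm_pow (by norm_num)

/-- The sequence of Fourier coefficients of a square integrable signal, as an element of `ℓ²`. -/
noncomputable def ofSignal (hT : 0 < T) {x : ℝ → ι → ℂ} {t : ℝ} (hx : VecL2 T t x) : Ell2 ι :=
  ⟨fun k => WithLp.toLp 2 (slidingFourier T x t k), by
    refine memℓp_gen ?_
    simp only [ENNReal.toReal_ofNat, Real.rpow_ofNat, EuclideanSpace.norm_sq_eq]
    exact (summable_norm_sq_slidingFourier hT hx).summable⟩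

theorem coords_ofSignal (hT : 0 < T) {x : ℝ → ι → ℂ} {t : ℝ} (hx : VecL2 T t x) :
    (ofSignal hT hx).coords = slidingFourier T x t := rfl

theorem inner_eq_tsum (X Y : Ell2 ι) :
    HasSum (fun k => ∑ i, star (X.coords k i) * Y.coords k i) (inner ℂ X Y) := by
  have h := lp.hasSum_inner (𝕜 := ℂ) X Y
  convert! h using 2 with k
  rw [PiLp.inner_apply]
  refine Finset.sum_congr rfl fun i _ => ?_
  rw [RCLike.inner_apply, mul_comm]
  rfl

theorem inner_eq_integral (hT : 0 < T) {x y : ℝ → ι → ℂ} {t : ℝ} (hx : VecL2 T t x)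
    (hy : VecL2 T t y) {X Y : Ell2 ι} (hX : X.coords = slidingFourier T x t)
    (hY : Y.coords = slidingFourier T y t) :
    inner ℂ X Y = (1 / (T : ℂ)) * ∫ τ in (t - T)..t, star (x τ) ⬝ᵥ y τ := by
  have h := inner_eq_tsum X Y
  rw [hX, hY] at h
  exact h.unique (hasSum_star_slidingFourier hT hx hy)

theorem norm_sq_eq_integral (hT : 0 < T) {x : ℝ → ι → ℂ} {t : ℝ} (hx : VecL2 T t x)
    {X : Ell2 ι} (hX : X.coords = slidingFourier T x t) :
    ‖X‖ ^ 2 = (1 / T) * ∫ τ in (t - T)..t, ∑ i, ‖x τ i‖ ^ 2 := by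
  have h := inner_eq_tsum X X
  rw [inner_self_eq_norm_sq_to_K, hX] at h
  have h2 := summable_norm_sq_slidingFourier hT hx
  have h3 : ∀ z : ℂ, Star.star z * z = ((‖z‖ ^ 2 : ℝ) : ℂ) := fun z => by
    rw [RCLike.star_def, Complex.conj_mul']; push_cast; rfl
  simp only [h3, ← Complex.ofReal_sum] at h
  have h4 : HasSum (fun k => ∑ i, ‖slidingFourier T x t k i‖ ^ 2) (‖X‖ ^ 2) := by
    rw [← Complex.hasSum_ofReal]
    simpa using h
  exact h4.unique h2

theorem exists_signal (hT : 0 < T) (X : Ell2 ι) :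
    ∃ x : ℝ → ι → ℂ, Function.Periodic x T ∧ (∀ t, VecL2 T t x) ∧
      ∀ t, X.coords = slidingFourier T x t := by
  have h : ∀ i, Memℓp (fun k => X k i) 2 := fun i => by
    refine memℓp_gen ?_
    have h1 := (memℓp_gen_iff (by norm_num)).1 (lp.memℓp X)
    refine Summable.of_nonneg_of_le (fun k => by positivity) (fun k => ?_) h1
    simp only [ENNReal.toReal_ofNat, Real.rpow_ofNat]
    gcongr
    exact PiLp.norm_apply_le _ i
  choose f hf1 hf2 hf3 using fun i => exists_periodic_signal hT ⟨fun k => X k i, h i⟩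
  refine ⟨fun τ i => f i τ, fun τ => funext fun i => hf1 i τ, fun t i => hf2 i t, fun t => ?_⟩
  ext k i
  exact (hf3 i t k).symm

theorem ae_eq_of_slidingFourier_eq (hT : 0 < T) {x y : ℝ → ι → ℂ} {t : ℝ} (hx : VecL2 T t x)
    (hy : VecL2 T t y) (h : slidingFourier T x t = slidingFourier T y t) :
    ∀ᵐ τ, τ ∈ Ioc (t - T) t → x τ = y τ := by
  have h1 : ∀ i, ∀ᵐ τ, τ ∈ Ioc (t - T) t → x τ i = y τ i := fun i =>
    ae_eq_of_phasor_eq hT (hx i) (hy i) fun k => congrFun (congrFun h k) i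
  filter_upwards [ae_all_iff.2 h1] with τ hτ hm
  exact funext fun i => hτ i hm

theorem slidingFourier_add {ι : Type} {x y : ℝ → ι → ℂ} {t : ℝ}
    (hx : ∀ i, IntervalIntegrable (fun τ => x τ i) volume (t - T) t)
    (hy : ∀ i, IntervalIntegrable (fun τ => y τ i) volume (t - T) t) :
    slidingFourier T (fun τ => x τ + y τ) t = slidingFourier T x t + slidingFourier T y t := by
  ext k i
  exact phasor_add (hx i) (hy i) k

theorem slidingFourier_sub {ι : Type} {x y : ℝ → ι → ℂ} {t : ℝ}
    (hx : ∀ i, IntervalIntegrable (fun τ => x τ i) volume (t - T) t)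
    (hy : ∀ i, IntervalIntegrable (fun τ => y τ i) volume (t - T) t) :
    slidingFourier T (fun τ => x τ - y τ) t = slidingFourier T x t - slidingFourier T y t := by
  ext k i
  exact phasor_sub (hx i) (hy i) k

theorem intervalIntegrable_mulVec {ι : Type} (hT : 0 ≤ T) {A : ℝ → Matrix ι κ ℂ} {x : ℝ → κ → ℂ}
    {t : ℝ}
    (hA : MatL2 T t A) (hx : VecL2 T t x) (i : ι) :
    IntervalIntegrable (fun τ => (A τ).mulVec (x τ) i) volume (t - T) t := by
  have := IntervalIntegrable.sum (μ := volume) (a := t - T) (b := t) Finset.univ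
    (f := fun j τ => A τ i j * x τ j) fun j _ => WindowL2.integrable_mul hT (hA i j) (hx j)
  simp only [Finset.sum_fn] at this
  exact this

/-- A Toeplitz matrix acts by convolution, and the coefficients of a product are a convolution. Both
factors are only square integrable, so the product is merely integrable and its phasors need not
come from an `ℓ²` argument. -/
theorem hasSum_toeplitz_mulVec {ι : Type} (hT : 0 < T) {A : ℝ → Matrix ι κ ℂ} {x : ℝ → κ → ℂ}
    {t : ℝ} (hA : MatL2 T t A) (hx : VecL2 T t x) (k : ℤ) :
    HasSum (fun l => (toeplitz T A t k l).mulVec (slidingFourier T x t l))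
      (slidingFourier T (fun τ => (A τ).mulVec (x τ)) t k) := by
  refine Pi.hasSum.2 fun i => ?_
  have h := hasSum_sum (s := Finset.univ) fun (j : κ) _ =>
    hasSum_phasor_mul hT (hA i j) (hx j) k
  rw [← phasor_sum _ fun j _ => WindowL2.integrable_mul hT.le (hA i j) (hx j)] at h
  exact h

theorem toeplitz_act {ι : Type} (hT : 0 < T) {A : ℝ → Matrix ι κ ℂ} {x : ℝ → κ → ℂ}
    {t : ℝ} (hA : MatL2 T t A) (hx : VecL2 T t x) :
    (toeplitz T A t).act (slidingFourier T x t) =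
      slidingFourier T (fun τ => (A τ).mulVec (x τ)) t :=
  funext fun k => (hasSum_toeplitz_mulVec hT hA hx k).tsum_eq

theorem toeplitz_mul_col {ι : Type} (hT : 0 < T) {A : ℝ → Matrix ι κ ℂ} {x : ℝ → κ → ℂ}
    {t : ℝ} (hA : MatL2 T t A) (hx : VecL2 T t x) :
    (toeplitz T A t).mul
      (toeplitzOfSeq fun p => Matrix.replicateCol Unit (slidingFourier T x t p)) =
    toeplitzOfSeq fun p => Matrix.replicateCol Unit
      (slidingFourier T (fun τ => (A τ).mulVec (x τ)) t p) := by
  ext k l i u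
  have h := hasSum_toeplitz_mulVec hT hA hx (k - l)
  -- The column `l` of the product is the convolution of index `k - l`, with the summation index
  -- shifted by `l`.
  rw [← (Equiv.subRight l).hasSum_iff] at h
  have h2 : HasSum (fun p => toeplitz T A t k p *
      (toeplitzOfSeq fun p => Matrix.replicateCol Unit (slidingFourier T x t p)) p l)
      (Matrix.replicateCol Unit (slidingFourier T (fun τ => (A τ).mulVec (x τ)) t (k - l))) := by
    refine Pi.hasSum.2 fun i => Pi.hasSum.2 fun u => ?_
    convert Pi.hasSum.1 h i using 2 with p
    · simp only [Function.comp_apply, Equiv.subRight_apply, toeplitz, toeplitzOfSeq,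
        sub_sub_sub_cancel_right]
      rfl
    · rfl
  exact congrFun (congrFun h2.tsum_eq i) u

theorem MatL2.const {ι κ : Type} (T t : ℝ) (A : Matrix ι κ ℂ) : MatL2 T t fun _ => A :=
  fun i j => memLp_const (A i j)

/-- The constant part may be decomposed at time `0` and the control at time `t`, because the phasors
of a constant do not depend on the window. -/
theorem toeplitz_affine {ι κ : Type} (hT : 0 < T) (A B : Matrix ι κ ℂ) {s : ℝ → ℂ} {t : ℝ}
    (hs : WindowL2 T t s) (k l : ℤ) :
    toeplitz T (fun _ => A) 0 k l + phasor T s t (k - l) • B =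
      toeplitz T (fun τ => A + s τ • B) t k l := by
  ext i j
  have hc : WindowL2 T t (fun _ => A i j) := memLp_const _
  have h1 := phasor_add (hc.intervalIntegrable hT.le)
    ((hs.intervalIntegrable hT.le).const_mul (B i j)) (k - l)
  rw [phasor_const_mul, phasor_const hT] at h1
  simp only [toeplitz, toeplitzOfSeq, Matrix.add_apply, Matrix.of_apply, Matrix.smul_apply,
    smul_eq_mul]
  rw [phasor_const hT, mul_comm (phasor T s t (k - l)), ← h1]
  simp only [mul_comm]

theorem VecL2.mulVec_of_const {ι κ : Type} [Fintype κ] {x : ℝ → κ → ℂ} {t : ℝ}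
    (A : Matrix ι κ ℂ) (hx : VecL2 T t x) : VecL2 T t fun τ => A.mulVec (x τ) := fun i =>
  memLp_finsetSum _ fun j _ => (hx j).const_mul (A i j)

theorem VecL2.mulVec_of_continuousOn {ι κ : Type} [Fintype κ] {x : ℝ → κ → ℂ} {t : ℝ}
    {A : ℝ → Matrix ι κ ℂ} (hA : ∀ i j, ContinuousOn (fun τ => A τ i j) (Icc (t - T) t))
    (hx : VecL2 T t x) : VecL2 T t fun τ => (A τ).mulVec (x τ) := fun i =>
  memLp_finsetSum _ fun j _ => (hx j).mul_continuousOn (hA i j)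

namespace BilinearData

variable {n m : ℕ} (σ : BilinearData n m)

theorem calA_eq_toeplitz (hT : 0 < T) {S : Ell2 Unit} {s : ℝ → ℂ} {t : ℝ} (hs : WindowL2 T t s)
    (hS : S.coords = slidingFourier T (fun τ _ => s τ) t) :
    σ.calA T S = toeplitz T (fun τ => cMat σ.Aind + s τ • cMat σ.Adep) t := by
  funext k l
  rw [← toeplitz_affine hT _ _ hs]
  have : S (k - l) () = phasor T s t (k - l) := congrFun (congrFun hS (k - l)) ()
  rw [← this]; rfl

theorem calB_eq_toeplitz (hT : 0 < T) {S : Ell2 Unit} {s : ℝ → ℂ} {t : ℝ} (hs : WindowL2 T t s)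
    (hS : S.coords = slidingFourier T (fun τ _ => s τ) t) :
    σ.calB T S = toeplitz T (fun τ => cMat σ.Bind + s τ • cMat σ.Bdep) t := by
  funext k l
  rw [← toeplitz_affine hT _ _ hs]
  have : S (k - l) () = phasor T s t (k - l) := congrFun (congrFun hS (k - l)) ()
  rw [← this]; rfl

end BilinearData

end VectorFourier

end HarmonicControl

namespace HarmonicControl

/-! ### Linear systems with locally integrable coefficients -/

section LinearSystem

open Set Matrix

variable {ι κ μ : Type}

/-- The entries of `M` are indefinite integrals of the entries of `M'` on `s`. -/
abbrev MatPrimOn {𝕜 : Type*} [RCLike 𝕜] (s : Set ℝ) (M M' : ℝ → Matrix ι κ 𝕜) : Prop :=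
  ∀ i j, IsPrimitiveOn s (fun t => M t i j) fun t => M' t i j

/-- The coordinates of `x` are indefinite integrals of the coordinates of `x'` on `s`. -/
abbrev VecPrimOn {𝕜 : Type*} [RCLike 𝕜] (s : Set ℝ) (x x' : ℝ → ι → 𝕜) : Prop :=
  ∀ i, IsPrimitiveOn s (fun t => x t i) fun t => x' t i

variable {𝕜 : Type*} [RCLike 𝕜] {s : Set ℝ}

theorem MatPrimOn.mul [Fintype κ] [s.OrdConnected] {M M' : ℝ → Matrix ι κ 𝕜}
    {N N' : ℝ → Matrix κ μ 𝕜} (hM : MatPrimOn s M M') (hN : MatPrimOn s N N') :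
    MatPrimOn s (fun t => M t * N t) (fun t => M' t * N t + M t * N' t) := fun i j => by
  simp only [Matrix.mul_apply, Matrix.add_apply, ← Finset.sum_add_distrib]
  exact IsPrimitiveOn.sum _ fun l _ => (hM i l).mul (hN l j)

theorem MatPrimOn.mulVec [Fintype κ] [s.OrdConnected] {M M' : ℝ → Matrix ι κ 𝕜}
    {x x' : ℝ → κ → 𝕜} (hM : MatPrimOn s M M') (hx : VecPrimOn s x x') :
    VecPrimOn s (fun t => M t *ᵥ x t) (fun t => M' t *ᵥ x t + M t *ᵥ x' t) := fun i => by
  simp only [Matrix.mulVec, dotProduct, Pi.add_apply, ← Finset.sum_add_distrib]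
  exact IsPrimitiveOn.sum _ fun l _ => (hM i l).mul (hx l)

theorem VecPrimOn.dotProduct [Fintype ι] [s.OrdConnected] {x x' y y' : ℝ → ι → 𝕜}
    (hx : VecPrimOn s x x') (hy : VecPrimOn s y y') :
    IsPrimitiveOn s (fun t => x t ⬝ᵥ y t) (fun t => x' t ⬝ᵥ y t + x t ⬝ᵥ y' t) := by
  simp only [_root_.dotProduct, ← Finset.sum_add_distrib]
  exact IsPrimitiveOn.sum _ fun l _ => (hx l).mul (hy l)

theorem VecPrimOn.star {x x' : ℝ → ι → ℂ} (hx : VecPrimOn s x x') :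
    VecPrimOn s (fun t => Star.star (x t)) (fun t => Star.star (x' t)) := fun i =>
  (hx i).clm_comp Complex.conjCLE.toContinuousLinearMap

theorem VecPrimOn.mono {x x' : ℝ → ι → 𝕜} {t : Set ℝ} (hx : VecPrimOn s x x') (h : t ⊆ s) :
    VecPrimOn t x x' := fun i => (hx i).mono h

theorem MatPrimOn.mono {x x' : ℝ → Matrix ι κ 𝕜} {t : Set ℝ} (hx : MatPrimOn s x x') (h : t ⊆ s) :
    MatPrimOn t x x' := fun i j => (hx i j).mono h

theorem MatPrimOn.congr_deriv [s.OrdConnected] {M M' N' : ℝ → Matrix ι κ 𝕜}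
    (hM : MatPrimOn s M M') (h : ∀ t ∈ s, M' t = N' t) : MatPrimOn s M N' := fun i j =>
  IsPrimitiveOn.congr_deriv (hM i j) fun t ht => congrFun (congrFun (h t ht) i) j

theorem VecPrimOn.congr_deriv [s.OrdConnected] {x x' y' : ℝ → ι → 𝕜}
    (hx : VecPrimOn s x x') (h : ∀ t ∈ s, x' t = y' t) : VecPrimOn s x y' := fun i =>
  IsPrimitiveOn.congr_deriv (hx i) fun t ht => congrFun (h t ht) i

theorem MatPrimOn.transpose {M M' : ℝ → Matrix ι κ 𝕜} (hM : MatPrimOn s M M') :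
    MatPrimOn s (fun t => (M t)ᵀ) (fun t => (M' t)ᵀ) := fun i j => hM j i

theorem IsPrimitiveOn.comp_add_right {E : Type*} [NormedAddCommGroup E] [NormedSpace ℝ E]
    {u u' : ℝ → E} (hu : IsPrimitiveOn univ u u') (c : ℝ) :
    IsPrimitiveOn univ (fun t => u (t + c)) (fun t => u' (t + c)) := fun a _ b _ => by
  refine ⟨?_, ?_⟩
  · have := (hu (a + c) (mem_univ _) (b + c) (mem_univ _)).1.comp_add_right c
    simpa using this
  · rw [intervalIntegral.integral_comp_add_right (fun t => u' t)]
    exact hu.sub_eq (mem_univ _) (mem_univ _)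

theorem MatPrimOn.eq_of_deriv_eq_zero {M : ℝ → Matrix ι κ 𝕜}
    (hM : MatPrimOn univ M fun _ => 0) (t s : ℝ) : M t = M s := by
  ext i j
  have := (hM i j).sub_eq (mem_univ s) (mem_univ t)
  simp only [Matrix.zero_apply, intervalIntegral.integral_zero] at this
  exact sub_eq_zero.1 this

theorem ofReal_primitive {u u' : ℝ → ℝ} (hu : IsPrimitiveOn s u u') :
    IsPrimitiveOn s (fun t => (u t : ℂ)) (fun t => (u' t : ℂ)) :=
  hu.clm_comp Complex.ofRealCLM

theorem locallyIntegrable_of_intervalIntegrable {E : Type*} [NormedAddCommGroup E] {f : ℝ → E}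
    (h : ∀ a b, IntervalIntegrable f volume a b) : LocallyIntegrable f volume := fun x =>
  ⟨Ioc (x - 1) (x + 1), Ioc_mem_nhds (by linarith) (by linarith),
    (intervalIntegrable_iff_integrableOn_Ioc_of_le (by linarith)).1 (h _ _)⟩

theorem norm_mulVec_le [Fintype κ] [Fintype ι] (A : Matrix ι κ 𝕜) (x : κ → 𝕜) :
    ‖A *ᵥ x‖ ≤ (∑ i, ∑ j, ‖A i j‖) * ‖x‖ := by
  rw [pi_norm_le_iff_of_nonneg (by positivity)]
  intro i
  calc ‖∑ j, A i j * x j‖ ≤ ∑ j, ‖A i j‖ * ‖x‖ := by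
        refine (norm_sum_le _ _).trans (Finset.sum_le_sum fun j _ => ?_)
        rw [norm_mul]
        gcongr
        exact norm_le_pi_norm x j
    _ ≤ _ := by
        rw [← Finset.sum_mul]
        gcongr
        exact Finset.single_le_sum (f := fun i => ∑ j, ‖A i j‖) (fun i _ => by positivity)
          (Finset.mem_univ i)

theorem vecPrimOn_of_isPrimitiveOn [Fintype ι] {x x' : ℝ → ι → 𝕜} (h : IsPrimitiveOn s x x') :
    VecPrimOn s x x' := fun i =>
  h.clm_comp (ContinuousLinearMap.proj (R := ℝ) (φ := fun _ : ι => 𝕜) i)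

theorem intervalIntegrable_pi [Fintype ι] {x : ℝ → ι → 𝕜} {a b : ℝ}
    (h : ∀ i, IntervalIntegrable (fun t => x t i) volume a b) :
    IntervalIntegrable x volume a b :=
  ⟨Integrable.of_eval fun i => (h i).1, Integrable.of_eval fun i => (h i).2⟩

theorem VecPrimOn.isPrimitiveOn [Fintype ι] {x x' : ℝ → ι → 𝕜} (h : VecPrimOn s x x') :
    IsPrimitiveOn s x x' := fun a ha b hb => by
  have hi := intervalIntegrable_pi fun i => (h i).intervalIntegrable ha hb
  refine ⟨hi, funext fun i => ?_⟩
  have h1 := (ContinuousLinearMap.proj (R := ℝ) (φ := fun _ : ι => 𝕜) i).intervalIntegral_comp_comm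
    hi
  exact ((h i).sub_eq ha hb).trans h1

theorem exists_linear_solution [Fintype ι] {A : ℝ → Matrix ι ι ℝ}
    (hA : ∀ i j a b, IntervalIntegrable (fun t => A t i j) volume a b) (ξ : ι → ℝ) :
    ∃ x : ℝ → ι → ℝ, x 0 = ξ ∧ VecPrimOn univ x fun t => A t *ᵥ x t := by
  obtain ⟨x, hx0, hx⟩ := exists_primitive_of_lipschitz (f := fun t x => A t *ᵥ x)
    (k := fun t => ∑ i, ∑ j, ‖A t i j‖)
    (fun a b => by
      have := IntervalIntegrable.sum (μ := volume) (a := a) (b := b) Finset.univ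
        (f := fun i t => ∑ j, ‖A t i j‖) fun i _ => by
          have := IntervalIntegrable.sum (μ := volume) (a := a) (b := b) Finset.univ
            (f := fun j t => ‖A t i j‖) fun j _ => (hA i j a b).norm
          simp only [Finset.sum_fn] at this
          exact this
      simp only [Finset.sum_fn] at this
      exact this)
    (fun t => by positivity)
    (Eventually.of_forall fun t x y => by
      rw [← Matrix.mulVec_sub]; exact norm_mulVec_le _ _)
    (Eventually.of_forall fun t => by simp only [Matrix.mulVec_zero, norm_zero]; positivity)
    (fun u hu => by
      refine (aemeasurable_pi_iff.2 fun i => AEStronglyMeasurable.aemeasurable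
        ?_).aestronglyMeasurable
      refine Finset.aestronglyMeasurable_fun_sum _ fun j _ => ?_
      exact (locallyIntegrable_of_intervalIntegrable (hA i j)).aestronglyMeasurable.mul
        ((continuous_apply j).comp hu).aestronglyMeasurable)
    0 ξ
  exact ⟨x, hx0, vecPrimOn_of_isPrimitiveOn hx⟩

/-- `Φ` is the fundamental matrix of `ẋ = A x` with `Φ 0 = 1`, and `Ψ` is its inverse. -/
structure IsFundamental [Fintype ι] [DecidableEq ι] (A Φ Ψ : ℝ → Matrix ι ι ℝ) : Prop where
  zero : Φ 0 = 1
  prim : MatPrimOn univ Φ fun t => A t * Φ t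
  prim_inv : MatPrimOn univ Ψ fun t => -(Ψ t * A t)
  inv_mul : ∀ t, Ψ t * Φ t = 1
  mul_inv : ∀ t, Φ t * Ψ t = 1

/-- The inverse is built independently, its rows being solutions of the adjoint system; then `Ψ Φ`
has zero derivative and equals `1` at time `0`. This avoids differentiating a matrix inverse. -/
theorem exists_isFundamental [Fintype ι] [DecidableEq ι] {A : ℝ → Matrix ι ι ℝ}
    (hA : ∀ i j a b, IntervalIntegrable (fun t => A t i j) volume a b) :
    ∃ Φ Ψ : ℝ → Matrix ι ι ℝ, IsFundamental A Φ Ψ := by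
  choose x hx0 hx using fun j => exists_linear_solution hA (Pi.single j 1)
  choose y hy0 hy using fun j => exists_linear_solution (A := fun t => -(A t)ᵀ)
    (fun i j a b => (hA j i a b).neg) (Pi.single j 1)
  have hΦ : MatPrimOn univ (fun t => Matrix.of fun i j => x j t i)
      fun t => A t * Matrix.of fun i j => x j t i := fun i j => hx j i
  have hΨ : MatPrimOn univ (fun t => Matrix.of fun i j => y i t j)
      fun t => -((Matrix.of fun i j => y i t j) * A t) := by
    refine MatPrimOn.congr_deriv (M' := fun t => Matrix.of fun i j => (-(A t)ᵀ *ᵥ y i t) j)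
      (fun i j => hy i j) fun t _ => ?_
    ext i j
    simp only [Matrix.neg_apply, Matrix.mul_apply, Matrix.mulVec, mul_neg, Finset.sum_neg_distrib,
      _root_.dotProduct, Matrix.transpose_apply, Matrix.of_apply, mul_comm]
  have h0 : (Matrix.of fun i j => x j 0 i : Matrix ι ι ℝ) = 1 := by
    ext i j
    simp [hx0, Matrix.one_apply, Pi.single_apply]
  have h0' : (Matrix.of fun i j => y i 0 j : Matrix ι ι ℝ) = 1 := by
    ext i j
    simp [hy0, Matrix.one_apply, Pi.single_apply, eq_comm]
  have h1 : ∀ t, (Matrix.of fun i j => y i t j) * (Matrix.of fun i j => x j t i) =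
      (1 : Matrix ι ι ℝ) := fun t => by
    have h2 : MatPrimOn univ (fun t => (Matrix.of fun i j => y i t j) *
        (Matrix.of fun i j => x j t i : Matrix ι ι ℝ)) fun _ => 0 :=
      (MatPrimOn.mul hΨ hΦ).congr_deriv fun t _ => by
        rw [Matrix.neg_mul, Matrix.mul_assoc, neg_add_cancel]
    rw [h2.eq_of_deriv_eq_zero t 0, h0, h0', one_mul]
  exact ⟨_, _, ⟨h0, hΦ, hΨ, h1, fun t => mul_eq_one_comm.1 (h1 t)⟩⟩

namespace IsFundamental

variable [Fintype ι] [DecidableEq ι] {A Φ Ψ : ℝ → Matrix ι ι ℝ} {T : ℝ}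

/-- Since `A` is periodic, `Φ (t + T)` solves the same system, so `Ψ t * Φ (t + T)` is constant,
with value `Φ T` at `t = 0`. -/
theorem add_period (h : IsFundamental A Φ Ψ) (hA : Function.Periodic A T) (t : ℝ) :
    Φ (t + T) = Φ t * Φ T := by
  have hs : MatPrimOn univ (fun t => Φ (t + T)) fun t => A t * Φ (t + T) :=
    MatPrimOn.congr_deriv (fun i j => (h.prim i j).comp_add_right T) fun t _ => by
      simp only [hA t]
  have h2 : MatPrimOn univ (fun t => Ψ t * Φ (t + T)) fun _ => 0 :=
    (MatPrimOn.mul h.prim_inv hs).congr_deriv fun t _ => by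
      rw [Matrix.neg_mul, Matrix.mul_assoc, neg_add_cancel]
  have h3 := h2.eq_of_deriv_eq_zero t 0
  have h4 : Ψ 0 = 1 := by simpa [h.zero] using h.inv_mul 0
  rw [zero_add, h4, one_mul] at h3
  rw [← h3, ← Matrix.mul_assoc, h.mul_inv, one_mul]

theorem add_nat_period (h : IsFundamental A Φ Ψ) (hA : Function.Periodic A T) (t : ℝ) (j : ℕ) :
    Φ (t + j * T) = Φ t * Φ T ^ j := by
  induction j with
  | zero => simp
  | succ j ih =>
    have : t + ((j + 1 : ℕ) : ℝ) * T = (t + j * T) + T := by push_cast; ring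
    rw [this, h.add_period hA, ih, Matrix.mul_assoc, pow_succ]

end IsFundamental

/-- The discrete Lyapunov equation. -/
theorem exists_discrete_lyapunov [Fintype ι] [DecidableEq ι] {M Q : Matrix ι ι ℝ}
    (hM : Tendsto (fun k : ℕ => M ^ k) atTop (𝓝 0)) (hQ : Q.PosSemidef) :
    ∃ P : Matrix ι ι ℝ, Pᵀ = P ∧ Mᵀ * P * M = P - Q ∧ ∀ v, v ⬝ᵥ Q *ᵥ v ≤ v ⬝ᵥ P *ᵥ v := by
  -- Iterating gives `X = (M ^ k)ᵀ X M ^ k → 0`. In finite dimension this injectivity of `X ↦ X - Mᵀ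
  -- X M` gives existence without summing a series, and it also forces the solution to be symmetric.
  have hinj : ∀ X : Matrix ι ι ℝ, X = Mᵀ * X * M → X = 0 := by
    intro X hX
    have h1 : ∀ k : ℕ, X = (M ^ k)ᵀ * X * M ^ k := by
      intro k
      induction k with
      | zero => simp
      | succ k ih =>
        conv_lhs => rw [ih, hX]
        simp only [pow_succ', Matrix.transpose_mul, Matrix.mul_assoc]
    have h2 : Tendsto (fun k : ℕ => (M ^ k)ᵀ * X * M ^ k) atTop (𝓝 0) := by
      have h3 : Tendsto (fun k : ℕ => (M ^ k)ᵀ) atTop (𝓝 0) := by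
        have := (continuous_id.matrix_transpose.tendsto (0 : Matrix ι ι ℝ)).comp hM
        rwa [id, Matrix.transpose_zero] at this
      simpa using (h3.mul_const X).mul hM
    exact tendsto_nhds_unique (tendsto_const_nhds.congr h1) h2
  let L : Matrix ι ι ℝ →ₗ[ℝ] Matrix ι ι ℝ :=
    { toFun := fun X => X - Mᵀ * X * M
      map_add' := fun X Y => by rw [Matrix.mul_add, Matrix.add_mul]; abel
      map_smul' := fun c X => by
        simp only [Matrix.mul_smul, Matrix.smul_mul, RingHom.id_apply, smul_sub] }
  have hL : Function.Injective L := by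
    rw [injective_iff_map_eq_zero]
    exact fun X hX => hinj X (sub_eq_zero.1 hX)
  obtain ⟨P, hP⟩ := (LinearMap.injective_iff_surjective.1 hL) Q
  have hP' : P - Mᵀ * P * M = Q := hP
  have hQt : Qᵀ = Q := by simpa using hQ.1.eq
  have hsymm : Pᵀ = P := by
    rw [← sub_eq_zero]
    refine hinj _ ?_
    have h1 : Pᵀ - Mᵀ * Pᵀ * M = Q := by
      have := congrArg Matrix.transpose hP'
      simpa [Matrix.transpose_mul, Matrix.mul_assoc, hQt] using this
    rw [Matrix.mul_sub, Matrix.sub_mul, ← sub_eq_zero]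
    calc Pᵀ - P - (Mᵀ * Pᵀ * M - Mᵀ * P * M) = (Pᵀ - Mᵀ * Pᵀ * M) - (P - Mᵀ * P * M) := by abel
      _ = 0 := by rw [h1, hP', sub_self]
  have hMPM : Mᵀ * P * M = P - Q := by rw [← hP']; abel
  refine ⟨P, hsymm, hMPM, fun v => ?_⟩
  have hquad : ∀ (X : Matrix ι ι ℝ) v, (M *ᵥ v) ⬝ᵥ X *ᵥ (M *ᵥ v) = v ⬝ᵥ (Mᵀ * X * M) *ᵥ v := by
    intro X v
    rw [← Matrix.mulVec_mulVec, ← Matrix.mulVec_mulVec, Matrix.dotProduct_mulVec v Mᵀ,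
      Matrix.vecMul_transpose]
  -- Along the orbit of `v` the form of `P` decreases by the form of `Q` and tends to zero; hence `a
  -- 1 ≥ 0`, and `a 0` is at least the first decrement.
  let a : ℕ → ℝ := fun k => (M ^ k *ᵥ v) ⬝ᵥ P *ᵥ (M ^ k *ᵥ v)
  have hstep : ∀ k, a (k + 1) = a k - (M ^ k *ᵥ v) ⬝ᵥ Q *ᵥ (M ^ k *ᵥ v) := by
    intro k
    simp only [a]
    rw [pow_succ', ← Matrix.mulVec_mulVec, hquad, hMPM, Matrix.sub_mulVec, dotProduct_sub]
  have hanti : Antitone a := antitone_nat_of_succ_le fun k => by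
    rw [hstep]
    have := hQ.dotProduct_mulVec_nonneg (M ^ k *ᵥ v)
    simp only [star_trivial] at this
    linarith
  have hlim : Tendsto a atTop (𝓝 0) := by
    have h1 : Tendsto (fun k : ℕ => M ^ k *ᵥ v) atTop (𝓝 0) := by
      have : Continuous fun X : Matrix ι ι ℝ => X *ᵥ v := by fun_prop
      have := (this.tendsto 0).comp hM
      rwa [Matrix.zero_mulVec] at this
    have h2 : Continuous fun u : ι → ℝ => u ⬝ᵥ P *ᵥ u := by fun_prop
    have := (h2.tendsto 0).comp h1
    rwa [zero_dotProduct] at this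
  have h1 : 0 ≤ a 1 := hanti.le_of_tendsto hlim 1
  have h2 := hstep 0
  simp only [zero_add, pow_zero, Matrix.one_mulVec, a] at h1 h2
  linarith

end LinearSystem

end HarmonicControl

namespace HarmonicControl

/-! ### Powers of the monodromy matrix and the periodic Lyapunov differential equation -/

section LyapunovMatrix

open Set Matrix

variable {ι : Type} [Fintype ι] [DecidableEq ι]

section Powers

attribute [local instance] Matrix.linftyOpNormedRing Matrix.linftyOpNormedAlgebra

theorem norm_apply_le_linftyOpNorm (M : Matrix ι ι ℂ) (i j : ι) : ‖M i j‖ ≤ ‖M‖ := by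
  have h := Matrix.linfty_opNorm_mulVec M (Pi.single j 1)
  rw [Matrix.mulVec_single_one] at h
  have h1 : ‖(Pi.single j 1 : ι → ℂ)‖ ≤ 1 := by
    rw [pi_norm_le_iff_of_nonneg zero_le_one]
    intro l
    rcases eq_or_ne l j with rfl | hl <;> simp [*]
  calc ‖M i j‖ ≤ ‖M.col j‖ := norm_le_pi_norm (M.col j) i
    _ ≤ ‖M‖ * ‖(Pi.single j 1 : ι → ℂ)‖ := h
    _ ≤ ‖M‖ := mul_le_of_le_one_right (norm_nonneg _) h1

/-- Gelfand's formula: the spectral radius is below `1`, so `‖M ^ k‖ ≤ r ^ k` eventually for some `r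
< 1`. The conclusion is stated entrywise so that it does not depend on the matrix norm chosen
locally. -/
theorem tendsto_pow_apply_zero_of_eigenvalue {M : Matrix ι ι ℂ}
    (h : ∀ (z : ℂ) (v : ι → ℂ), v ≠ 0 → M *ᵥ v = z • v → ‖z‖ < 1) (i j : ι) :
    Tendsto (fun k : ℕ => (M ^ k) i j) atTop (𝓝 0) := by
  have : Nonempty ι := ⟨i⟩
  have hr : spectralRadius ℂ M < (1 : NNReal) := by
    refine spectrum.spectralRadius_lt_of_forall_lt M fun z hz => ?_
    rw [spectrum.mem_iff, Matrix.isUnit_iff_isUnit_det, isUnit_iff_ne_zero, not_not] at hz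
    obtain ⟨v, hv, hvM⟩ := Matrix.exists_mulVec_eq_zero_iff.2 hz
    refine h z v hv ?_
    rw [Matrix.sub_mulVec, sub_eq_zero, Matrix.algebraMap_eq_diagonal] at hvM
    rw [← hvM]
    ext l
    simp [Matrix.mulVec_diagonal]
  obtain ⟨r, hr1, hr2⟩ := ENNReal.lt_iff_exists_nnreal_btwn.1 hr
  have hr3 : r < 1 := by exact_mod_cast hr2
  have h1 := (spectrum.pow_nnnorm_pow_one_div_tendsto_nhds_spectralRadius M).eventually_lt_const hr1
  have h2 : ∀ᶠ k : ℕ in atTop, ‖(M ^ k) i j‖ ≤ (r : ℝ) ^ k := by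
    filter_upwards [h1, eventually_gt_atTop 0] with k hk hk0
    have hk' : (k : ℝ) ≠ 0 := by positivity
    have h3 : (‖M ^ k‖₊ : ENNReal) ≤ (r : ENNReal) ^ k := by
      have h4 := ENNReal.rpow_le_rpow hk.le (z := k) (by positivity)
      rwa [← ENNReal.rpow_mul, one_div, inv_mul_cancel₀ hk', ENNReal.rpow_one,
        ENNReal.rpow_natCast] at h4
    have h5 : ‖M ^ k‖₊ ≤ r ^ k := by exact_mod_cast h3
    exact (norm_apply_le_linftyOpNorm _ i j).trans (by exact_mod_cast h5)
  refine squeeze_zero_norm' h2 (tendsto_pow_atTop_nhds_zero_of_lt_one r.2 ?_)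
  exact_mod_cast hr3

end Powers

theorem cMat_pow (M : Matrix ι ι ℝ) (k : ℕ) : cMat (M ^ k) = cMat M ^ k :=
  map_pow Complex.ofRealHom.mapMatrix M k

theorem tendsto_pow_zero_of_eigenvalue {M : Matrix ι ι ℝ}
    (h : ∀ (z : ℂ) (v : ι → ℂ), v ≠ 0 → cMat M *ᵥ v = z • v → ‖z‖ < 1) :
    Tendsto (fun k : ℕ => M ^ k) atTop (𝓝 0) := by
  refine tendsto_pi_nhds.2 fun i => tendsto_pi_nhds.2 fun j => ?_
  have h1 := tendsto_pow_apply_zero_of_eigenvalue h i j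
  simp only [← cMat_pow] at h1
  have h2 := (Complex.continuous_re.tendsto 0).comp h1
  exact h2

/-- Cauchy–Schwarz for the form `Q` between `e` and `u = Q⁻¹ δ_i`, since `u ⬝ᵥ Q e = e i` and `u ⬝ᵥ
Q u = Q⁻¹ i i`. -/
theorem PosDef.sq_le_inv_mul {Q : Matrix ι ι ℝ} (hQ : Q.PosDef) (e : ι → ℝ) (i : ι) :
    e i ^ 2 ≤ Q⁻¹ i i * (e ⬝ᵥ Q *ᵥ e) := by
  have hdet : IsUnit Q.det := (Matrix.isUnit_iff_isUnit_det Q).1 hQ.isUnit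
  have hQt : Qᵀ = Q := by simpa using hQ.1.eq
  set u := Q⁻¹ *ᵥ Pi.single i 1 with hu
  have hui : u i = Q⁻¹ i i := by simp [hu]
  have hQu : Q *ᵥ u = Pi.single i 1 := by
    rw [hu, Matrix.mulVec_mulVec, Matrix.mul_nonsing_inv _ hdet, Matrix.one_mulVec]
  have hβ : 0 < Q⁻¹ i i := hQ.inv.diag_pos
  -- The form at this vector equals `Q⁻¹ i i` times the difference of the two sides of the claim.
  have h1 := hQ.posSemidef.dotProduct_mulVec_nonneg (Q⁻¹ i i • e - e i • u)
  have h2 : u ⬝ᵥ Q *ᵥ e = e i := by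
    rw [Matrix.dotProduct_mulVec, ← Matrix.mulVec_transpose, hQt, hQu, single_one_dotProduct]
  simp only [star_trivial, Matrix.mulVec_sub, Matrix.mulVec_smul, hQu, sub_dotProduct,
    dotProduct_sub, smul_dotProduct, dotProduct_smul, h2, dotProduct_single_one, hui,
    smul_eq_mul, Pi.sub_apply, Pi.smul_apply] at h1
  nlinarith

/-- The periodic differential Lyapunov equation. -/
theorem IsFundamental.exists_periodic_lyapunov {A Φ Ψ Q : ℝ → Matrix ι ι ℝ} {T : ℝ} (hT : 0 < T)
    (hΦ : IsFundamental A Φ Ψ) (hA : Function.Periodic A T)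
    (hM : Tendsto (fun k : ℕ => Φ T ^ k) atTop (𝓝 0)) (hQper : Function.Periodic Q T)
    (hQint : ∀ i j a b, IntervalIntegrable (fun t => Q t i j) volume a b)
    (hQpos : ∀ᵐ t, (Q t).PosDef) :
    ∃ P : ℝ → Matrix ι ι ℝ, Function.Periodic P T ∧ (∀ t, (P t).PosDef) ∧
      MatPrimOn univ P fun t => -((A t)ᵀ * P t + P t * A t + Q t) := by
  have hΦc : ∀ i j, Continuous fun t => Φ t i j := fun i j => (hΦ.prim i j).continuous
  have hint : ∀ i j a b, IntervalIntegrable (fun t => ((Φ t)ᵀ * Q t * Φ t) i j) volume a b := by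
    intro i j a b
    simp only [Matrix.mul_apply, Finset.sum_mul]
    have := IntervalIntegrable.sum (μ := volume) (a := a) (b := b) Finset.univ
      (f := fun l t => ∑ l', (Φ t)ᵀ i l' * Q t l' l * Φ t l j) fun l _ => by
        have := IntervalIntegrable.sum (μ := volume) (a := a) (b := b) Finset.univ
          (f := fun l' t => (Φ t)ᵀ i l' * Q t l' l * Φ t l j) fun l' _ =>
          ((hQint l' l a b).continuousOn_mul (hΦc l' i).continuousOn).mul_continuousOn
            (hΦc l j).continuousOn
        simp only [Finset.sum_fn] at this
        exact this
    simp only [Finset.sum_fn] at this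
    exact this
  -- The Gramian of `Q` along the flow. In the moving frame the Lyapunov equation reads `(Φᵀ P Φ)' =
  -- -R'`, so `Φᵀ P Φ = P₀ - R`.
  set R : ℝ → Matrix ι ι ℝ := fun t => Matrix.of fun i j =>
    ∫ r in (0 : ℝ)..t, ((Φ r)ᵀ * Q r * Φ r) i j with hR
  have hRprim : MatPrimOn univ R fun t => (Φ t)ᵀ * Q t * Φ t := fun i j => by
    have := IsPrimitiveOn.of_integral (s := univ) (a := 0) (fun b _ => hint i j 0 b) 0
    simp only [zero_add] at this
    exact this
  have hR0 : R 0 = 0 := by ext i j; simp [hR]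
  have hquad : ∀ v (t : ℝ) r, v ⬝ᵥ (R t - R r) *ᵥ v =
      ∫ q in r..t, (Φ q *ᵥ v) ⬝ᵥ Q q *ᵥ (Φ q *ᵥ v) := by
    intro v t r
    have h1 : IsPrimitiveOn univ (fun t => v ⬝ᵥ R t *ᵥ v)
        (fun t => v ⬝ᵥ ((Φ t)ᵀ * Q t * Φ t) *ᵥ v) := by
      have h2 : VecPrimOn univ (fun _ => v) fun _ : ℝ => (0 : ι → ℝ) := fun i =>
        IsPrimitiveOn.const _
      have h3 := h2.dotProduct (hRprim.mulVec h2)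
      exact h3.congr_deriv fun t _ => by simp
    rw [Matrix.sub_mulVec, dotProduct_sub, h1.sub_eq (mem_univ r) (mem_univ t)]
    refine intervalIntegral.integral_congr fun q _ => ?_
    simp only [← Matrix.mulVec_mulVec, Matrix.dotProduct_mulVec v (Φ q)ᵀ, Matrix.vecMul_transpose]
  have hnn : ∀ v, ∀ᵐ q, 0 ≤ (Φ q *ᵥ v) ⬝ᵥ Q q *ᵥ (Φ q *ᵥ v) := fun v => by
    filter_upwards [hQpos] with q hq
    simpa using hq.posSemidef.dotProduct_mulVec_nonneg (Φ q *ᵥ v)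
  have hquad_nonneg : ∀ v r t, r ≤ t → 0 ≤ v ⬝ᵥ (R t - R r) *ᵥ v := fun v r t hrt => by
    rw [hquad]
    exact intervalIntegral.integral_nonneg_of_ae hrt (hnn v)
  have hquad_pos : ∀ v, v ≠ 0 → 0 < v ⬝ᵥ (R T) *ᵥ v := fun v hv => by
    have h0 := hquad v T 0
    rw [hR0, sub_zero] at h0
    refine lt_of_le_of_ne (by have := hquad_nonneg v 0 T hT.le; rwa [hR0, sub_zero] at this) ?_
    intro h1
    have hi : IntervalIntegrable (fun q => (Φ q *ᵥ v) ⬝ᵥ Q q *ᵥ (Φ q *ᵥ v)) volume 0 T := by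
      have h2 : VecPrimOn univ (fun _ => v) fun _ : ℝ => (0 : ι → ℝ) := fun i =>
        IsPrimitiveOn.const _
      have h3 := (h2.dotProduct (hRprim.mulVec h2)).intervalIntegrable (mem_univ 0) (mem_univ T)
      refine h3.congr_ae (Eventually.of_forall fun q => ?_)
      simp only [← Matrix.mulVec_mulVec, Matrix.dotProduct_mulVec v (Φ q)ᵀ,
        Matrix.vecMul_transpose, zero_dotProduct, Matrix.mulVec_zero, zero_add, add_zero]
    rw [← h1, eq_comm, intervalIntegral.integral_of_le hT.le, integral_eq_zero_iff_of_nonneg_ae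
      (ae_restrict_of_ae (hnn v)) hi.1] at h0
    -- A vanishing integral would make the form zero almost everywhere, although `Q` is almost
    -- everywhere positive definite and `Φ q v ≠ 0`; the interval would then be null.
    have h4 : ∀ᵐ q ∂(volume.restrict (Ioc 0 T)), False := by
      filter_upwards [h0, ae_restrict_of_ae hQpos] with q hq hq'
      have hne : Φ q *ᵥ v ≠ 0 := fun h => hv (by
        have := congrArg (fun u => Ψ q *ᵥ u) h
        simpa [Matrix.mulVec_mulVec, hΦ.inv_mul] using this)
      have := hq'.dotProduct_mulVec_pos hne
      simp only [star_trivial] at this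
      exact this.ne' hq
    rw [ae_iff] at h4
    simp only [not_false_eq_true] at h4
    have h5 : volume (Ioc 0 T) = 0 := by simpa using h4
    rw [Real.volume_Ioc] at h5
    simp only [sub_zero, ENNReal.ofReal_eq_zero] at h5
    linarith
  have hQt : ∀ᵐ t, (Q t)ᵀ = Q t := by
    filter_upwards [hQpos] with t ht
    simpa using ht.1.eq
  have hRt : ∀ t, (R t)ᵀ = R t := fun t => by
    ext i j
    simp only [hR, Matrix.transpose_apply, Matrix.of_apply]
    refine intervalIntegral.integral_congr_ae ?_
    filter_upwards [hQt] with q hq _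
    have h1 : ((Φ q)ᵀ * Q q * Φ q)ᵀ = (Φ q)ᵀ * Q q * Φ q := by
      simp [Matrix.transpose_mul, hq, Matrix.mul_assoc]
    exact congrFun (congrFun h1 i) j
  -- The weight `R T` is the one for which the initial value `P₀` is reproduced after one period.
  obtain ⟨P₀, hP₀t, hP₀, hP₀le⟩ := exists_discrete_lyapunov (Q := R T) hM
    (PosSemidef.of_dotProduct_mulVec_nonneg (hRt T) fun v => by
      have := hquad_nonneg v 0 T hT.le
      simpa [hR0] using this)
  have hΨT : ∀ t, (Ψ t)ᵀ * (Φ t)ᵀ = 1 := fun t => by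
    rw [← Matrix.transpose_mul, hΦ.mul_inv, Matrix.transpose_one]
  have hΦT : ∀ t, (Φ t)ᵀ * (Ψ t)ᵀ = 1 := fun t => by
    rw [← Matrix.transpose_mul, hΦ.inv_mul, Matrix.transpose_one]
  have hconst : MatPrimOn univ (fun _ => P₀) fun _ => 0 := fun i j => IsPrimitiveOn.const _
  have hPR : MatPrimOn univ (fun t => P₀ - R t) fun t => -((Φ t)ᵀ * Q t * Φ t) := fun i j =>
    ((hconst i j).sub (hRprim i j)).congr_deriv fun t _ => by simp
  have hPprim : MatPrimOn univ (fun t => (Ψ t)ᵀ * (P₀ - R t) * Ψ t)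
      fun t => -((A t)ᵀ * ((Ψ t)ᵀ * (P₀ - R t) * Ψ t) + ((Ψ t)ᵀ * (P₀ - R t) * Ψ t) * A t
        + Q t) := by
    refine MatPrimOn.congr_deriv
      (MatPrimOn.mul (MatPrimOn.mul hΦ.prim_inv.transpose hPR) hΦ.prim_inv) fun t _ => ?_
    have h1 : (Ψ t)ᵀ * -((Φ t)ᵀ * Q t * Φ t) * Ψ t = -Q t := by
      calc _ = -(((Ψ t)ᵀ * (Φ t)ᵀ) * Q t * (Φ t * Ψ t)) := by
            simp only [Matrix.mul_neg, Matrix.neg_mul, Matrix.mul_assoc]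
        _ = _ := by rw [hΨT, hΦ.mul_inv, Matrix.one_mul, Matrix.mul_one]
    rw [Matrix.add_mul, h1]
    simp only [Matrix.transpose_neg, Matrix.transpose_mul, Matrix.neg_mul, Matrix.mul_neg,
      Matrix.mul_assoc]
    abel
  have hPΦ : ∀ t, (Φ t)ᵀ * ((Ψ t)ᵀ * (P₀ - R t) * Ψ t) * Φ t = P₀ - R t := fun t => by
    calc _ = ((Φ t)ᵀ * (Ψ t)ᵀ) * (P₀ - R t) * (Ψ t * Φ t) := by simp only [Matrix.mul_assoc]
      _ = _ := by rw [hΦT, hΦ.inv_mul, Matrix.one_mul, Matrix.mul_one]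
  have hper : Function.Periodic (fun t => (Ψ t)ᵀ * (P₀ - R t) * Ψ t) T := by
    set P : ℝ → Matrix ι ι ℝ := fun t => (Ψ t)ᵀ * (P₀ - R t) * Ψ t with hP
    have hs : MatPrimOn univ (fun t => P (t + T))
        fun t => -((A t)ᵀ * P (t + T) + P (t + T) * A t + Q t) :=
      MatPrimOn.congr_deriv (fun i j => (hPprim i j).comp_add_right T) fun t _ => by
        simp only [hA t, hQper t]; rfl
    have h1 := MatPrimOn.mul (MatPrimOn.mul hΦ.prim.transpose hs) hΦ.prim
    -- The translate of `P` solves the same equation, so this expression is constant. At `t = 0` it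
    -- is `P T = P₀`, whence `Φᵀ P(t + T) Φ = P₀ - R = Φᵀ P(t) Φ`.
    have h2 : MatPrimOn univ (fun t => (Φ t)ᵀ * P (t + T) * Φ t + R t) fun _ => 0 := by
      refine MatPrimOn.congr_deriv (fun i j => (h1 i j).add (hRprim i j)) (N' := fun _ => 0)
        (M' := fun t => ((A t * Φ t)ᵀ * P (t + T) + (Φ t)ᵀ *
          -((A t)ᵀ * P (t + T) + P (t + T) * A t + Q t)) * Φ t + (Φ t)ᵀ * P (t + T) * (A t * Φ t)
          + (Φ t)ᵀ * Q t * Φ t) fun t _ => ?_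
      simp only [Matrix.transpose_mul, Matrix.mul_add, Matrix.add_mul, Matrix.neg_mul,
        Matrix.mul_neg, Matrix.mul_assoc]
      abel
    intro t
    have h3 := h2.eq_of_deriv_eq_zero t 0
    have h4 : P T = P₀ := by
      have : P₀ - R T = (Φ T)ᵀ * P₀ * Φ T := hP₀.symm
      simp only [hP]
      rw [this]
      calc _ = ((Ψ T)ᵀ * (Φ T)ᵀ) * P₀ * (Φ T * Ψ T) := by simp only [Matrix.mul_assoc]
        _ = _ := by rw [hΨT, hΦ.mul_inv, Matrix.one_mul, Matrix.mul_one]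
    rw [zero_add, h4, hΦ.zero, hR0, Matrix.transpose_one, Matrix.one_mul, Matrix.mul_one,
      add_zero, ← eq_sub_iff_add_eq, ← hPΦ t] at h3
    have h5 := congrArg (fun X => (Ψ t)ᵀ * X * Ψ t) h3
    have h6 : ∀ X : Matrix ι ι ℝ, (Ψ t)ᵀ * ((Φ t)ᵀ * X * Φ t) * Ψ t = X := fun X => by
      calc _ = ((Ψ t)ᵀ * (Φ t)ᵀ) * X * (Φ t * Ψ t) := by simp only [Matrix.mul_assoc]
        _ = _ := by rw [hΨT, hΦ.mul_inv, Matrix.one_mul, Matrix.mul_one]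
    rwa [h6, h6] at h5
  refine ⟨_, hper, fun t => ?_, hPprim⟩
  -- By periodicity positivity is needed only for `r ∈ [0, T)`, where `R r ≤ R T`.
  obtain ⟨r, hr, hrt⟩ := hper.exists_mem_Ico₀ hT t
  rw [hrt]
  refine PosDef.of_dotProduct_mulVec_pos ?_ fun v hv => ?_
  · change _ᴴ = _
    simp only [conjTranspose_eq_transpose_of_trivial, Matrix.transpose_mul,
      Matrix.transpose_transpose, Matrix.transpose_sub, hP₀t, hRt, Matrix.mul_assoc]
  · have hne : Ψ r *ᵥ v ≠ 0 := fun h => hv (by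
      have := congrArg (fun u => Φ r *ᵥ u) h
      simpa [Matrix.mulVec_mulVec, hΦ.mul_inv] using this)
    set u := Ψ r *ᵥ v with hu
    have h1 : star v ⬝ᵥ ((Ψ r)ᵀ * (P₀ - R r) * Ψ r) *ᵥ v = u ⬝ᵥ (P₀ - R r) *ᵥ u := by
      rw [star_trivial, ← Matrix.mulVec_mulVec, ← Matrix.mulVec_mulVec,
        Matrix.dotProduct_mulVec v (Ψ r)ᵀ, Matrix.vecMul_transpose]
    -- Here `P₀ - R T = Φ(T)ᵀ P₀ Φ(T)` is used. The first term is positive since `P₀ ≥ R T > 0`, the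
    -- second is nonnegative.
    have h2 : u ⬝ᵥ (P₀ - R r) *ᵥ u = (Φ T *ᵥ u) ⬝ᵥ P₀ *ᵥ (Φ T *ᵥ u) +
        u ⬝ᵥ (R T - R r) *ᵥ u := by
      have h3 : (Φ T *ᵥ u) ⬝ᵥ P₀ *ᵥ (Φ T *ᵥ u) = u ⬝ᵥ (P₀ - R T) *ᵥ u := by
        rw [← hP₀, ← Matrix.mulVec_mulVec, ← Matrix.mulVec_mulVec,
          Matrix.dotProduct_mulVec u (Φ T)ᵀ, Matrix.vecMul_transpose]
      rw [h3]
      simp only [Matrix.sub_mulVec, dotProduct_sub]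
      ring
    have hne' : Φ T *ᵥ u ≠ 0 := fun h => hne (by
      have := congrArg (fun u => Ψ T *ᵥ u) h
      simpa [Matrix.mulVec_mulVec, hΦ.inv_mul] using this)
    rw [h1, h2]
    have h4 := hP₀le (Φ T *ᵥ u)
    have h5 := hquad_pos _ hne'
    have h6 := hquad_nonneg u r T hr.2.le
    linarith

end LyapunovMatrix

end HarmonicControl

namespace HarmonicControl

/-! ### The operator `𝒜 - N` in the time domain -/

section Graph

open Set Matrix

variable {ι κ μ : Type} {T : ℝ}

theorem cMat_mul [Fintype κ] (A : Matrix ι κ ℝ) (B : Matrix κ μ ℝ) :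
    cMat (A * B) = cMat A * cMat B :=
  Matrix.map_mul (f := Complex.ofRealHom)

theorem cMat_add (A B : Matrix ι κ ℝ) : cMat (A + B) = cMat A + cMat B := by
  ext i j; simp [cMat]

theorem cMat_neg (A : Matrix ι κ ℝ) : cMat (-A) = -cMat A := by
  ext i j; simp [cMat]

theorem cMat_transpose (A : Matrix ι κ ℝ) : cMat Aᵀ = (cMat A)ᵀ := rfl

theorem cMat_one [DecidableEq ι] : cMat (1 : Matrix ι ι ℝ) = 1 := by
  ext i j; rcases eq_or_ne i j with rfl | h <;> simp [cMat, *]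

theorem cMat_smul (c : ℝ) (A : Matrix ι κ ℝ) : cMat (c • A) = (c : ℂ) • cMat A := by
  ext i j; simp [cMat]

theorem cVec_mulVec [Fintype κ] (A : Matrix ι κ ℝ) (v : κ → ℝ) :
    cVec (A *ᵥ v) = cMat A *ᵥ cVec v := by
  ext i; simp [cVec, cMat, Matrix.mulVec, dotProduct]

theorem star_cMat_mulVec [Fintype κ] (A : Matrix ι κ ℝ) (v : κ → ℂ) :
    star (cMat A *ᵥ v) = cMat A *ᵥ star v := by
  ext i
  simp [cMat, Matrix.mulVec, dotProduct]

theorem star_cMat_mulVec_dotProduct [Fintype ι] [Fintype κ] (A : Matrix ι κ ℝ) (v : κ → ℂ)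
    (u : ι → ℂ) : star (cMat A *ᵥ v) ⬝ᵥ u = star v ⬝ᵥ (cMat Aᵀ *ᵥ u) := by
  rw [star_cMat_mulVec, cMat_transpose, Matrix.dotProduct_mulVec, Matrix.vecMul_transpose]

theorem MatPrimOn.cMat {s : Set ℝ} {M M' : ℝ → Matrix ι κ ℝ} (h : MatPrimOn s M M') :
    MatPrimOn s (fun t => HarmonicControl.cMat (M t)) fun t => HarmonicControl.cMat (M' t) :=
  fun i j => ofReal_primitive (h i j)

theorem VecPrimOn.cVec {s : Set ℝ} {x x' : ℝ → ι → ℝ} (h : VecPrimOn s x x') :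
    VecPrimOn s (fun t => HarmonicControl.cVec (x t)) fun t => HarmonicControl.cVec (x' t) :=
  fun i => ofReal_primitive (h i)

theorem VecPrimOn.vecL2 {x x' : ℝ → ι → ℂ} {t : ℝ} (h : VecPrimOn (Icc (t - T) t) x x') :
    VecL2 T t x := fun i => WindowL2.of_continuousOn (h i).continuousOn

/-- Continuity also reaches the left endpoint `t - T`, which is outside the half-open window; that
endpoint is where initial values are read off. -/
theorem VecPrimOn.eq_zero_of_ae {x x' : ℝ → ι → ℂ} {t : ℝ} (hT : 0 < T)
    (hx : VecPrimOn (Icc (t - T) t) x x') (h : ∀ᵐ τ, τ ∈ Ioc (t - T) t → x τ = 0) :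
    ∀ τ ∈ Icc (t - T) t, x τ = 0 := by
  intro τ hτ
  funext i
  have hne : t - T ≠ t := by linarith
  refine Measure.eqOn_Icc_of_ae_eq volume hne ?_ (hx i).continuousOn
    (continuousOn_const (c := (0 : ℂ))) hτ
  rw [EventuallyEq, ae_restrict_iff' measurableSet_Icc]
  have h1 : ∀ᵐ x, x ≠ t - T := by simp [ae_iff, measure_singleton]
  filter_upwards [h, h1] with r hr hr' hm
  exact congrFun (hr ⟨lt_of_le_of_ne hm.1 hr'.symm, hm.2⟩) i

variable [Fintype ι]

/-- Equal end values kill the boundary term in the integration by parts, so `ẋ = A x - y` becomes `N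
X = 𝒜 X - Y`. -/
theorem harmGraph_of_primitive (hT : 0 < T) {A : ℝ → Matrix ι ι ℂ} {t : ℝ} (hA : MatL2 T t A)
    {x y : ℝ → ι → ℂ} (hx : VecPrimOn (Icc (t - T) t) x fun τ => A τ *ᵥ x τ - y τ)
    (hy : VecL2 T t y) (hper : x t = x (t - T)) {X Y : Ell2 ι}
    (hX : X.coords = slidingFourier T x t) (hY : Y.coords = slidingFourier T y t) :
    HarmGraph T (toeplitz T A t) X Y := by
  intro k i
  have hx2 := hx.vecL2
  have h1 := phasor_deriv hT (hx i) k
  rw [hper, sub_self, zero_mul, mul_zero, zero_add] at h1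
  have h2 := phasor_sub (intervalIntegrable_mulVec hT.le hA hx2 i)
    ((hy i).intervalIntegrable hT.le) k
  have h3 : X k i = phasor T (fun τ => x τ i) t k := congrFun (congrFun hX k) i
  have h4 : Y k i = phasor T (fun τ => y τ i) t k := congrFun (congrFun hY k) i
  rw [hX, toeplitz_act hT hA hx2, h3, h4, slidingFourier_apply, ← h1]
  exact eq_sub_of_add_eq' (by rw [← eq_sub_iff_add_eq]; exact h2)

/-- The converse, describing the maximal domain: the graph relation prescribes the phasors of `A x -
y` as those of a derivative with zero jump, so `exists_ae_eq_add_integral` with `d = 0` corrects `x`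
on a null set. -/
theorem HarmGraph.exists_primitive (hT : 0 < T) {A : ℝ → Matrix ι ι ℂ} {t : ℝ}
    (hA : MatL2 T t A) {x y : ℝ → ι → ℂ} (hx : VecL2 T t x) (hy : VecL2 T t y) {X Y : Ell2 ι}
    (hX : X.coords = slidingFourier T x t) (hY : Y.coords = slidingFourier T y t)
    (h : HarmGraph T (toeplitz T A t) X Y) :
    ∃ x' : ℝ → ι → ℂ, VecPrimOn (Icc (t - T) t) x' (fun τ => A τ *ᵥ x' τ - y τ) ∧
      x' t = x' (t - T) ∧ X.coords = slidingFourier T x' t := by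
  have hint : ∀ i, IntervalIntegrable (fun τ => (A τ *ᵥ x τ - y τ) i) volume (t - T) t := fun i =>
    (intervalIntegrable_mulVec hT.le hA hx i).sub ((hy i).intervalIntegrable hT.le)
  have h1 : ∀ i (k : ℤ), phasor T (fun τ => (A τ *ᵥ x τ - y τ) i) t k =
      (1 / (T : ℂ)) * (0 * expo T k t) +
      Complex.I * ((2 * Real.pi / T : ℝ) : ℂ) * (k : ℂ) * phasor T (fun τ => x τ i) t k := by
    intro i k
    have h2 := phasor_sub (intervalIntegrable_mulVec hT.le hA hx i)
      ((hy i).intervalIntegrable hT.le) k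
    have h3 : X k i = phasor T (fun τ => x τ i) t k := congrFun (congrFun hX k) i
    have h4 : Y k i = phasor T (fun τ => y τ i) t k := congrFun (congrFun hY k) i
    have h5 := h k i
    rw [hX, toeplitz_act hT hA hx, h3, h4, slidingFourier_apply] at h5
    refine h2.trans ?_
    rw [h5]; ring
  choose h0 c hc using fun i => exists_ae_eq_add_integral hT (hx i) (hint i) (h1 i)
  have hae : ∀ᵐ τ, τ ∈ Ioc (t - T) t →
      x τ = fun i => c i + ∫ r in (t - T)..τ, (A r *ᵥ x r - y r) i := by
    filter_upwards [ae_all_iff.2 hc] with τ hτ hm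
    exact funext fun i => hτ i hm
  refine ⟨fun τ i => c i + ∫ r in (t - T)..τ, (A r *ᵥ x r - y r) i, fun i => ?_, ?_, ?_⟩
  · have h6 : IsPrimitiveOn (Icc (t - T) t)
        (fun τ => c i + ∫ r in (t - T)..τ, (A r *ᵥ x r - y r) i)
        (fun τ => (A τ *ᵥ x τ - y τ) i) :=
      IsPrimitiveOn.of_integral (fun b hb => (hint i).mono_set (uIcc_subset_uIcc left_mem_uIcc
        (by rwa [uIcc_of_le (by linarith)]))) _
    refine h6.congr (fun _ _ => rfl) ?_
    have h7 : ∀ᵐ x, x ≠ t - T := by simp [ae_iff, measure_singleton]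
    filter_upwards [hae, h7] with τ hτ hτ' hm
    rw [← hτ ⟨lt_of_le_of_ne hm.1 hτ'.symm, hm.2⟩]
  · funext i
    simp only [h0 i, intervalIntegral.integral_same]
  · rw [hX]
    exact slidingFourier_congr_ae hT.le hae

end Graph

/-! ### Floquet theory: a Hurwitz harmonic operator has a stable monodromy matrix -/

section Monodromy

open Set Matrix

variable {ι : Type} [Fintype ι] [DecidableEq ι] {T : ℝ} {A Φ Ψ : ℝ → Matrix ι ι ℝ}

theorem IsFundamental.prim_cMat (hΦ : IsFundamental A Φ Ψ) :
    MatPrimOn univ (fun t => cMat (Φ t)) fun t => cMat (A t) * cMat (Φ t) :=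
  hΦ.prim.cMat.congr_deriv fun _ _ => cMat_mul _ _

/-- A Floquet multiplier `μ` with eigenvector `v` makes `exp(-z t) Φ(t) v` periodic over one period
and solve `ẋ = A x - z x`, which is an eigenvector of `𝒜 - N` for `z`. -/
theorem IsFundamental.tendsto_pow (hT : 0 < T) (hΦ : IsFundamental A Φ Ψ)
    (hAper : Function.Periodic A T) (hA : ∀ t, MatL2 T t fun τ => cMat (A τ))
    (hH : IsHurwitz T (toeplitz T (fun τ => cMat (A τ)) 0)) :
    Tendsto (fun k : ℕ => Φ T ^ k) atTop (𝓝 0) := by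
  refine tendsto_pow_zero_of_eigenvalue fun μ v hv hμ => ?_
  by_contra hcon
  push Not at hcon
  have hμ0 : μ ≠ 0 := norm_pos_iff.1 (lt_of_lt_of_le one_pos hcon)
  have hTc : (T : ℂ) ≠ 0 := by exact_mod_cast hT.ne'
  -- Characteristic exponents are determined modulo `jω`; any logarithm would do, as only `Re z =
  -- log |μ| / T ≥ 0` matters.
  set z : ℂ := Complex.log μ / T with hz
  have hzre : 0 ≤ z.re := by
    rw [hz, Complex.div_ofReal_re, Complex.log_re]
    exact div_nonneg (Real.log_nonneg hcon) hT.le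
  have hE : ∀ τ : ℝ, HasDerivAt (fun τ : ℝ => Complex.exp (-(z * τ)))
      (-z * Complex.exp (-(z * τ))) τ := fun τ => by
    have h1 : HasDerivAt (fun τ : ℝ => -(z * (τ : ℂ))) (-(z * 1)) τ :=
      ((Complex.ofRealCLM.hasDerivAt (x := τ)).const_mul _).neg
    have := h1.cexp
    rw [mul_one, mul_comm (Complex.exp _)] at this
    exact this
  have hEprim : IsPrimitiveOn univ (fun τ : ℝ => Complex.exp (-(z * τ)))
      (fun τ : ℝ => -z * Complex.exp (-(z * τ))) :=
    IsPrimitiveOn.of_hasDerivAt hE (by fun_prop)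
  set x : ℝ → ι → ℂ := fun τ => Complex.exp (-(z * τ)) • (cMat (Φ τ) *ᵥ v) with hx
  have hvprim : VecPrimOn univ (fun _ => v) fun _ : ℝ => (0 : ι → ℂ) := fun i =>
    IsPrimitiveOn.const _
  have hxprim : VecPrimOn univ x fun τ => cMat (A τ) *ᵥ x τ - z • x τ := by
    have h1 := (hΦ.prim_cMat).mulVec hvprim
    refine VecPrimOn.congr_deriv (x' := fun τ i => -z * Complex.exp (-(z * τ)) *
      (cMat (Φ τ) *ᵥ v) i + Complex.exp (-(z * τ)) *
        ((cMat (A τ) * cMat (Φ τ)) *ᵥ v + cMat (Φ τ) *ᵥ (0 : ι → ℂ)) i)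
      (fun i => hEprim.mul (h1 i)) fun τ _ => ?_
    funext i
    simp only [hx, Matrix.mulVec_zero, add_zero, Matrix.mulVec_smul, Matrix.mulVec_mulVec,
      Pi.sub_apply, Pi.smul_apply, smul_eq_mul]
    ring
  have hxT : x T = x (T - T) := by
    simp only [hx, sub_self, hΦ.zero, cMat_one, Matrix.one_mulVec, hμ]
    have : z * (T : ℂ) = Complex.log μ := by rw [hz]; field_simp
    rw [this, Complex.exp_neg, Complex.exp_log hμ0, smul_smul, inv_mul_cancel₀ hμ0]
    simp
  have hx2 : VecL2 T T x := (hxprim.mono (subset_univ _)).vecL2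
  have hzx2 : VecL2 T T fun τ => z • x τ := fun i => (hx2 i).const_mul z
  have hg := harmGraph_of_primitive hT (hA T) (hxprim.mono (subset_univ _)) hzx2 hxT
    (coords_ofSignal hT hx2) (coords_ofSignal hT hzx2)
  rw [toeplitz_eq_of_periodic hT.ne' (fun τ => by rw [hAper τ]) T 0] at hg
  have h0 := (hH z hzre).1 _ _ hg (by
    rw [sub_eq_zero]
    refine Ell2.ext_coords ?_
    rw [coords_ofSignal]
    ext k i
    exact (phasor_const_mul z (fun τ => x τ i) T k).symm)
  have h1 : slidingFourier T x T = slidingFourier T (fun _ _ => 0) T := by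
    rw [← coords_ofSignal hT hx2, h0]
    ext k i
    simp [Ell2.coords, slidingFourier, phasor]
  have h2 := ae_eq_of_slidingFourier_eq hT hx2 (fun i => memLp_const 0) h1
  have h3 := (hxprim.mono (subset_univ _)).eq_zero_of_ae hT h2 (T - T) ⟨le_rfl, by linarith⟩
  apply hv
  simpa [hx, hΦ.zero, cMat_one] using h3

end Monodromy

end HarmonicControl

namespace HarmonicControl

/-! ### The harmonic Lyapunov equation: existence -/

section LyapunovExistence

open Set Matrix

variable {ι : Type} [Fintype ι] {T : ℝ}

theorem sum_norm_sq_le (x : ι → ℂ) : ∑ i, ‖x i‖ ^ 2 ≤ Fintype.card ι * ‖x‖ ^ 2 := by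
  calc ∑ i, ‖x i‖ ^ 2 ≤ ∑ _i : ι, ‖x‖ ^ 2 :=
        Finset.sum_le_sum fun i _ => by gcongr; exact norm_le_pi_norm x i
    _ = _ := by simp

theorem norm_sq_le_sum (x : ι → ℂ) : ‖x‖ ^ 2 ≤ ∑ i, ‖x i‖ ^ 2 := by
  have h0 : 0 ≤ ∑ i, ‖x i‖ ^ 2 := by positivity
  have h : ‖x‖ ≤ √(∑ i, ‖x i‖ ^ 2) := by
    rw [pi_norm_le_iff_of_nonneg (Real.sqrt_nonneg _)]
    intro i
    refine Real.le_sqrt_of_sq_le ?_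
    exact Finset.single_le_sum (f := fun i => ‖x i‖ ^ 2) (fun i _ => by positivity)
      (Finset.mem_univ i)
  calc ‖x‖ ^ 2 ≤ √(∑ i, ‖x i‖ ^ 2) ^ 2 := by gcongr
    _ = _ := Real.sq_sqrt h0

theorem intervalIntegrable_sum_norm_sq (hT : 0 ≤ T) {x : ℝ → ι → ℂ} {t : ℝ} (hx : VecL2 T t x) :
    IntervalIntegrable (fun τ => ∑ i, ‖x τ i‖ ^ 2) volume (t - T) t := by
  rw [intervalIntegrable_iff_integrableOn_Ioc_of_le (by linarith)]
  exact integrable_finsetSum _ fun i _ => (hx i).integrable_norm_pow (by norm_num)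

theorem intervalIntegrable_dotProduct (hT : 0 ≤ T) {x y : ℝ → ι → ℂ} {t : ℝ} (hx : VecL2 T t x)
    (hy : VecL2 T t y) :
    IntervalIntegrable (fun τ => star (x τ) ⬝ᵥ y τ) volume (t - T) t := by
  rw [intervalIntegrable_iff_integrableOn_Ioc_of_le (by linarith)]
  exact integrable_finsetSum _ fun i _ => MemLp.integrable_mul (hx i).star (hy i)

theorem Ell2.coords_sub (X Y : Ell2 ι) : (X - Y).coords = X.coords - Y.coords := rfl

theorem Ell2.coords_smul (c : ℂ) (X : Ell2 ι) : (c • X).coords = c • X.coords := rfl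

theorem slidingFourier_smul {ι : Type} (c : ℂ) (x : ℝ → ι → ℂ) (t : ℝ) :
    slidingFourier T (fun τ => c • x τ) t = c • slidingFourier T x t := by
  ext k i
  exact phasor_const_mul c (fun τ => x τ i) t k

theorem slidingFourier_mulVec_smul (P : ℝ → Matrix ι ι ℂ) (c : ℂ) (x : ℝ → ι → ℂ) (t : ℝ) :
    slidingFourier T (fun τ => P τ *ᵥ (c • x τ)) t =
      c • slidingFourier T (fun τ => P τ *ᵥ x τ) t := by
  rw [← slidingFourier_smul]
  simp only [Matrix.mulVec_smul]

/-- The multiplication operator by a continuous matrix signal, in the frequency domain. -/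
theorem exists_toeplitz_clm (hT : 0 < T) {P : ℝ → Matrix ι ι ℂ} {t : ℝ}
    (hP : ∀ i j, ContinuousOn (fun τ => P τ i j) (Icc (t - T) t)) :
    ∃ L : Ell2 ι →L[ℂ] Ell2 ι, ∀ (X : Ell2 ι) (x : ℝ → ι → ℂ), VecL2 T t x →
      X.coords = slidingFourier T x t →
        (L X).coords = slidingFourier T (fun τ => P τ *ᵥ x τ) t := by
  -- The signal chosen for `X` need not depend linearly on `X`; linearity of the operator is
  -- recovered because two signals with the same coefficients agree almost everywhere on the window.
  choose sig _ hsig hsig' using fun X : Ell2 ι => exists_signal hT X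
  have hP2 : ∀ X, VecL2 T t fun τ => P τ *ᵥ sig X τ := fun X =>
    VecL2.mulVec_of_continuousOn hP (hsig X t)
  have hmain : ∀ (X : Ell2 ι) (x : ℝ → ι → ℂ), VecL2 T t x →
      X.coords = slidingFourier T x t → (ofSignal hT (hP2 X)).coords =
        slidingFourier T (fun τ => P τ *ᵥ x τ) t := by
    intro X x hx hX
    rw [coords_ofSignal]
    refine slidingFourier_congr_ae hT.le ?_
    filter_upwards [ae_eq_of_slidingFourier_eq hT (hsig X t) hx ((hsig' X t).symm.trans hX)]
      with τ hτ hm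
    rw [hτ hm]
  have hint : ∀ {x : ℝ → ι → ℂ}, VecL2 T t x → ∀ i,
      IntervalIntegrable (fun τ => x τ i) volume (t - T) t := fun hx i =>
    (hx i).intervalIntegrable hT.le
  let L : Ell2 ι →ₗ[ℂ] Ell2 ι :=
    { toFun := fun X => ofSignal hT (hP2 X)
      map_add' := fun X Y => by
        refine Ell2.ext_coords ?_
        have h1 : (X + Y).coords = slidingFourier T (fun τ => sig X τ + sig Y τ) t := by
          rw [slidingFourier_add (hint (hsig X t)) (hint (hsig Y t)), ← hsig' X t, ← hsig' Y t]
          rfl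
        refine (hmain (X + Y) _ (fun i => MemLp.add (hsig X t i) (hsig Y t i)) h1).trans ?_
        refine (congrArg (fun f => slidingFourier T f t)
          (funext fun τ => Matrix.mulVec_add _ _ _)).trans ?_
        exact slidingFourier_add (hint (hP2 X)) (hint (hP2 Y))
      map_smul' := fun c X => by
        refine Ell2.ext_coords ?_
        have h2 : (c • X).coords = slidingFourier T (fun τ => c • sig X τ) t := by
          rw [slidingFourier_smul, ← hsig' X t, Ell2.coords_smul]
        rw [hmain (c • X) (fun τ => c • sig X τ) (fun i => (hsig X t i).const_mul c) h2,
          RingHom.id_apply, Ell2.coords_smul, coords_ofSignal, slidingFourier_mulVec_smul] }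
  have hK : ∃ K : ℝ, 0 ≤ K ∧ ∀ τ ∈ Icc (t - T) t, ∑ i, ∑ j, ‖P τ i j‖ ≤ K := by
    have hc : ContinuousOn (fun τ => ∑ i, ∑ j, ‖P τ i j‖) (Icc (t - T) t) :=
      continuousOn_finsetSum _ fun i _ => continuousOn_finsetSum _ fun j _ => (hP i j).norm
    obtain ⟨K, hK⟩ := isCompact_Icc.exists_bound_of_continuousOn hc
    refine ⟨max K 0, le_max_right _ _, fun τ hτ => ?_⟩
    exact ((le_abs_self _).trans (hK τ hτ)).trans (le_max_left _ _)
  obtain ⟨K, hK0, hK⟩ := hK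
  have hbound : ∀ X, ‖L X‖ ≤ √(Fintype.card ι) * K * ‖X‖ := by
    intro X
    refine (sq_le_sq₀ (norm_nonneg _) (by positivity)).1 ?_
    have h1 : ‖L X‖ ^ 2 = _ := norm_sq_eq_integral hT (hP2 X) (coords_ofSignal hT (hP2 X))
    rw [h1, mul_pow, norm_sq_eq_integral hT (hsig X t) (hsig' X t), mul_left_comm]
    refine mul_le_mul_of_nonneg_left ?_ (by positivity)
    rw [← intervalIntegral.integral_const_mul]
    refine intervalIntegral.integral_mono_on (by linarith)
      (intervalIntegrable_sum_norm_sq hT.le (hP2 X))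
      ((intervalIntegrable_sum_norm_sq hT.le (hsig X t)).const_mul _) fun τ hτ => ?_
    refine (sum_norm_sq_le _).trans ?_
    rw [mul_pow, Real.sq_sqrt (by positivity), mul_assoc]
    refine mul_le_mul_of_nonneg_left ?_ (by positivity)
    have h2 := (norm_mulVec_le (P τ) (sig X τ)).trans
      (mul_le_mul_of_nonneg_right (hK τ hτ) (norm_nonneg _))
    calc ‖P τ *ᵥ sig X τ‖ ^ 2 ≤ (K * ‖sig X τ‖) ^ 2 := by gcongr
      _ = K ^ 2 * ‖sig X τ‖ ^ 2 := mul_pow _ _ _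
      _ ≤ _ := by gcongr; exact norm_sq_le_sum _
  exact ⟨L.mkContinuous _ hbound, hmain⟩

/-- The Hermitian form of a real matrix, on complex vectors. -/
def hermForm (P : Matrix ι ι ℝ) (x : ι → ℂ) : ℝ :=
  (fun i => (x i).re) ⬝ᵥ P *ᵥ (fun i => (x i).re) + (fun i => (x i).im) ⬝ᵥ P *ᵥ fun i => (x i).im

theorem re_star_dotProduct_cMat (P : Matrix ι ι ℝ) (x : ι → ℂ) :
    (star x ⬝ᵥ cMat P *ᵥ x).re = hermForm P x := by
  simp only [hermForm, dotProduct, Matrix.mulVec, cMat, Pi.star_apply, RCLike.star_def,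
    Matrix.map_apply, Complex.re_sum, Complex.mul_re, Complex.conj_re, Complex.conj_im,
    Complex.im_sum, Complex.mul_im, Complex.ofReal_re, Complex.ofReal_im,
    ← Finset.sum_add_distrib]
  refine Finset.sum_congr rfl fun i _ => ?_
  simp

/-- A quantitative positivity bound obtained by adding the coordinate estimates of
`PosDef.sq_le_inv_mul`. The constant is the trace of the inverse, which depends continuously, hence
measurably, on a positive definite matrix. -/
theorem sum_norm_sq_le_hermForm [DecidableEq ι] {P : Matrix ι ι ℝ} (hP : P.PosDef) (x : ι → ℂ) :
    ∑ i, ‖x i‖ ^ 2 ≤ P⁻¹.trace * hermForm P x := by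
  rw [Matrix.trace, Finset.sum_mul]
  refine Finset.sum_le_sum fun i _ => ?_
  have h1 := PosDef.sq_le_inv_mul hP (fun i => (x i).re) i
  have h2 := PosDef.sq_le_inv_mul hP (fun i => (x i).im) i
  rw [← Complex.normSq_eq_norm_sq, Complex.normSq_apply, hermForm, Matrix.diag_apply]
  linarith

theorem hermForm_nonneg {P : Matrix ι ι ℝ} (hP : P.PosSemidef) (x : ι → ℂ) : 0 ≤ hermForm P x := by
  have h1 := hP.dotProduct_mulVec_nonneg fun i => (x i).re
  have h2 := hP.dotProduct_mulVec_nonneg fun i => (x i).im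
  simp only [star_trivial] at h1 h2
  exact add_nonneg h1 h2

theorem hermForm_le (P : Matrix ι ι ℝ) (x : ι → ℂ) :
    hermForm P x ≤ Fintype.card ι * (∑ i, ∑ j, ‖cMat P i j‖) * ‖x‖ ^ 2 := by
  rw [← re_star_dotProduct_cMat]
  refine (Complex.re_le_norm _).trans ((norm_sum_le _ _).trans ?_)
  have h : ∀ i ∈ Finset.univ, ‖star x i * (cMat P *ᵥ x) i‖ ≤
      ‖x‖ * ((∑ i, ∑ j, ‖cMat P i j‖) * ‖x‖) := fun i _ => by
    rw [norm_mul, Pi.star_apply, norm_star]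
    gcongr
    · exact norm_le_pi_norm x i
    · exact (norm_le_pi_norm _ i).trans (norm_mulVec_le _ _)
  refine (Finset.sum_le_sum h).trans_eq ?_
  simp only [Finset.sum_const, Finset.card_univ, nsmul_eq_mul]
  ring

theorem WindowL2.ofReal_of_bounded {f : ℝ → ℝ} (hf : MemLp f ⊤ volume) {g : ℝ → ℂ} {t : ℝ}
    (hg : WindowL2 T t g) : WindowL2 T t fun τ => (f τ : ℂ) * g τ := by
  have h1 : MemLp (fun τ => (f τ : ℂ)) ⊤ (volume.restrict (Ioc (t - T) t)) :=
    (hf.restrict _).ofReal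
  exact hg.mul h1

/-- The solution is multiplication by `P` in the time domain. Symmetry and positivity are pointwise;
the equation is the integral over one period of the derivative of `x^* P y`. -/
theorem exists_lyapunovSolution [DecidableEq ι] (hT : 0 < T) {A P Q : ℝ → Matrix ι ι ℝ}
    (hA : MatL2 T 0 fun τ => cMat (A τ)) (hPper : Function.Periodic P T)
    (hPpos : ∀ t, (P t).PosDef)
    (hP : MatPrimOn univ P fun t => -((A t)ᵀ * P t + P t * A t + Q t))
    (hQ : ∀ i j, MemLp (fun t => Q t i j) ⊤ volume) :
    ∃ L : Ell2 ι →L[ℂ] Ell2 ι,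
      IsLyapunovSolution T (toeplitz T (fun τ => cMat (A τ)) 0)
        (toeplitz T (fun τ => cMat (Q τ)) 0) L ∧
      ∀ (X : Ell2 ι) (x : ℝ → ι → ℂ), VecL2 T 0 x → X.coords = slidingFourier T x 0 →
        (L X).coords = slidingFourier T (fun τ => cMat (P τ) *ᵥ x τ) 0 := by
  have hPt : ∀ t, (P t)ᵀ = P t := fun t => by simpa using (hPpos t).1.eq
  have hPc : ∀ i j, ContinuousOn (fun τ => cMat (P τ) i j) (Icc (0 - T) 0) := fun i j =>
    (hP.cMat i j).continuous.continuousOn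
  obtain ⟨L, hL⟩ := exists_toeplitz_clm hT hPc
  have hP2 : ∀ {x : ℝ → ι → ℂ}, VecL2 T 0 x → VecL2 T 0 fun τ => cMat (P τ) *ᵥ x τ := fun hx =>
    VecL2.mulVec_of_continuousOn hPc hx
  have hQ2 : ∀ {x : ℝ → ι → ℂ}, VecL2 T 0 x → VecL2 T 0 fun τ => cMat (Q τ) *ᵥ x τ :=
    fun hx i => memLp_finsetSum _ fun j _ => WindowL2.ofReal_of_bounded (hQ i j) (hx j)
  refine ⟨L, ⟨?_, ?_, ?_⟩, hL⟩
  · rw [ContinuousLinearMap.isSelfAdjoint_iff_isSymmetric]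
    intro X Y
    obtain ⟨x, -, hx, hX⟩ := exists_signal hT X
    obtain ⟨y, -, hy, hY⟩ := exists_signal hT Y
    change inner ℂ (L X) Y = inner ℂ X (L Y)
    rw [inner_eq_integral hT (hP2 (hx 0)) (hy 0) (hL X x (hx 0) (hX 0)) (hY 0),
      inner_eq_integral hT (hx 0) (hP2 (hy 0)) (hX 0) (hL Y y (hy 0) (hY 0))]
    simp only [star_cMat_mulVec_dotProduct, hPt]
  · intro X hX0
    obtain ⟨x, -, hx, hX⟩ := exists_signal hT X
    rw [inner_eq_integral hT (hx 0) (hP2 (hx 0)) (hX 0) (hL X x (hx 0) (hX 0))]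
    have hi := intervalIntegrable_dotProduct hT.le (hx 0) (hP2 (hx 0))
    have h1 : ((1 / (T : ℂ)) * ∫ τ in (0 - T)..0, star (x τ) ⬝ᵥ cMat (P τ) *ᵥ x τ).re =
        (1 / T) * ∫ τ in (0 - T)..0, hermForm (P τ) (x τ) := by
      have h2 := Complex.reCLM.intervalIntegral_comp_comm hi
      simp only [Complex.reCLM_apply, re_star_dotProduct_cMat] at h2
      rw [h2, ← Complex.ofReal_one, ← Complex.ofReal_div, Complex.re_ofReal_mul]
    rw [h1]
    have hi' : IntervalIntegrable (fun τ => hermForm (P τ) (x τ)) volume (0 - T) 0 := by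
      have h2 : IntervalIntegrable (fun τ => (star (x τ) ⬝ᵥ cMat (P τ) *ᵥ x τ).re) volume
          (0 - T) 0 := ⟨hi.1.re, hi.2.re⟩
      simpa only [re_star_dotProduct_cMat] using h2
    have hnn : ∀ τ, 0 ≤ hermForm (P τ) (x τ) := fun τ => hermForm_nonneg (hPpos τ).posSemidef _
    refine mul_pos (by positivity) (lt_of_le_of_ne
      (intervalIntegral.integral_nonneg (by linarith) fun τ _ => hnn τ) fun h0 => hX0 ?_)
    rw [eq_comm, intervalIntegral.integral_of_le (by linarith), integral_eq_zero_iff_of_nonneg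
      hnn hi'.1] at h0
    refine Ell2.ext_coords ?_
    rw [hX 0, slidingFourier_congr_ae hT.le (y := fun _ _ => 0)]
    · ext k i
      simp [Ell2.coords, slidingFourier, phasor]
    · rw [← ae_restrict_iff' measurableSet_Ioc]
      filter_upwards [h0] with τ hτ
      have h3 := sum_norm_sq_le_hermForm (hPpos τ) (x τ)
      have hτ' : hermForm (P τ) (x τ) = 0 := hτ
      rw [hτ', mul_zero] at h3
      have h4 := (norm_sq_le_sum (x τ)).trans h3
      have : ‖x τ‖ = 0 := by nlinarith [norm_nonneg (x τ)]
      exact norm_eq_zero.1 this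
  · intro X X' Y Y' hXX hYY
    obtain ⟨x₀, -, hx₀, hX₀⟩ := exists_signal hT X
    obtain ⟨x', -, hx', hX'⟩ := exists_signal hT X'
    obtain ⟨y₀, -, hy₀, hY₀⟩ := exists_signal hT Y
    obtain ⟨y', -, hy', hY'⟩ := exists_signal hT Y'
    obtain ⟨x, hxp, hxT, hX⟩ := hXX.exists_primitive hT hA (hx₀ 0) (hx' 0) (hX₀ 0) (hX' 0)
    obtain ⟨y, hyp, hyT, hY⟩ := hYY.exists_primitive hT hA (hy₀ 0) (hy' 0) (hY₀ 0) (hY' 0)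
    have hx := hxp.vecL2
    have hy := hyp.vecL2
    have hQm : MatL2 T 0 fun τ => cMat (Q τ) := fun i j => by
      have := WindowL2.ofReal_of_bounded (T := T) (t := 0) (g := fun _ => 1) (hQ i j)
        (memLp_const 1)
      simp only [mul_one] at this
      exact this
    have hsum : ∑' k : ℤ, ∑ i : ι, star (X k i) *
        (toeplitz T (fun τ => cMat (Q τ)) 0).act Y.coords k i =
        (1 / (T : ℂ)) * ∫ τ in (0 - T)..0, star (x τ) ⬝ᵥ cMat (Q τ) *ᵥ y τ := by
      rw [hY, toeplitz_act hT hQm hy, ← (hasSum_star_slidingFourier hT hx (hQ2 hy)).tsum_eq]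
      refine tsum_congr fun k => Finset.sum_congr rfl fun i _ => ?_
      rw [← hX]; rfl
    rw [hsum, inner_eq_integral hT (hx' 0) (hP2 hy) (hX' 0) (hL Y y hy hY),
      inner_eq_integral hT hx (hP2 (hy' 0)) hX (hL Y' y' (hy' 0) (hY' 0)), ← mul_add, ← mul_add,
      ← intervalIntegral.integral_add (intervalIntegrable_dotProduct hT.le (hx' 0) (hP2 hy))
        (intervalIntegrable_dotProduct hT.le hx (hP2 (hy' 0))),
      ← intervalIntegral.integral_add ((intervalIntegrable_dotProduct hT.le (hx' 0) (hP2 hy)).add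
        (intervalIntegrable_dotProduct hT.le hx (hP2 (hy' 0))))
        (intervalIntegrable_dotProduct hT.le hx (hQ2 hy))]
    have hmem1 : (0 : ℝ) - T ∈ Icc (0 - T) 0 := ⟨le_rfl, by linarith⟩
    have hmem2 : (0 : ℝ) ∈ Icc (0 - T) 0 := ⟨by linarith, le_rfl⟩
    -- By the differential equations of `x`, `y` and `P`, the derivative of `-x^* P y` is exactly
    -- the integrand of the Lyapunov identity; its integral vanishes since all three take equal
    -- values at `-T` and `0`.
    have hD := (hxp.star.dotProduct ((hP.cMat.mono (subset_univ _)).mulVec hyp)).neg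
    have h1 := hD.sub_eq hmem1 hmem2
    have hPT : P (0 - T) = P 0 := hPper.sub_eq 0
    rw [hxT, hyT, hPT, sub_self] at h1
    rw [mul_eq_zero]
    right
    rw [h1]
    refine intervalIntegral.integral_congr fun τ _ => ?_
    simp only [star_sub, sub_dotProduct, star_cMat_mulVec_dotProduct, cMat_neg, cMat_add,
      cMat_mul, Matrix.neg_mulVec, Matrix.add_mulVec, Matrix.mulVec_sub, dotProduct_add,
      dotProduct_sub, dotProduct_neg, Matrix.mulVec_mulVec]
    ring

end LyapunovExistence

end HarmonicControl

namespace HarmonicControl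

/-! ### The harmonic Lyapunov equation: uniqueness -/

section LyapunovUniqueness

open Set Matrix
open scoped ContDiff

variable {ι : Type} [Fintype ι] {T : ℝ}

theorem Ell2.norm_le_of_signal (hT : 0 < T) {x : ℝ → ι → ℂ} {t : ℝ} (hx : VecL2 T t x) {X : Ell2 ι}
    (hX : X.coords = slidingFourier T x t) {B : ℝ} (hB0 : 0 ≤ B)
    (hB : ∀ τ ∈ Icc (t - T) t, ‖x τ‖ ≤ B) : ‖X‖ ≤ √(Fintype.card ι) * B := by
  refine (sq_le_sq₀ (norm_nonneg _) (by positivity)).1 ?_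
  rw [norm_sq_eq_integral hT hx hX, mul_pow, Real.sq_sqrt (by positivity)]
  have h : ∫ τ in (t - T)..t, ∑ i, ‖x τ i‖ ^ 2 ≤ ∫ _τ in (t - T)..t, Fintype.card ι * B ^ 2 := by
    refine intervalIntegral.integral_mono_on (by linarith)
      (intervalIntegrable_sum_norm_sq hT.le hx) intervalIntegrable_const fun τ hτ => ?_
    refine (sum_norm_sq_le _).trans ?_
    have := hB τ hτ
    gcongr
  rw [intervalIntegral.integral_const, sub_sub_cancel, smul_eq_mul] at h
  calc 1 / T * ∫ τ in (t - T)..t, ∑ i, ‖x τ i‖ ^ 2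
      ≤ 1 / T * (T * (Fintype.card ι * B ^ 2)) := by gcongr
    _ = _ := by field_simp

theorem phasor_eq_of_support_subset {f : ℝ → ℂ} {t s : ℝ}
    (ht : Function.support f ⊆ Ioc (t - T) t) (hs : Function.support f ⊆ Ioc (s - T) s) (k : ℤ) :
    phasor T f t k = phasor T f s k := by
  have h : Function.support (fun τ => f τ * expo T k τ) ⊆ Function.support f :=
    Function.support_mul_subset_left _ _
  rw [phasor_def, phasor_def, intervalIntegral.integral_eq_integral_of_support_subset (h.trans ht),
    intervalIntegral.integral_eq_integral_of_support_subset (h.trans hs)]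

/-- The translate by `τ` of the window function `φ`, times a solution of the linear system. -/
noncomputable def windowedSolution (Φ : ℝ → Matrix ι ι ℝ) (φ : ℝ → ℝ) (v : ι → ℂ) (τ : ℝ) :
    ℝ → ι → ℂ :=
  fun t => (φ (t - τ) : ℂ) • (cMat (Φ t) *ᵥ v)

/-- A windowed solution is not periodic, but its phasors do not change while the window contains its
support. This lets two nearby translates be compared on one window. -/
theorem slidingFourier_windowedSolution_eq {Φ : ℝ → Matrix ι ι ℝ} {φ : ℝ → ℝ} {a b : ℝ}
    (h0 : ∀ u, φ u ≠ 0 → u ∈ Icc a b) (v : ι → ℂ) {τ t s : ℝ} (ht : t - T < τ + a ∧ τ + b ≤ t) (hs : s - T < τ + a ∧ τ + b ≤ s) :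
    slidingFourier T (windowedSolution Φ φ v τ) t =
      slidingFourier T (windowedSolution Φ φ v τ) s := by
  have h : ∀ i, ∀ r, windowedSolution Φ φ v τ r i ≠ 0 → τ + a ≤ r ∧ r ≤ τ + b := by
    intro i r hr
    have h1 : φ (r - τ) ≠ 0 := fun h => hr (by simp [windowedSolution, h])
    have := h0 _ h1
    constructor <;> linarith [this.1, this.2]
  ext k i
  refine phasor_eq_of_support_subset (fun r hr => ?_) (fun r hr => ?_) k <;>
  · have := h i r hr
    constructor <;> linarith

variable [DecidableEq ι] {A Φ Ψ : ℝ → Matrix ι ι ℝ} {φ : ℝ → ℝ}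

theorem IsFundamental.continuous_mulVec (hΦ : IsFundamental A Φ Ψ) (v : ι → ℂ) :
    Continuous fun t => cMat (Φ t) *ᵥ v :=
  continuous_pi fun i => continuous_finsetSum _ fun j _ =>
    ((hΦ.prim_cMat i j).continuous).mul continuous_const

theorem continuous_windowedSolution (hΦ : IsFundamental A Φ Ψ) (hφ : Continuous φ) (v : ι → ℂ)
    (τ : ℝ) : Continuous (windowedSolution Φ φ v τ) :=
  (Complex.continuous_ofReal.comp (hφ.comp (continuous_id.sub continuous_const))).smul
    (hΦ.continuous_mulVec v)

theorem vecL2_windowedSolution (hΦ : IsFundamental A Φ Ψ) (hφ : Continuous φ) (v : ι → ℂ)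
    (τ t : ℝ) : VecL2 T t (windowedSolution Φ φ v τ) := fun i =>
  WindowL2.of_continuousOn
    ((continuous_apply i).comp (continuous_windowedSolution hΦ hφ v τ)).continuousOn

/-- The cutoff vanishes at both ends of the window, so the signal is in the domain. Differentiating
in `t` gives `A x` plus the cutoff term `φ'`, so `(𝒜 - N)` replaces `φ` by `-φ'`, which is the
derivative in the shift `τ`. -/
theorem harmGraph_windowedSolution (hT : 0 < T) (hΦ : IsFundamental A Φ Ψ)
    (hAper : Function.Periodic A T) (hA : ∀ t, MatL2 T t fun τ => cMat (A τ))
    (hφ : ContDiff ℝ 1 φ) (h0 : φ 0 = 0) (h1 : φ T = 0) (v : ι → ℂ) (τ : ℝ) {X Y : Ell2 ι}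
    (hX : X.coords = slidingFourier T (windowedSolution Φ φ v τ) (τ + T))
    (hY : Y.coords = slidingFourier T (windowedSolution Φ (fun u => -deriv φ u) v τ) (τ + T)) :
    HarmGraph T (toeplitz T (fun τ => cMat (A τ)) 0) X Y := by
  have hper : Function.Periodic (fun τ => cMat (A τ)) T := fun t => by
    change cMat (A (t + T)) = _
    rw [hAper]
  rw [toeplitz_eq_of_periodic hT.ne' hper 0 (τ + T)]
  have hφ' : Continuous (deriv φ) := hφ.continuous_deriv le_rfl
  refine harmGraph_of_primitive hT (hA _) (y := windowedSolution Φ (fun u => -deriv φ u) v τ) ?_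
    (vecL2_windowedSolution hΦ hφ'.neg v τ _) ?_ hX hY
  · intro i
    refine IsPrimitiveOn.mono (s := univ) ?_ (subset_univ _)
    have hp : IsPrimitiveOn univ (fun t => (φ (t - τ) : ℂ))
        fun t => ((deriv φ (t - τ) : ℝ) : ℂ) := by
      refine ofReal_primitive (IsPrimitiveOn.of_hasDerivAt (fun t => ?_)
        (hφ'.comp (continuous_id.sub continuous_const)))
      exact ((hφ.differentiable one_ne_zero (t - τ)).hasDerivAt).comp_sub_const t τ
    have hv : VecPrimOn univ (fun t => cMat (Φ t) *ᵥ v) fun t =>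
        (cMat (A t) * cMat (Φ t)) *ᵥ v + cMat (Φ t) *ᵥ 0 :=
      hΦ.prim_cMat.mulVec (x := fun _ => v) (x' := fun _ => 0) fun i => IsPrimitiveOn.const _
    refine (hp.mul (hv i)).congr_deriv fun t _ => ?_
    simp only [windowedSolution, Matrix.mulVec_zero, add_zero, Pi.smul_apply, Pi.sub_apply,
      Matrix.mulVec_smul, Matrix.mulVec_mulVec, smul_eq_mul]
    push_cast
    ring
  · simp [windowedSolution, h0, h1]

theorem norm_sub_add_mul_deriv_le (hφ : ContDiff ℝ 1 φ) {K : NNReal}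
    (hK : LipschitzWith K (deriv φ)) (u h : ℝ) :
    ‖φ (u - h) - φ u + h * deriv φ u‖ ≤ K * h ^ 2 := by
  have hd : ∀ s, HasDerivAt (fun s => φ (u - s) + s * deriv φ u)
      (-deriv φ (u - s) + deriv φ u) s := fun s => by
    have h1 := ((hφ.differentiable one_ne_zero (u - s)).hasDerivAt).comp_const_sub u s
    have h2 := (hasDerivAt_id s).mul_const (deriv φ u)
    rw [one_mul] at h2
    exact h1.add h2
  have h3 := (convex_uIcc 0 h).norm_image_sub_le_of_norm_hasDerivWithin_le
    (C := K * |h|) (fun s _ => (hd s).hasDerivWithinAt) (fun s hs => ?_)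
    left_mem_uIcc right_mem_uIcc
  · simp only [sub_zero, zero_mul, add_zero] at h3
    calc ‖φ (u - h) - φ u + h * deriv φ u‖ = ‖φ (u - h) + h * deriv φ u - φ u‖ := by ring_nf
      _ ≤ K * |h| * ‖h‖ := h3
      _ = _ := by rw [Real.norm_eq_abs, mul_assoc, ← sq, sq_abs]
  · have h4 := hK.norm_sub_le u (u - s)
    rw [neg_add_eq_sub]
    refine h4.trans ?_
    rw [sub_sub_cancel]
    gcongr
    have := abs_sub_left_of_mem_uIcc hs
    simpa using this

theorem exists_bound_mulVec (hΦ : IsFundamental A Φ Ψ) (a b : ℝ) :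
    ∃ C : ℝ, 0 ≤ C ∧ ∀ t ∈ Icc a b, ∀ v : ι → ℂ, ‖cMat (Φ t) *ᵥ v‖ ≤ C * ‖v‖ := by
  have hc : Continuous fun t => ∑ i, ∑ j, ‖cMat (Φ t) i j‖ :=
    continuous_finsetSum _ fun i _ => continuous_finsetSum _ fun j _ =>
      (hΦ.prim_cMat i j).continuous.norm
  obtain ⟨K, hK⟩ := (isCompact_Icc (a := a) (b := b)).exists_bound_of_continuousOn hc.continuousOn
  refine ⟨max K 0, le_max_right _ _, fun t ht v => (norm_mulVec_le _ _).trans ?_⟩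
  gcongr
  exact ((le_abs_self _).trans (hK t ht)).trans (le_max_left _ _)

/-- The difference quotient in `τ` acts on the cutoff alone and converges uniformly on the window,
hence in `ℓ²`. Together with `harmGraph_windowedSolution`, `X` is an orbit of the generator,
obtained without semigroup theory. -/
theorem hasDerivAt_windowedSolution (hT : 0 < T) (hΦ : IsFundamental A Φ Ψ)
    (hφ : ContDiff ℝ 1 φ) {K : NNReal} (hK : LipschitzWith K (deriv φ)) {a b : ℝ} (ha : 0 < a)
    (hb : b < T) (h0 : ∀ u, φ u ≠ 0 → u ∈ Icc a b) (v : ι → ℂ) {X Y : ℝ → Ell2 ι}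
    (hX : ∀ τ, (X τ).coords = slidingFourier T (windowedSolution Φ φ v τ) (τ + T))
    (hY : ∀ τ, (Y τ).coords =
      slidingFourier T (windowedSolution Φ (fun u => -deriv φ u) v τ) (τ + T)) (τ : ℝ) :
    HasDerivAt X (Y τ) τ := by
  obtain ⟨C, hC0, hC⟩ := exists_bound_mulVec hΦ τ (τ + T)
  have hφ' : Continuous (deriv φ) := hφ.continuous_deriv le_rfl
  -- For such `h` the supports of both translates lie inside the windows ending at `τ + T` and at `τ
  -- + h + T`, so the window can be frozen.
  have hkey : ∀ h, |h| < min a (T - b) →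
      ‖X (τ + h) - X τ - h • Y τ‖ ≤ √(Fintype.card ι) * (K * h ^ 2 * (C * ‖v‖)) := by
    intro h hh
    have hh1 := abs_lt.1 (hh.trans_le (min_le_left _ _))
    have hh2 := abs_lt.1 (hh.trans_le (min_le_right _ _))
    have hx1 := vecL2_windowedSolution (T := T) hΦ hφ.continuous v (τ + h) (τ + T)
    have hx2 := vecL2_windowedSolution (T := T) hΦ hφ.continuous v τ (τ + T)
    have hx3 := vecL2_windowedSolution (T := T) hΦ hφ'.neg v τ (τ + T)
    have hx4 : VecL2 T (τ + T) fun t => (h : ℂ) • windowedSolution Φ (fun u => -deriv φ u) v τ t :=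
      fun i => (hx3 i).const_mul (h : ℂ)
    have hint : ∀ {x : ℝ → ι → ℂ}, VecL2 T (τ + T) x → ∀ i,
        IntervalIntegrable (fun s => x s i) volume (τ + T - T) (τ + T) := fun hx i =>
      (hx i).intervalIntegrable hT.le
    have hx5 : VecL2 T (τ + T) fun t => windowedSolution Φ φ v (τ + h) t -
        windowedSolution Φ φ v τ t := fun i => (hx1 i).sub (hx2 i)
    refine Ell2.norm_le_of_signal hT (t := τ + T) (x := fun t => windowedSolution Φ φ v (τ + h) t -
        windowedSolution Φ φ v τ t - (h : ℂ) • windowedSolution Φ (fun u => -deriv φ u) v τ t)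
      (fun i => (hx5 i).sub (hx4 i)) ?_ (by positivity) fun t ht => ?_
    · have hs : h • Y τ = (h : ℂ) • Y τ := (Complex.coe_smul h (Y τ)).symm
      rw [slidingFourier_sub (hint hx5) (hint hx4), slidingFourier_sub (hint hx1) (hint hx2),
        slidingFourier_smul, hs, Ell2.coords_sub, Ell2.coords_sub, Ell2.coords_smul, hX, hX, hY,
        slidingFourier_windowedSolution_eq h0 v (t := τ + h + T) (s := τ + T)]
      · constructor <;> linarith
      · constructor <;> linarith
    · have h1 : windowedSolution Φ φ v (τ + h) t - windowedSolution Φ φ v τ t -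
          (h : ℂ) • windowedSolution Φ (fun u => -deriv φ u) v τ t =
          ((φ (t - τ - h) - φ (t - τ) + h * deriv φ (t - τ) : ℝ) : ℂ) • (cMat (Φ t) *ᵥ v) := by
        simp only [windowedSolution, smul_smul, ← sub_smul, sub_add_eq_sub_sub]
        congr 1
        push_cast
        ring
      rw [h1, norm_smul, Complex.norm_real]
      have h2 := hC t ⟨by linarith [ht.1], ht.2⟩ v
      gcongr
      exact norm_sub_add_mul_deriv_le hφ hK _ _
  rw [hasDerivAt_iff_isLittleO_nhds_zero]
  have hO : (fun h => X (τ + h) - X τ - h • Y τ) =O[𝓝 0] fun h : ℝ => h ^ 2 := by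
    refine Asymptotics.IsBigO.of_bound (√(Fintype.card ι) * (K * (C * ‖v‖))) ?_
    have hpos : 0 < min a (T - b) := lt_min ha (by linarith)
    filter_upwards [Metric.ball_mem_nhds (0 : ℝ) hpos] with h hh
    rw [Metric.mem_ball, dist_zero_right, Real.norm_eq_abs] at hh
    refine (hkey h hh).trans_eq ?_
    rw [Real.norm_of_nonneg (sq_nonneg h)]
    ring
  refine hO.trans_isLittleO ?_
  simpa using Asymptotics.isLittleO_pow_id (𝕜 := ℝ) (n := 2) (by norm_num)

/-- After `j` periods the signal is the original one with `v` replaced by `Φ T ^ j v`, up to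
translation in time. -/
theorem tendsto_windowedSolution (hT : 0 < T) (hΦ : IsFundamental A Φ Ψ)
    (hAper : Function.Periodic A T) (hM : Tendsto (fun k : ℕ => Φ T ^ k) atTop (𝓝 0))
    (hφ : Continuous φ) (v : ι → ℂ) {X : ℝ → Ell2 ι}
    (hX : ∀ τ, (X τ).coords = slidingFourier T (windowedSolution Φ φ v τ) (τ + T)) :
    Tendsto (fun j : ℕ => X (j * T)) atTop (𝓝 0) := by
  obtain ⟨C, hC0, hC⟩ := exists_bound_mulVec hΦ 0 T
  obtain ⟨K, hK⟩ := (isCompact_Icc (a := 0) (b := T)).exists_bound_of_continuousOn hφ.continuousOn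
  have hK0 : 0 ≤ K := (norm_nonneg _).trans (hK 0 ⟨le_rfl, hT.le⟩)
  have hbound : ∀ j : ℕ, ‖X (j * T)‖ ≤
      √(Fintype.card ι) * (K * (C * ‖cMat (Φ T ^ j) *ᵥ v‖)) := fun j => by
    refine Ell2.norm_le_of_signal hT (vecL2_windowedSolution hΦ hφ v _ _) (hX _)
      (by positivity) fun t ht => ?_
    have ht' : t - j * T ∈ Icc 0 T := ⟨by linarith [ht.1], by linarith [ht.2]⟩
    have h1 := hΦ.add_nat_period hAper (t - j * T) j
    rw [sub_add_cancel] at h1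
    rw [windowedSolution, norm_smul, Complex.norm_real, h1, cMat_mul, ← Matrix.mulVec_mulVec]
    have h2 := hC _ ht' (cMat (Φ T ^ j) *ᵥ v)
    have h3 := hK _ ht'
    gcongr
  have hv : Tendsto (fun j : ℕ => cMat (Φ T ^ j) *ᵥ v) atTop (𝓝 0) := by
    refine tendsto_pi_nhds.2 fun i => ?_
    have h1 : ∀ l, Tendsto (fun j : ℕ => cMat (Φ T ^ j) i l * v l) atTop (𝓝 (0 * v l)) :=
        fun l => by
      refine Tendsto.mul_const _ ?_
      have h2 := tendsto_pi_nhds.1 (tendsto_pi_nhds.1 hM i) l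
      have h3 := (Complex.continuous_ofReal.tendsto 0).comp h2
      simpa [cMat, Function.comp_def] using h3
    have h2 := tendsto_finsetSum Finset.univ fun l _ => h1 l
    simpa [Matrix.mulVec, dotProduct] using h2
  refine squeeze_zero_norm hbound ?_
  simpa using ((hv.norm.const_mul C).const_mul K).const_mul √(Fintype.card ι)

/-- Totality of the windowed solutions: arbitrary cutoffs `φ` force `(Φ v)^* z = 0` almost
everywhere, and letting `v` run through a basis gives `z = 0` because `Φ` is invertible. -/
theorem eq_zero_of_inner_windowedSolution (hT : 0 < T) (hΦ : IsFundamental A Φ Ψ) {Z : Ell2 ι}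
    (hZ : ∀ (φ : ℝ → ℝ) (v : ι → ℂ) (X : Ell2 ι), ContDiff ℝ ∞ φ → HasCompactSupport φ →
      tsupport φ ⊆ Ioo 0 T → X.coords = slidingFourier T (windowedSolution Φ φ v 0) T →
        inner ℂ X Z = 0) : Z = 0 := by
  obtain ⟨z, -, hz, hZz⟩ := exists_signal hT Z
  have hzi : ∀ i, IntervalIntegrable (fun t => z t i) volume 0 T := fun i => by
    simpa using (hz T i).intervalIntegrable hT.le
  have hmain : ∀ v : ι → ℂ, ∀ᵐ t, t ∈ Ioo 0 T → star (cMat (Φ t) *ᵥ v) ⬝ᵥ z t = 0 := by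
    intro v
    have hdi : IntervalIntegrable (fun t => star (cMat (Φ t) *ᵥ v) ⬝ᵥ z t) volume 0 T := by
      have hx : VecL2 T T fun t => cMat (Φ t) *ᵥ v := fun i => WindowL2.of_continuousOn
        ((continuous_apply i).comp (hΦ.continuous_mulVec v)).continuousOn
      simpa using intervalIntegrable_dotProduct hT.le hx (hz T)
    refine isOpen_Ioo.ae_eq_zero_of_integral_contDiff_smul_eq_zero ?_ fun φ hφ hφc hφs => ?_
    · refine (IntegrableOn.mono_set ?_ Ioo_subset_Ioc_self).locallyIntegrableOn
      exact (intervalIntegrable_iff_integrableOn_Ioc_of_le hT.le).1 hdi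
    · have h2 := vecL2_windowedSolution (T := T) hΦ hφ.continuous v 0 T
      have h1 := hZ φ v (ofSignal hT h2) hφ hφc hφs (coords_ofSignal hT h2)
      rw [inner_eq_integral hT h2 (hz T) (coords_ofSignal hT h2) (hZz T), mul_eq_zero,
        sub_self] at h1
      have h3 := h1.resolve_left (by simp [hT.ne'])
      rw [intervalIntegral.integral_eq_integral_of_support_subset] at h3
      · rw [← h3]
        refine integral_congr_ae (ae_of_all _ fun t => ?_)
        simp [windowedSolution]
      · intro t ht
        have h4 : φ t ≠ 0 := fun h => ht (by simp [windowedSolution, h])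
        exact Ioo_subset_Ioc_self (hφs (subset_tsupport _ h4))
  have hz0 : ∀ᵐ t, t ∈ Ioo 0 T → z t = 0 := by
    filter_upwards [ae_all_iff.2 fun i : ι => hmain (Pi.single i 1)] with t ht hm
    have h1 : cMat (Φ t)ᵀ *ᵥ z t = 0 := by
      funext i
      have := ht i hm
      rw [star_cMat_mulVec_dotProduct] at this
      simpa [Pi.star_single] using this
    have h2 : cMat (Ψ t)ᵀ *ᵥ (cMat (Φ t)ᵀ *ᵥ z t) = z t := by
      rw [Matrix.mulVec_mulVec, ← cMat_mul, ← Matrix.transpose_mul, hΦ.mul_inv,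
        Matrix.transpose_one, cMat_one, Matrix.one_mulVec]
    rw [← h2, h1, Matrix.mulVec_zero]
  refine Ell2.ext_coords ?_
  rw [hZz T, slidingFourier_congr_ae hT.le (y := fun _ _ => 0)]
  · ext k i
    simp [Ell2.coords, slidingFourier, phasor]
  · have h3 : ∀ᵐ t : ℝ, t ≠ T := by simp [ae_iff]
    filter_upwards [hz0, h3] with t ht htT hm
    rw [sub_self] at hm
    exact ht ⟨hm.1, lt_of_le_of_ne hm.2 htT⟩

/-- The homogeneous Lyapunov equation has only the trivial Hermitian solution. -/
theorem eq_zero_of_homogeneous_lyapunov (hT : 0 < T) (hΦ : IsFundamental A Φ Ψ)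
    (hAper : Function.Periodic A T) (hA : ∀ t, MatL2 T t fun τ => cMat (A τ))
    (hM : Tendsto (fun k : ℕ => Φ T ^ k) atTop (𝓝 0)) {D : Ell2 ι →L[ℂ] Ell2 ι}
    (hD : IsSelfAdjoint D)
    (hDeq : ∀ X X' Y Y', HarmGraph T (toeplitz T (fun τ => cMat (A τ)) 0) X X' →
      HarmGraph T (toeplitz T (fun τ => cMat (A τ)) 0) Y Y' →
        inner ℂ X' (D Y) + inner ℂ X (D Y') = 0) : D = 0 := by
  have htest : ∀ (φ : ℝ → ℝ) (v : ι → ℂ) (X : Ell2 ι), ContDiff ℝ ∞ φ → HasCompactSupport φ →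
      tsupport φ ⊆ Ioo 0 T → X.coords = slidingFourier T (windowedSolution Φ φ v 0) T →
      ∃ Xt Xt' : ℝ → Ell2 ι, Xt 0 = X ∧
        (∀ τ, HarmGraph T (toeplitz T (fun τ => cMat (A τ)) 0) (Xt τ) (Xt' τ)) ∧
        (∀ τ, HasDerivAt Xt (Xt' τ) τ) ∧ Tendsto (fun j : ℕ => Xt (j * T)) atTop (𝓝 0) := by
    intro φ v X hφ hφc hφs hX
    have hφ1 : ContDiff ℝ 1 φ := hφ.of_le (mod_cast le_top)
    have hφ' : ContDiff ℝ 1 (deriv φ) :=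
      (contDiff_infty_iff_deriv.1 hφ).2.of_le (mod_cast le_top)
    obtain ⟨K, hK⟩ := hφ'.lipschitzWith_of_hasCompactSupport hφc.deriv one_ne_zero
    have hend : ∀ u, u ∉ Ioo 0 T → φ u = 0 := fun u hu =>
      image_eq_zero_of_notMem_tsupport fun h => hu (hφs h)
    have hab : ∃ a b : ℝ, 0 < a ∧ b < T ∧ ∀ u, φ u ≠ 0 → u ∈ Icc a b := by
      by_cases hne : (tsupport φ).Nonempty
      · obtain ⟨a, ha, ha'⟩ := hφc.isCompact.exists_isLeast hne
        obtain ⟨b, hb, hb'⟩ := hφc.isCompact.exists_isGreatest hne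
        exact ⟨a, b, (hφs ha).1, (hφs hb).2, fun u hu =>
          ⟨ha' (subset_tsupport _ hu), hb' (subset_tsupport _ hu)⟩⟩
      -- For `φ = 0` there is nothing to enclose, and the empty interval `[1, 0]` serves.
      · refine ⟨1, 0, one_pos, hT, fun u hu => absurd ⟨u, subset_tsupport _ hu⟩ hne⟩
    obtain ⟨a, b, ha, hb, hab⟩ := hab
    have h1 := fun τ => vecL2_windowedSolution (T := T) hΦ hφ.continuous v τ (τ + T)
    have h2 := fun τ => vecL2_windowedSolution (T := T) hΦ hφ'.continuous.neg v τ (τ + T)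
    refine ⟨fun τ => ofSignal hT (h1 τ), fun τ => ofSignal hT (h2 τ), ?_, fun τ => ?_, fun τ => ?_,
      ?_⟩
    · refine Ell2.ext_coords ?_
      rw [coords_ofSignal, hX, zero_add]
    · exact harmGraph_windowedSolution hT hΦ hAper hA hφ1 (hend _ (by simp)) (hend _ (by simp)) v τ
        (coords_ofSignal hT (h1 τ)) (coords_ofSignal hT (h2 τ))
    · exact hasDerivAt_windowedSolution hT hΦ hφ1 hK ha hb hab v
        (fun τ => coords_ofSignal hT (h1 τ)) (fun τ => coords_ofSignal hT (h2 τ)) τ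
    · exact tendsto_windowedSolution hT hΦ hAper hM hφ.continuous v
        fun τ => coords_ofSignal hT (h1 τ)
  have hzero : ∀ (φ : ℝ → ℝ) (v : ι → ℂ) (Y : Ell2 ι), ContDiff ℝ ∞ φ → HasCompactSupport φ →
      tsupport φ ⊆ Ioo 0 T → Y.coords = slidingFourier T (windowedSolution Φ φ v 0) T →
      D Y = 0 := by
    intro ψ u Y hψ hψc hψs hY
    refine eq_zero_of_inner_windowedSolution hT hΦ fun φ v X hφ hφc hφs hX => ?_
    obtain ⟨Xt, Xt', hX0, hXg, hXd, hXl⟩ := htest φ v X hφ hφc hφs hX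
    obtain ⟨Yt, Yt', hY0, hYg, hYd, hYl⟩ := htest ψ u Y hψ hψc hψs hY
    -- The homogeneous equation says that the sesquilinear form of `D` is invariant along pairs of
    -- orbits; decay along `τ = jT` then makes it zero.
    have hF : ∀ τ, HasDerivAt (fun τ => inner ℂ (Xt τ) (D (Yt τ))) 0 τ := fun τ => by
      have h1 := (hXd τ).inner ℂ ((D.restrictScalars ℝ).hasFDerivAt.comp_hasDerivAt τ (hYd τ))
      have h2 := hDeq _ _ _ _ (hXg τ) (hYg τ)
      rw [add_comm] at h2
      exact h1.congr_deriv h2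
    have hconst : ∀ τ, inner ℂ (Xt τ) (D (Yt τ)) = inner ℂ X (D Y) := fun τ => by
      rw [← hX0, ← hY0]
      exact is_const_of_deriv_eq_zero (f := fun τ => inner ℂ (Xt τ) (D (Yt τ)))
        (fun τ => (hF τ).differentiableAt) (fun τ => (hF τ).deriv) τ 0
    have hlim := hXl.inner (𝕜 := ℂ) ((D.continuous.tendsto 0).comp hYl)
    simp only [map_zero, inner_zero_left, Function.comp_apply, hconst] at hlim
    exact tendsto_nhds_unique tendsto_const_nhds hlim
  -- `D` vanishes on the total set of windowed solutions; self-adjointness extends this to every `Z`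
  -- by moving `D` to the test element.
  ext1 Z
  refine eq_zero_of_inner_windowedSolution hT hΦ fun φ v X hφ hφc hφs hX => ?_
  have h1 := (ContinuousLinearMap.isSelfAdjoint_iff_isSymmetric.1 hD) X Z
  change inner ℂ (D X) Z = inner ℂ X (D Z) at h1
  rw [← h1, hzero φ v X hφ hφc hφs hX, inner_zero_left]

theorem IsLyapunovSolution.unique (hT : 0 < T) (hΦ : IsFundamental A Φ Ψ)
    (hAper : Function.Periodic A T) (hA : ∀ t, MatL2 T t fun τ => cMat (A τ))
    (hM : Tendsto (fun k : ℕ => Φ T ^ k) atTop (𝓝 0)) {Q : BlockMatrix ι ι}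
    {L₁ L₂ : Ell2 ι →L[ℂ] Ell2 ι}
    (h₁ : IsLyapunovSolution T (toeplitz T (fun τ => cMat (A τ)) 0) Q L₁)
    (h₂ : IsLyapunovSolution T (toeplitz T (fun τ => cMat (A τ)) 0) Q L₂) : L₁ = L₂ := by
  refine sub_eq_zero.1 (eq_zero_of_homogeneous_lyapunov hT hΦ hAper hA hM
    (h₁.hermitian.sub h₂.hermitian) fun X X' Y Y' hX hY => ?_)
  have e1 := h₁.equation X X' Y Y' hX hY
  have e2 := h₂.equation X X' Y Y' hX hY
  simp only [_root_.sub_apply, inner_sub_right]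
  linear_combination e1 - e2

end LyapunovUniqueness

end HarmonicControl

namespace HarmonicControl

/-! ### The periodic equilibrium trajectory -/

section Equilibrium

open Set Matrix

variable {T : ℝ}

theorem memLp_two_of_periodic {E : Type*} [NormedAddCommGroup E] (hT : 0 < T) {f : ℝ → E}
    (hf : Function.Periodic f T) (h : MemLp f 2 (volume.restrict (Icc 0 T))) (a b : ℝ) :
    MemLp f 2 (volume.restrict (Icc a b)) := by
  rcases lt_or_ge b a with hab | hab
  · rw [Icc_eq_empty (not_le.2 hab), Measure.restrict_empty]
    simp
  have hi : IntervalIntegrable f volume 0 (0 + T) := by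
    rw [zero_add, intervalIntegrable_iff_integrableOn_Icc_of_le hT.le]
    exact h.integrable (by norm_num)
  have hi2 : IntervalIntegrable (fun t => ‖f t‖ ^ 2) volume 0 (0 + T) := by
    rw [zero_add, intervalIntegrable_iff_integrableOn_Icc_of_le hT.le]
    exact h.integrable_norm_pow (by norm_num)
  have hf2 : Function.Periodic (fun t => ‖f t‖ ^ 2) T := fun t => by simp only [hf t]
  have h1 := (intervalIntegrable_iff_integrableOn_Icc_of_le hab).1
    (hf.intervalIntegrable hT.ne' hi a b)
  have h2 := (intervalIntegrable_iff_integrableOn_Icc_of_le hab).1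
    (hf2.intervalIntegrable hT.ne' hi2 a b)
  exact (memLp_two_iff_integrable_sq_norm h1.1).2 h2

variable {ι : Type} [Fintype ι]

theorem intervalIntegrable_mulVec_of_continuous {B : ℝ → Matrix ι ι ℝ} {b : ℝ → ι → ℝ}
    (hB : ∀ i j, Continuous fun t => B t i j) {u v : ℝ}
    (hb : ∀ i, IntervalIntegrable (fun t => b t i) volume u v) (i : ι) :
    IntervalIntegrable (fun t => (B t *ᵥ b t) i) volume u v := by
  have := IntervalIntegrable.sum (μ := volume) (a := u) (b := v) Finset.univ
    (f := fun j t => B t i j * b t j) fun j _ => (hb j).continuousOn_mul (hB i j).continuousOn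
  simp only [Finset.sum_fn] at this
  exact this

/-- The difference between `X` and the decomposition of the periodic solution lies in the kernel of
`𝒜 - N`, which is trivial since `0` is in the resolvent set. -/
theorem eq_of_harmonic_equilibrium (hT : 0 < T) {A : ℝ → Matrix ι ι ℂ} (hA : MatL2 T 0 A)
    {b : ℝ → ι → ℂ} (hb : ∀ i, IntervalIntegrable (fun t => b t i) volume (0 - T) 0)
    {x : ℝ → ι → ℂ} (hx : VecPrimOn (Icc (0 - T) 0) x fun t => A t *ᵥ x t + b t)
    (hxT : x 0 = x (0 - T)) (h0 : InResolventSet T (toeplitz T A 0) 0) {X : Ell2 ι}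
    (hX : ∀ k i, (toeplitz T A 0).act X.coords k i -
      Complex.I * ((2 * Real.pi / T : ℝ) : ℂ) * (k : ℂ) * X k i + slidingFourier T b 0 k i = 0) :
    X.coords = slidingFourier T x 0 := by
  obtain ⟨x₀, -, hx₀, hX₀⟩ := exists_signal hT X
  have hxL := hx.vecL2
  have hint : ∀ {y : ℝ → ι → ℂ}, VecL2 T 0 y → ∀ i,
      IntervalIntegrable (fun s => y s i) volume (0 - T) 0 := fun hy i =>
    (hy i).intervalIntegrable hT.le
  have hdL : VecL2 T 0 fun t => x₀ t - x t := fun i => (hx₀ 0 i).sub (hxL i)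
  have hd : (X - ofSignal hT hxL).coords = slidingFourier T (fun t => x₀ t - x t) 0 := by
    rw [slidingFourier_sub (hint (hx₀ 0)) (hint hxL), Ell2.coords_sub, coords_ofSignal, ← hX₀ 0]
  have hzero : X - ofSignal hT hxL = 0 := by
    refine h0.1 _ 0 (fun k i => ?_) (by simp)
    have e1 := hX k i
    have e2 := phasor_deriv hT (hx i) k
    simp only [Pi.add_apply] at e2
    rw [phasor_add (intervalIntegrable_mulVec hT.le hA hxL i) (hb i), hxT, sub_self, zero_mul,
      mul_zero, zero_add] at e2
    have e3 : (X - ofSignal hT hxL) k i = X k i - phasor T (fun t => x t i) 0 k := rfl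
    rw [hX₀ 0, toeplitz_act hT hA (hx₀ 0)] at e1
    have e4 : slidingFourier T (fun t => A t *ᵥ (x₀ t - x t)) 0 k i =
        slidingFourier T (fun t => A t *ᵥ x₀ t) 0 k i -
          phasor T (fun t => (A t *ᵥ x t) i) 0 k := by
      simp only [Matrix.mulVec_sub]
      exact congrFun (congrFun (slidingFourier_sub (intervalIntegrable_mulVec hT.le hA (hx₀ 0))
        (intervalIntegrable_mulVec hT.le hA hxL)) k) i
    rw [hd, toeplitz_act hT hA hdL, e3, e4]
    have e5 : slidingFourier T b 0 k i = phasor T (fun t => b t i) 0 k := rfl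
    have e6 : (0 : Ell2 ι) k i = 0 := rfl
    rw [e6]
    linear_combination e5 - e1 + e2
  rw [sub_eq_zero.1 hzero, coords_ofSignal]

variable [DecidableEq ι] {A Φ Ψ : ℝ → Matrix ι ι ℝ}

theorem IsFundamental.eq_zero_of_prim (hΦ : IsFundamental A Φ Ψ) {d : ℝ → ι → ℝ}
    (hd : VecPrimOn univ d fun t => A t *ᵥ d t) (h0 : d 0 = 0) (t : ℝ) : d t = 0 := by
  have h1 : VecPrimOn univ (fun t => Ψ t *ᵥ d t) fun _ => 0 := by
    refine (hΦ.prim_inv.mulVec hd).congr_deriv fun t _ => ?_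
    simp [Matrix.neg_mulVec, Matrix.mulVec_mulVec]
  have h2 : Ψ t *ᵥ d t = 0 := by
    funext i
    have := (h1 i).sub_eq (mem_univ 0) (mem_univ t)
    simpa [h0, sub_eq_zero] using this
  have h3 : Φ t *ᵥ (Ψ t *ᵥ d t) = d t := by
    rw [Matrix.mulVec_mulVec, hΦ.mul_inv, Matrix.one_mulVec]
  rw [← h3, h2, Matrix.mulVec_zero]

/-- A fixed vector of `M` satisfies `v = M ^ k v → 0`, so `1 - M` is injective, hence surjective. -/
theorem exists_solution_one_sub {M : Matrix ι ι ℝ}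
    (hM : Tendsto (fun k : ℕ => M ^ k) atTop (𝓝 0)) (b : ι → ℝ) : ∃ ξ, ξ - M *ᵥ ξ = b := by
  let L : (ι → ℝ) →ₗ[ℝ] ι → ℝ := LinearMap.id - M.mulVecLin
  have hL : Function.Injective L := by
    rw [injective_iff_map_eq_zero]
    intro v hv
    have hv1 : M *ᵥ v = v := (sub_eq_zero.1 (show v - M *ᵥ v = 0 from hv)).symm
    have hv2 : ∀ k : ℕ, v = M ^ k *ᵥ v := fun k => by
      induction k with
      | zero => simp
      | succ k ih => rw [pow_succ, ← Matrix.mulVec_mulVec, hv1, ← ih]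
    have h2 : Continuous fun X : Matrix ι ι ℝ => X *ᵥ v := by fun_prop
    have h3 := (h2.tendsto 0).comp hM
    rw [Matrix.zero_mulVec] at h3
    exact tendsto_nhds_unique (tendsto_const_nhds.congr hv2) h3
  exact LinearMap.injective_iff_surjective.1 hL b

/-- A stable periodic linear system with a periodic input has a periodic solution. -/
theorem IsFundamental.exists_periodic_solution (hΦ : IsFundamental A Φ Ψ)
    (hAper : Function.Periodic A T) (hM : Tendsto (fun k : ℕ => Φ T ^ k) atTop (𝓝 0))
    {b : ℝ → ι → ℝ} (hbper : Function.Periodic b T)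
    (hb : ∀ i u v, IntervalIntegrable (fun t => b t i) volume u v) :
    ∃ x : ℝ → ι → ℝ, Function.Periodic x T ∧ VecPrimOn univ x fun t => A t *ᵥ x t + b t := by
  have hΨc : ∀ i j, Continuous fun t => Ψ t i j := fun i j => (hΦ.prim_inv i j).continuous
  let β : ℝ → ι → ℝ := fun t i => ∫ r in 0..t, (Ψ r *ᵥ b r) i
  -- Variation of constants gives `x = Φ (ξ + β)`; this choice of `ξ` is the condition `x T = x 0`.
  obtain ⟨ξ, hξ⟩ := exists_solution_one_sub hM (Φ T *ᵥ β T)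
  have hy : VecPrimOn univ (fun t => ξ + β t) fun t => Ψ t *ᵥ b t := fun i =>
    IsPrimitiveOn.of_integral (fun t _ =>
      intervalIntegrable_mulVec_of_continuous hΨc (fun i => hb i 0 t) i) (ξ i)
  have hx : VecPrimOn univ (fun t => Φ t *ᵥ (ξ + β t)) fun t =>
      A t *ᵥ (Φ t *ᵥ (ξ + β t)) + b t := by
    refine (hΦ.prim.mulVec hy).congr_deriv fun t _ => ?_
    simp only [Matrix.mulVec_mulVec, hΦ.mul_inv, Matrix.one_mulVec]
  refine ⟨_, fun t => ?_, hx⟩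
  -- The difference between `x` and its translate solves the homogeneous system and vanishes at `0`,
  -- so matching one pair of values gives periodicity.
  have hd : VecPrimOn univ (fun t => Φ (t + T) *ᵥ (ξ + β (t + T)) - Φ t *ᵥ (ξ + β t)) fun t =>
      A t *ᵥ (Φ (t + T) *ᵥ (ξ + β (t + T)) - Φ t *ᵥ (ξ + β t)) := fun i => by
    refine (((hx i).comp_add_right T).sub (hx i)).congr_deriv fun t _ => ?_
    simp only [hAper t, hbper t, Matrix.mulVec_sub, Pi.sub_apply, Pi.add_apply]
    ring
  refine sub_eq_zero.1 (hΦ.eq_zero_of_prim hd ?_ t)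
  have hβ0 : β 0 = 0 := funext fun i => intervalIntegral.integral_same
  rw [zero_add, hβ0, hΦ.zero, Matrix.one_mulVec, add_zero, Matrix.mulVec_add, ← hξ]
  abel

end Equilibrium

end HarmonicControl

namespace HarmonicControl

/-! ### The error system of the closed loop -/

section ErrorSystem

open Set Matrix

variable {ι : Type} [Fintype ι]

/-- The radial retraction of a normed space onto a ball. -/
noncomputable def radialRetract {E : Type*} [NormedAddCommGroup E] [NormedSpace ℝ E] (R : ℝ)
    (x : E) : E :=
  (R / max R ‖x‖) • x

section RadialRetract

variable {E : Type*} [NormedAddCommGroup E] [NormedSpace ℝ E] {R : ℝ}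

theorem radialRetract_of_norm_le (hR : 0 < R) {x : E} (hx : ‖x‖ ≤ R) : radialRetract R x = x := by
  rw [radialRetract, max_eq_left hx, div_self hR.ne', one_smul]

theorem norm_radialRetract_le (hR : 0 < R) (x : E) : ‖radialRetract R x‖ ≤ R := by
  have hm : 0 < max R ‖x‖ := lt_max_of_lt_left hR
  rw [radialRetract, norm_smul, Real.norm_of_nonneg (by positivity), div_mul_eq_mul_div,
    div_le_iff₀ hm]
  gcongr
  exact le_max_right _ _

/-- In a general normed space, such as the sup-norm space used here, the retraction need not be
nonexpansive; the constant `2` collects the change of the vector and the change of the scaling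
factor. -/
theorem norm_radialRetract_sub_le (hR : 0 < R) (x y : E) :
    ‖radialRetract R x - radialRetract R y‖ ≤ 2 * ‖x - y‖ := by
  have hx : 0 < max R ‖x‖ := lt_max_of_lt_left hR
  have hy : 0 < max R ‖y‖ := lt_max_of_lt_left hR
  have h1 : radialRetract R x - radialRetract R y =
      (R / max R ‖x‖) • (x - y) + (R / max R ‖x‖ - R / max R ‖y‖) • y := by
    simp only [radialRetract, smul_sub, sub_smul]
    abel
  have h2 : R / max R ‖x‖ ≤ 1 := (div_le_one hx).2 (le_max_left _ _)
  have h3 : |R / max R ‖x‖ - R / max R ‖y‖| * ‖y‖ ≤ ‖x - y‖ := by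
    have h4 : R / max R ‖x‖ - R / max R ‖y‖ =
        R / max R ‖x‖ * ((max R ‖y‖ - max R ‖x‖) / max R ‖y‖) := by
      field_simp
    have h5 : |max R ‖y‖ - max R ‖x‖| ≤ ‖x - y‖ := by
      refine (abs_max_sub_max_le_max _ _ _ _).trans ?_
      rw [sub_self, abs_zero]
      refine max_le (norm_nonneg _) ?_
      rw [abs_sub_comm]
      exact abs_norm_sub_norm_le x y
    rw [h4, abs_mul, abs_of_nonneg (show 0 ≤ R / max R ‖x‖ by positivity), abs_div,
      abs_of_pos hy]
    calc R / max R ‖x‖ * (|max R ‖y‖ - max R ‖x‖| / max R ‖y‖) * ‖y‖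
        ≤ 1 * (‖x - y‖ / max R ‖y‖) * max R ‖y‖ := by
          gcongr
          exact le_max_right _ _
      _ = ‖x - y‖ := by field_simp
  rw [h1]
  refine (norm_add_le _ _).trans ?_
  rw [norm_smul, norm_smul, Real.norm_of_nonneg (show 0 ≤ R / max R ‖x‖ by positivity),
    Real.norm_eq_abs]
  nlinarith [norm_nonneg (x - y)]

theorem continuous_radialRetract (hR : 0 < R) : Continuous (radialRetract R : E → E) := by
  refine (LipschitzWith.of_dist_le_mul (K := 2) fun x y => ?_).continuous
  rw [dist_eq_norm, dist_eq_norm]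
  exact norm_radialRetract_sub_le hR x y

end RadialRetract

/-- The direction `g₀ + G e` in which the control acts on the error `e`. -/
noncomputable def gainVec (G : Matrix ι ι ℝ) (g₀ : ι → ℝ) (e : ι → ℂ) : ι → ℂ :=
  cVec g₀ + cMat G *ᵥ e

/-- The correction `γ (g(e)^* P e) g(e)` of the state feedback. -/
noncomputable def correction (P G : Matrix ι ι ℝ) (γ : ℝ) (g₀ : ι → ℝ) (e : ι → ℂ) : ι → ℂ :=
  ((γ : ℂ) * (star (gainVec G g₀ e) ⬝ᵥ cMat P *ᵥ e)) • gainVec G g₀ e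

/-- The right-hand side of the closed-loop error system. -/
noncomputable def errorField (A P : ℝ → Matrix ι ι ℝ) (G : Matrix ι ι ℝ) (γ : ℝ → ℝ)
    (g₀ : ℝ → ι → ℝ) (t : ℝ) (e : ι → ℂ) : ι → ℂ :=
  cMat (A t) *ᵥ e - correction (P t) G (γ t) (g₀ t) e

theorem norm_cVec (v : ι → ℝ) : ‖cVec v‖ = ‖v‖ := by
  simp only [cVec, Pi.norm_def, Complex.nnnorm_real]

theorem norm_dotProduct_le (x y : ι → ℂ) : ‖star x ⬝ᵥ y‖ ≤ Fintype.card ι * (‖x‖ * ‖y‖) := by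
  refine (norm_sum_le _ _).trans ((Finset.sum_le_sum (g := fun _ => ‖x‖ * ‖y‖)
    fun i _ => ?_).trans_eq (by simp))
  rw [norm_mul, Pi.star_apply, norm_star]
  exact mul_le_mul (norm_le_pi_norm x i) (norm_le_pi_norm y i) (norm_nonneg _) (norm_nonneg _)

/-- The correction is a product of three factors affine in `e`; telescoping gives three terms, and
`b = ‖g₀‖ + c R` bounds both the gain and `c R`. The constant is quadratic in `g₀`, so it is locally
integrable for `g₀` in `L²`. -/
theorem norm_correction_sub_le (P G : Matrix ι ι ℝ) (γ : ℝ) (g₀ : ι → ℝ) {R p c : ℝ}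
    (hp : ∑ i, ∑ j, ‖cMat P i j‖ ≤ p) (hc : ∑ i, ∑ j, ‖cMat G i j‖ ≤ c) {x y : ι → ℂ}
    (hx : ‖x‖ ≤ R) (hy : ‖y‖ ≤ R) :
    ‖correction P G γ g₀ x - correction P G γ g₀ y‖ ≤
      3 * Fintype.card ι * p * |γ| * (‖g₀‖ + c * R) ^ 2 * ‖x - y‖ := by
  have hp0 : 0 ≤ p := le_trans (by positivity) hp
  have hc0 : 0 ≤ c := le_trans (by positivity) hc
  have hR0 : 0 ≤ R := (norm_nonneg _).trans hx
  have hP : ∀ v, ‖cMat P *ᵥ v‖ ≤ p * ‖v‖ := fun v => (norm_mulVec_le _ _).trans (by gcongr)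
  have hG : ∀ v, ‖cMat G *ᵥ v‖ ≤ c * ‖v‖ := fun v => (norm_mulVec_le _ _).trans (by gcongr)
  set b := ‖g₀‖ + c * R with hb
  have hb0 : 0 ≤ b := by positivity
  have hcb : c * R ≤ b := by rw [hb]; linarith [norm_nonneg g₀]
  have hgv : ∀ v : ι → ℂ, ‖v‖ ≤ R → ‖gainVec G g₀ v‖ ≤ b := fun v hv => by
    refine (norm_add_le _ _).trans ?_
    rw [norm_cVec]
    have := hG v
    rw [hb]
    gcongr
    exact this.trans (by gcongr)
  have hgd : gainVec G g₀ x - gainVec G g₀ y = cMat G *ᵥ (x - y) := by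
    rw [gainVec, gainVec, Matrix.mulVec_sub]
    abel
  have h1 : correction P G γ g₀ x - correction P G γ g₀ y =
      (γ : ℂ) • ((star (gainVec G g₀ x) ⬝ᵥ cMat P *ᵥ (x - y)) • gainVec G g₀ x +
        (star (gainVec G g₀ x - gainVec G g₀ y) ⬝ᵥ cMat P *ᵥ y) • gainVec G g₀ x +
        (star (gainVec G g₀ y) ⬝ᵥ cMat P *ᵥ y) • (gainVec G g₀ x - gainVec G g₀ y)) := by
    simp only [correction, Matrix.mulVec_sub, star_sub, sub_dotProduct, dotProduct_sub, smul_sub,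
      sub_smul, smul_add, mul_smul]
    abel
  rw [h1, norm_smul, Complex.norm_real, Real.norm_eq_abs]
  have hd := norm_nonneg (x - y)
  have e1 : ‖(star (gainVec G g₀ x) ⬝ᵥ cMat P *ᵥ (x - y)) • gainVec G g₀ x‖ ≤
      Fintype.card ι * (b * (p * ‖x - y‖)) * b := by
    rw [norm_smul]
    have := norm_dotProduct_le (gainVec G g₀ x) (cMat P *ᵥ (x - y))
    have h2 := hgv x hx
    have h3 := hP (x - y)
    calc _ ≤ Fintype.card ι * (‖gainVec G g₀ x‖ * ‖cMat P *ᵥ (x - y)‖) * ‖gainVec G g₀ x‖ := by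
          gcongr
      _ ≤ _ := by gcongr
  have e2 : ‖(star (gainVec G g₀ x - gainVec G g₀ y) ⬝ᵥ cMat P *ᵥ y) • gainVec G g₀ x‖ ≤
      Fintype.card ι * ((c * ‖x - y‖) * (p * R)) * b := by
    rw [norm_smul, hgd]
    have := norm_dotProduct_le (cMat G *ᵥ (x - y)) (cMat P *ᵥ y)
    have h2 := hgv x hx
    have h3 := hP y
    have h4 := hG (x - y)
    calc _ ≤ Fintype.card ι * (‖cMat G *ᵥ (x - y)‖ * ‖cMat P *ᵥ y‖) * ‖gainVec G g₀ x‖ := by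
          gcongr
      _ ≤ Fintype.card ι * ((c * ‖x - y‖) * (p * ‖y‖)) * b := by gcongr
      _ ≤ _ := by gcongr
  have e3 : ‖(star (gainVec G g₀ y) ⬝ᵥ cMat P *ᵥ y) • (gainVec G g₀ x - gainVec G g₀ y)‖ ≤
      Fintype.card ι * (b * (p * R)) * (c * ‖x - y‖) := by
    rw [norm_smul, hgd]
    have := norm_dotProduct_le (gainVec G g₀ y) (cMat P *ᵥ y)
    have h2 := hgv y hy
    have h3 := hP y
    have h4 := hG (x - y)
    calc _ ≤ Fintype.card ι * (‖gainVec G g₀ y‖ * ‖cMat P *ᵥ y‖) * ‖cMat G *ᵥ (x - y)‖ := by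
          gcongr
      _ ≤ Fintype.card ι * (b * (p * ‖y‖)) * (c * ‖x - y‖) := by gcongr
      _ ≤ _ := by gcongr
  have e4 : (Fintype.card ι : ℝ) * (b * (p * ‖x - y‖)) * b +
      Fintype.card ι * ((c * ‖x - y‖) * (p * R)) * b +
      Fintype.card ι * (b * (p * R)) * (c * ‖x - y‖) ≤
      3 * Fintype.card ι * p * b ^ 2 * ‖x - y‖ := by
    have h5 : (Fintype.card ι * p * b * ‖x - y‖) * (c * R) ≤
        (Fintype.card ι * p * b * ‖x - y‖) * b := by gcongr
    nlinarith
  calc _ ≤ |γ| * (Fintype.card ι * (b * (p * ‖x - y‖)) * b +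
      Fintype.card ι * ((c * ‖x - y‖) * (p * R)) * b +
      Fintype.card ι * (b * (p * R)) * (c * ‖x - y‖)) := by
        gcongr
        exact (norm_add_le _ _).trans (add_le_add ((norm_add_le _ _).trans (add_le_add e1 e2)) e3)
    _ ≤ |γ| * (3 * Fintype.card ι * p * b ^ 2 * ‖x - y‖) := by gcongr
    _ = _ := by ring

theorem star_correction (P G : Matrix ι ι ℝ) (γ : ℝ) (g₀ : ι → ℝ) (e : ι → ℂ) :
    star (correction P G γ g₀ e) = correction P G γ g₀ (star e) := by
  have hg : gainVec G g₀ (star e) = star (gainVec G g₀ e) := by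
    rw [gainVec, gainVec, star_add, star_cMat_mulVec]
    congr 1
    ext i
    simp [cVec]
  rw [correction, correction, hg, star_smul, star_mul', ← star_cMat_mulVec,
    Matrix.star_dotProduct_star]
  congr 2
  · simp
  · simp [dotProduct_comm]

end ErrorSystem

end HarmonicControl

namespace HarmonicControl

/-! ### Stability of dissipative error systems -/

section Dissipative

open Set Matrix

variable {ι : Type} [Fintype ι] {T : ℝ} {A P Q : ℝ → Matrix ι ι ℝ} {G : Matrix ι ι ℝ}
  {γ : ℝ → ℝ} {g₀ : ℝ → ι → ℝ}

/-- The derivative of the Lyapunov function along a damped solution. -/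
theorem isPrimitiveOn_hermForm {s : Set ℝ} [s.OrdConnected]
    (hP : MatPrimOn s P fun t => -((A t)ᵀ * P t + P t * A t + Q t)) (hPt : ∀ t, (P t)ᵀ = P t)
    {c : ℝ → ℝ} {g e : ℝ → ι → ℂ}
    (he : VecPrimOn s e fun t => cMat (A t) *ᵥ e t -
      ((c t : ℂ) * (star (g t) ⬝ᵥ cMat (P t) *ᵥ e t)) • g t) :
    IsPrimitiveOn s (fun t => hermForm (P t) (e t)) fun t =>
      -hermForm (Q t) (e t) - 2 * c t * ‖star (g t) ⬝ᵥ cMat (P t) *ᵥ e t‖ ^ 2 := by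
  have h1 := (he.star.dotProduct (hP.cMat.mulVec he)).clm_comp Complex.reCLM
  simp only [Complex.reCLM_apply, re_star_dotProduct_cMat] at h1
  refine h1.congr_deriv fun t _ => ?_
  rw [← re_star_dotProduct_cMat]
  set z := star (g t) ⬝ᵥ cMat (P t) *ᵥ e t with hz
  -- By symmetry of `P` the two terms produced by the feedback are conjugate, and together they give
  -- `-2 c |z|²`: the control can only dissipate.
  have hz' : star (e t) ⬝ᵥ cMat (P t) *ᵥ g t = star z := by
    rw [hz, ← hPt t, ← star_cMat_mulVec_dotProduct, hPt t, Matrix.star_dotProduct]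
  have hzz : ((‖z‖ ^ 2 : ℝ) : ℂ) = star z * z := by
    rw [RCLike.star_def, ← Complex.normSq_eq_conj_mul_self, Complex.normSq_eq_norm_sq]
  have h2 : star (cMat (A t) *ᵥ e t - ((c t : ℂ) * z) • g t) ⬝ᵥ cMat (P t) *ᵥ e t +
      star (e t) ⬝ᵥ (cMat (-((A t)ᵀ * P t + P t * A t + Q t)) *ᵥ e t +
        cMat (P t) *ᵥ (cMat (A t) *ᵥ e t - ((c t : ℂ) * z) • g t)) =
      -(star (e t) ⬝ᵥ cMat (Q t) *ᵥ e t) - ((2 * c t * ‖z‖ ^ 2 : ℝ) : ℂ) := by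
    simp only [star_sub, sub_dotProduct, star_cMat_mulVec_dotProduct, cMat_neg, cMat_add,
      cMat_mul, Matrix.neg_mulVec, Matrix.add_mulVec, Matrix.mulVec_sub, dotProduct_add,
      dotProduct_sub, dotProduct_neg, Matrix.mulVec_mulVec, star_smul, smul_dotProduct,
      Matrix.mulVec_smul, dotProduct_smul, ← hz, hz', smul_eq_mul, star_mul', Complex.ofReal_mul,
      hzz]
    simp only [Complex.ofReal_ofNat, RCLike.star_def, Complex.conj_ofReal]
    ring
  rw [h2, Complex.sub_re, Complex.neg_re, Complex.ofReal_re]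

/-- The data of the closed-loop error system: `P` is a periodic Lyapunov function for `A` with
weight `Q`, and `γ` is a bounded positive gain. -/
structure DissipativeLoop [DecidableEq ι] (T : ℝ) (A P Q : ℝ → Matrix ι ι ℝ) (γ : ℝ → ℝ)
    (g₀ : ℝ → ι → ℝ) : Prop where
  period_pos : 0 < T
  intA : ∀ i j a b, IntervalIntegrable (fun t => A t i j) volume a b
  perP : Function.Periodic P T
  posP : ∀ t, (P t).PosDef
  primP : MatPrimOn univ P fun t => -((A t)ᵀ * P t + P t * A t + Q t)
  perQ : Function.Periodic Q T
  measQ : ∀ i j, AEStronglyMeasurable (fun t => Q t i j) volume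
  posQ : ∀ᵐ t, (Q t).PosDef
  memγ : MemLp γ ⊤ volume
  posγ : ∀ᵐ t, 0 < γ t
  memg : ∀ i a b, MemLp (fun t => g₀ t i) 2 (volume.restrict (Icc a b))

/-- The error signal `e` is driven by the linear system and by a damping along some direction. -/
def IsDamped (A P : ℝ → Matrix ι ι ℝ) (s : Set ℝ) (e : ℝ → ι → ℂ) : Prop :=
  ∃ (c : ℝ → ℝ) (g : ℝ → ι → ℂ), (∀ᵐ t, 0 ≤ c t) ∧
    VecPrimOn s e fun t => cMat (A t) *ᵥ e t -
      ((c t : ℂ) * (star (g t) ⬝ᵥ cMat (P t) *ᵥ e t)) • g t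

theorem exists_bound_of_periodic {f : ℝ → ℝ} (hT : 0 < T) (hf : Function.Periodic f T)
    (hc : Continuous f) : ∃ C, 0 ≤ C ∧ ∀ t, f t ≤ C := by
  obtain ⟨C, hC⟩ := isBounded_iff_forall_norm_le.1 (hf.isBounded_of_continuous hT.ne' hc)
  exact ⟨max C 0, le_max_right _ _, fun t =>
    ((le_abs_self _).trans (hC _ ⟨t, rfl⟩)).trans (le_max_left _ _)⟩

variable [DecidableEq ι]

/-- Makes continuity and measurability visible, the determinant and the adjugate being polynomial in
the entries. -/
theorem trace_inv_eq (M : Matrix ι ι ℝ) : M⁻¹.trace = M.det⁻¹ * M.adjugate.trace := by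
  rw [Matrix.inv_def, Matrix.trace_smul, Ring.inverse_eq_inv', smul_eq_mul]

namespace DissipativeLoop

theorem transpose_eq (h : DissipativeLoop T A P Q γ g₀) (t : ℝ) : (P t)ᵀ = P t := by
  simpa using (h.posP t).1.eq

theorem continuous_P (h : DissipativeLoop T A P Q γ g₀) : Continuous P :=
  continuous_pi fun i => continuous_pi fun j => (h.primP i j).continuous

theorem exists_bound_P (h : DissipativeLoop T A P Q γ g₀) :
    ∃ p, 0 ≤ p ∧ ∀ t, ∑ i, ∑ j, ‖cMat (P t) i j‖ ≤ p := by
  refine exists_bound_of_periodic h.period_pos (fun t => by rw [h.perP t]) ?_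
  exact continuous_finsetSum _ fun i _ => continuous_finsetSum _ fun j _ =>
    (h.primP.cMat i j).continuous.norm

theorem exists_bound_trace_inv (h : DissipativeLoop T A P Q γ g₀) :
    ∃ p, 0 ≤ p ∧ ∀ t, (P t)⁻¹.trace ≤ p := by
  refine exists_bound_of_periodic h.period_pos (fun t => by rw [h.perP t]) ?_
  simp only [trace_inv_eq]
  refine Continuous.mul (Continuous.inv₀ h.continuous_P.matrix_det fun t => ?_) ?_
  · exact (h.posP t).det_pos.ne'
  · exact h.continuous_P.matrix_adjugate.matrix_trace

theorem antitoneOn (h : DissipativeLoop T A P Q γ g₀) {s : Set ℝ} [s.OrdConnected]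
    {e : ℝ → ι → ℂ} (he : IsDamped A P s e) :
    AntitoneOn (fun t => hermForm (P t) (e t)) s := by
  obtain ⟨c, g, hc, he⟩ := he
  refine (isPrimitiveOn_hermForm (h.primP.mono (subset_univ _)) h.transpose_eq he).antitoneOn ?_
  filter_upwards [hc, h.posQ] with t hct hQt _
  have := hermForm_nonneg hQt.posSemidef (e t)
  have h2 : 0 ≤ 2 * c t * ‖star (g t) ⬝ᵥ cMat (P t) *ᵥ e t‖ ^ 2 := by positivity
  linarith

/-- Damped error signals are uniformly bounded by their initial values. -/
theorem exists_norm_le (h : DissipativeLoop T A P Q γ g₀) : ∃ C, 0 < C ∧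
    ∀ (s : Set ℝ) [s.OrdConnected] (e : ℝ → ι → ℂ),
    IsDamped A P s e → ∀ a ∈ s, ∀ b ∈ s, a ≤ b → ‖e b‖ ≤ C * ‖e a‖ := by
  obtain ⟨p, hp0, hp⟩ := h.exists_bound_P
  obtain ⟨q, hq0, hq⟩ := h.exists_bound_trace_inv
  -- The summand `1` keeps the constant positive even for zero bounds; it is later used as a
  -- divisor.
  refine ⟨√(q * (Fintype.card ι * p)) + 1, by positivity, fun s _ e he a ha b hb hab => ?_⟩
  have h1 := h.antitoneOn he ha hb hab
  have h2 : ‖e b‖ ^ 2 ≤ (√(q * (Fintype.card ι * p)) * ‖e a‖) ^ 2 := by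
    calc ‖e b‖ ^ 2 ≤ ∑ i, ‖e b i‖ ^ 2 := norm_sq_le_sum _
      _ ≤ (P b)⁻¹.trace * hermForm (P b) (e b) := sum_norm_sq_le_hermForm (h.posP b) _
      _ ≤ q * hermForm (P b) (e b) := by
        have := hermForm_nonneg (h.posP b).posSemidef (e b)
        have := hq b
        gcongr
      _ ≤ q * hermForm (P a) (e a) := by gcongr
      _ ≤ q * (Fintype.card ι * p * ‖e a‖ ^ 2) := by
        have := hermForm_le (P a) (e a)
        have := hp a
        gcongr
        exact (hermForm_le (P a) (e a)).trans (by gcongr)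
      _ = _ := by rw [mul_pow, Real.sq_sqrt (by positivity)]; ring
  have h3 := (sq_le_sq₀ (norm_nonneg _) (by positivity)).1 h2
  refine h3.trans ?_
  gcongr
  linarith

/-- `Q` is positive definite almost everywhere but without a uniform lower bound, so the rate is a
function of time. Positivity and periodicity suffice for its integral to diverge. -/
theorem exists_decay (h : DissipativeLoop T A P Q γ g₀) :
    ∃ κ : ℝ → ℝ, Function.Periodic κ T ∧ (∀ t, 0 < κ t) ∧
    (∀ a b, IntervalIntegrable κ volume a b) ∧
      ∀ᵐ t, ∀ e, κ t * hermForm (P t) e ≤ hermForm (Q t) e := by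
  obtain ⟨p, hp0, hp⟩ := h.exists_bound_P
  have hmQ : AEStronglyMeasurable Q volume :=
    (aemeasurable_pi_lambda _ fun i => aemeasurable_pi_lambda _ fun j =>
      (h.measQ i j).aemeasurable).aestronglyMeasurable
  have hmtr : AEStronglyMeasurable (fun t => (Q t)⁻¹.trace) volume := by
    simp only [trace_inv_eq]
    have h1 : AEStronglyMeasurable (fun t => (Q t).det) volume :=
      (continuous_id.matrix_det).comp_aestronglyMeasurable hmQ
    have h2 : AEStronglyMeasurable (fun t => (Q t).adjugate.trace) volume :=
      (continuous_id.matrix_adjugate.matrix_trace).comp_aestronglyMeasurable hmQ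
    exact (h1.aemeasurable.inv.aestronglyMeasurable).mul h2
  set d := (Fintype.card ι : ℝ) * p + 1 with hd
  have hd0 : 0 < d := by positivity
  -- The term `1 + |·|` bounds the rate by `d⁻¹`, hence local integrability, and makes it positive
  -- also at the exceptional times where `Q t` is not positive definite.
  refine ⟨fun t => (d * (1 + |(Q t)⁻¹.trace|))⁻¹, fun t => by simp only [h.perQ t],
    fun t => by positivity, fun a b => ?_, ?_⟩
  · refine (intervalIntegrable_const (c := d⁻¹)).mono_fun' ?_ (ae_of_all _ fun t => ?_)
    · exact ((hmtr.norm.const_add 1).const_mul d).aemeasurable.inv.aestronglyMeasurable.restrict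
    · change ‖(d * (1 + |(Q t)⁻¹.trace|))⁻¹‖ ≤ d⁻¹
      rw [Real.norm_of_nonneg (by positivity)]
      refine inv_anti₀ hd0 ?_
      nlinarith [abs_nonneg (Q t)⁻¹.trace]
  · filter_upwards [h.posQ] with t hQt e
    rw [inv_mul_le_iff₀ (by positivity)]
    have h1 := sum_norm_sq_le_hermForm hQt e
    have h2 := hermForm_nonneg hQt.posSemidef e
    calc hermForm (P t) e ≤ Fintype.card ι * (∑ i, ∑ j, ‖cMat (P t) i j‖) * ‖e‖ ^ 2 :=
          hermForm_le _ _
      _ ≤ Fintype.card ι * p * ∑ i, ‖e i‖ ^ 2 := by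
        gcongr
        · exact hp t
        · exact norm_sq_le_sum e
      _ ≤ d * ∑ i, ‖e i‖ ^ 2 := by gcongr; linarith
      _ ≤ d * ((1 + |(Q t)⁻¹.trace|) * hermForm (Q t) e) := by
        gcongr
        refine h1.trans ?_
        gcongr
        linarith [le_abs_self (Q t)⁻¹.trace]
      _ = _ := by ring

/-- Damped error signals tend to zero. -/
theorem tendsto_zero (h : DissipativeLoop T A P Q γ g₀) {a : ℝ} {e : ℝ → ι → ℂ}
    (he : IsDamped A P (Ici a) e) :
    Tendsto e atTop (𝓝 0) := by
  obtain ⟨κ, hκper, hκpos, hκint, hκ⟩ := h.exists_decay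
  obtain ⟨q, hq0, hq⟩ := h.exists_bound_trace_inv
  obtain ⟨c, g, hc, hprim⟩ := he
  have hV := isPrimitiveOn_hermForm (h.primP.mono (subset_univ _)) h.transpose_eq hprim
  have hle : ∀ t ∈ Ici a, hermForm (P t) (e t) ≤
      hermForm (P a) (e a) * Real.exp (∫ r in a..t, -κ r) := fun t ht => by
    refine hV.le_mul_exp self_mem_Ici ht ht (fun c _ => (hκint a c).neg) ?_
    filter_upwards [hc, hκ] with t hct hκt _
    have h1 := hκt (e t)
    have h2 : 0 ≤ 2 * c t * ‖star (g t) ⬝ᵥ cMat (P t) *ᵥ e t‖ ^ 2 := by positivity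
    linarith
  -- The integral of `κ` over each period is the same positive number, so the exponent in Grönwall's
  -- bound tends to `-∞`.
  have hint : Tendsto (fun t => ∫ r in a..t, -κ r) atTop atBot := by
    have h1 := hκper.tendsto_atTop_intervalIntegral_of_pos' (hκint 0 T) hκpos h.period_pos
    have h2 : ∀ t, ∫ r in a..t, -κ r = -((∫ r in a..0, κ r) + ∫ r in 0..t, κ r) := fun t => by
      rw [intervalIntegral.integral_neg,
        intervalIntegral.integral_add_adjacent_intervals (hκint a 0) (hκint 0 t)]
    simp only [h2]
    exact tendsto_neg_atTop_atBot.comp (tendsto_atTop_add_const_left _ _ h1)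
  have hsq : Tendsto (fun t => ‖e t‖ ^ 2) atTop (𝓝 0) := by
    have hlim : Tendsto (fun t => q * (hermForm (P a) (e a) * Real.exp (∫ r in a..t, -κ r)))
        atTop (𝓝 0) := by
      simpa using ((Real.tendsto_exp_atBot.comp hint).const_mul (hermForm (P a) (e a))).const_mul q
    refine tendsto_of_tendsto_of_tendsto_of_le_of_le' tendsto_const_nhds hlim
      (Eventually.of_forall fun t => by positivity) ?_
    filter_upwards [eventually_ge_atTop a] with t ht
    calc ‖e t‖ ^ 2 ≤ ∑ i, ‖e t i‖ ^ 2 := norm_sq_le_sum _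
      _ ≤ (P t)⁻¹.trace * hermForm (P t) (e t) := sum_norm_sq_le_hermForm (h.posP t) _
      _ ≤ q * hermForm (P t) (e t) := by
        have := hermForm_nonneg (h.posP t).posSemidef (e t)
        have := hq t
        gcongr
      _ ≤ _ := by gcongr; exact hle t ht
  refine tendsto_zero_iff_norm_tendsto_zero.2 ?_
  have := hsq.sqrt
  simpa using this

end DissipativeLoop

end Dissipative

end HarmonicControl

namespace HarmonicControl

/-! ### Existence and uniqueness for the closed-loop error system -/

section ClosedLoop

open Set Matrix

variable {ι : Type} [Fintype ι] {T : ℝ} {A P Q : ℝ → Matrix ι ι ℝ} {G : Matrix ι ι ℝ}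
  {γ : ℝ → ℝ} {g₀ : ℝ → ι → ℝ}

/-- With `r` the scaling factor of the radial retraction, the truncated feedback is again a damping,
with gain `γ r` and direction evaluated at the retracted error. So the a priori bound also covers
the truncated system. -/
theorem correction_smul (P G : Matrix ι ι ℝ) (γ : ℝ) (g₀ : ι → ℝ) (r : ℝ) (e : ι → ℂ) :
    correction P G γ g₀ (r • e) =
      (((γ * r : ℝ) : ℂ) * (star (gainVec G g₀ (r • e)) ⬝ᵥ cMat P *ᵥ e)) •
        gainVec G g₀ (r • e) := by
  have h1 : cMat P *ᵥ (r • e) = (r : ℂ) • (cMat P *ᵥ e) := by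
    rw [← Matrix.mulVec_smul]
    congr 1
  rw [correction, h1, dotProduct_smul, smul_eq_mul]
  push_cast
  congr 1
  ring

theorem isDamped_of_errorField (hγ : ∀ᵐ t, 0 < γ t) {s : Set ℝ} {e : ℝ → ι → ℂ}
    (he : VecPrimOn s e fun t => errorField A P G γ g₀ t (e t)) : IsDamped A P s e :=
  ⟨γ, fun t => gainVec G (g₀ t) (e t), hγ.mono fun _ ht => ht.le, he⟩

theorem continuous_cMat_of {ι : Type} : Continuous fun M : ι → ι → ℝ => cMat (Matrix.of M) :=
  continuous_matrix fun i j =>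
    Complex.continuous_ofReal.comp ((continuous_apply j).comp (continuous_apply i))

theorem continuous_correction : Continuous fun q : (ι → ι → ℝ) × ℝ × (ι → ℝ) × (ι → ℂ) =>
    correction (Matrix.of q.1) G q.2.1 q.2.2.1 q.2.2.2 := by
  have h1 : Continuous fun q : (ι → ι → ℝ) × ℝ × (ι → ℝ) × (ι → ℂ) => cMat (Matrix.of q.1) :=
    continuous_cMat_of.comp continuous_fst
  have h2 : Continuous fun q : (ι → ι → ℝ) × ℝ × (ι → ℝ) × (ι → ℂ) =>
      gainVec G q.2.2.1 q.2.2.2 := by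
    unfold gainVec cVec
    fun_prop
  unfold correction
  fun_prop

variable [DecidableEq ι]

namespace DissipativeLoop

theorem aestronglyMeasurable_g (h : DissipativeLoop T A P Q γ g₀) :
    AEStronglyMeasurable g₀ volume := by
  refine (aemeasurable_pi_lambda _ fun i => ?_).aestronglyMeasurable
  have h1 : LocallyIntegrable (fun t => g₀ t i) volume :=
    locallyIntegrable_of_intervalIntegrable fun a b => by
      rw [intervalIntegrable_iff]
      exact ((h.memg i (min a b) (max a b)).integrable (by norm_num)).mono_measure
        (Measure.restrict_mono Ioc_subset_Icc_self le_rfl)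
  exact h1.aestronglyMeasurable.aemeasurable

theorem aestronglyMeasurable_A (h : DissipativeLoop T A P Q γ g₀) (i j : ι) :
    AEStronglyMeasurable (fun t => A t i j) volume :=
  (locallyIntegrable_of_intervalIntegrable (h.intA i j)).aestronglyMeasurable

theorem aestronglyMeasurable_correction (h : DissipativeLoop T A P Q γ g₀) {u : ℝ → ι → ℂ}
    (hu : Continuous u) :
    AEStronglyMeasurable (fun t => correction (P t) G (γ t) (g₀ t) (u t)) volume := by
  have hP : Continuous fun t => (fun i j => P t i j : ι → ι → ℝ) :=
    continuous_pi fun i => continuous_pi fun j => (h.primP i j).continuous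
  exact (continuous_correction (G := G)).comp_aestronglyMeasurable
    (hP.aestronglyMeasurable.prodMk
      (h.memγ.1.prodMk (h.aestronglyMeasurable_g.prodMk hu.aestronglyMeasurable)))

theorem aestronglyMeasurable_mulVec (h : DissipativeLoop T A P Q γ g₀) {u : ℝ → ι → ℂ}
    (hu : Continuous u) :
    AEStronglyMeasurable (fun t => cMat (A t) *ᵥ u t) volume := by
  refine (aemeasurable_pi_lambda _ fun i => ?_).aestronglyMeasurable
  refine Finset.aemeasurable_fun_sum _ fun j _ => ?_
  exact (Complex.measurable_ofReal.comp_aemeasurable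
    (h.aestronglyMeasurable_A i j).aemeasurable).mul
    ((continuous_apply j).comp hu).aemeasurable

/-- The correction term is Lipschitz on balls, with a locally integrable constant. -/
theorem exists_lipschitz (h : DissipativeLoop T A P Q γ g₀) (G : Matrix ι ι ℝ) (R : ℝ) :
    ∃ k : ℝ → ℝ, (∀ a b, IntervalIntegrable k volume a b) ∧ (∀ t, 0 ≤ k t) ∧
      ∀ t x y, ‖x‖ ≤ R → ‖y‖ ≤ R →
        ‖correction (P t) G (γ t) (g₀ t) x - correction (P t) G (γ t) (g₀ t) y‖ ≤
          k t * ‖x - y‖ := by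
  obtain ⟨p, hp0, hp⟩ := h.exists_bound_P
  set c := ∑ i, ∑ j, ‖cMat G i j‖ with hc
  refine ⟨fun t => 3 * Fintype.card ι * p * |γ t| * (‖g₀ t‖ + c * R) ^ 2, fun a b => ?_,
    fun t => by positivity, fun t x y hx hy => norm_correction_sub_le _ _ _ _ (hp t) le_rfl hx hy⟩
  rw [intervalIntegrable_iff]
  have h1 : MemLp (fun t => ‖g₀ t‖ + c * R) 2 (volume.restrict (uIoc a b)) := by
    have h2 : MemLp g₀ 2 (volume.restrict (uIoc a b)) :=
      MemLp.of_eval fun i => (h.memg i (min a b) (max a b)).mono_measure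
        (Measure.restrict_mono Ioc_subset_Icc_self le_rfl)
    have : IsFiniteMeasure (volume.restrict (uIoc a b)) :=
      inferInstanceAs (IsFiniteMeasure (volume.restrict (Ioc (min a b) (max a b))))
    exact h2.norm.add (memLp_const _)
  have h3 : MemLp (fun t => |γ t|) ⊤ (volume.restrict (uIoc a b)) := (h.memγ.restrict _).norm
  -- A bounded function times the square of an `L²` function.
  have h4 : Integrable (fun t => |γ t| * (‖g₀ t‖ + c * R) ^ 2) (volume.restrict (uIoc a b)) := by
    have h5 := memLp_one_iff_integrable.2 h1.integrable_sq
    exact memLp_one_iff_integrable.1 (h5.mul (r := 1) h3)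
  refine (h4.const_mul (3 * Fintype.card ι * p)).congr (ae_of_all _ fun t => ?_)
  change _ * (_ * _) = _
  ring

theorem intervalIntegrable_normA (h : DissipativeLoop T A P Q γ g₀) (a b : ℝ) :
    IntervalIntegrable (fun t => ∑ i, ∑ j, ‖cMat (A t) i j‖) volume a b := by
  have h1 := IntervalIntegrable.sum (μ := volume) (a := a) (b := b) Finset.univ
    (f := fun i t => ∑ j, ‖cMat (A t) i j‖) fun i _ => by
      have h2 := IntervalIntegrable.sum (μ := volume) (a := a) (b := b) Finset.univ
        (f := fun j t => ‖cMat (A t) i j‖) fun j _ => by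
          simpa [cMat] using (h.intA i j a b).norm
      simpa only [Finset.sum_fn] using h2
  simpa only [Finset.sum_fn] using h1

/-- Global existence for the closed-loop error system. -/
theorem exists_solution (h : DissipativeLoop T A P Q γ g₀) (G : Matrix ι ι ℝ) (a : ℝ)
    (ξ : ι → ℂ) : ∃ e : ℝ → ι → ℂ, e a = ξ ∧
      VecPrimOn (Ici a) e fun t => errorField A P G γ g₀ t (e t) := by
  obtain ⟨C, hC0, hC⟩ := h.exists_norm_le
  -- Larger than the a priori bound `C ‖ξ‖`, so the truncation at radius `R` is inactive along the
  -- solution for `t ≥ a`; the `1` keeps the radius positive when `ξ = 0`.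
  set R := C * ‖ξ‖ + 1 with hR
  have hR0 : 0 < R := by positivity
  obtain ⟨k, hki, hk0, hk⟩ := h.exists_lipschitz G R
  set f : ℝ → (ι → ℂ) → ι → ℂ := fun t x =>
    cMat (A t) *ᵥ x - correction (P t) G (γ t) (g₀ t) (radialRetract R x) with hf
  have hlip : ∀ t x y, ‖f t x - f t y‖ ≤ (∑ i, ∑ j, ‖cMat (A t) i j‖ + 2 * k t) * ‖x - y‖ := by
    intro t x y
    have h1 : f t x - f t y =
        cMat (A t) *ᵥ (x - y) - (correction (P t) G (γ t) (g₀ t) (radialRetract R x) -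
          correction (P t) G (γ t) (g₀ t) (radialRetract R y)) := by
      rw [Matrix.mulVec_sub]
      simp only [hf]
      abel
    rw [h1, add_mul]
    refine (norm_sub_le _ _).trans (add_le_add (norm_mulVec_le _ _) ?_)
    refine (hk t _ _ (norm_radialRetract_le hR0 x) (norm_radialRetract_le hR0 y)).trans ?_
    have := mul_le_mul_of_nonneg_left (norm_radialRetract_sub_le hR0 x y) (hk0 t)
    linarith
  have hK0 : ∀ t, 0 ≤ ∑ i, ∑ j, ‖cMat (A t) i j‖ + 2 * k t := fun t =>
    add_nonneg (by positivity) (mul_nonneg zero_le_two (hk0 t))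
  have hzero : ∀ t, ‖f t 0‖ ≤ ∑ i, ∑ j, ‖cMat (A t) i j‖ + 2 * k t := fun t => by
    have h1 : f t 0 = 0 := by simp [hf, radialRetract, correction]
    rw [h1, norm_zero]
    exact hK0 t
  have hmeas : ∀ u : ℝ → ι → ℂ, Continuous u →
      AEStronglyMeasurable (fun t => f t (u t)) volume := fun u hu =>
    (h.aestronglyMeasurable_mulVec hu).sub
      (h.aestronglyMeasurable_correction ((continuous_radialRetract hR0).comp hu))
  obtain ⟨e, hea, he⟩ := exists_primitive_of_lipschitz
    (fun a b => (h.intervalIntegrable_normA a b).add ((hki a b).const_mul 2)) hK0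
    (ae_of_all _ hlip) (ae_of_all _ hzero) hmeas a ξ
  have hv := vecPrimOn_of_isPrimitiveOn he
  have hdamp : IsDamped A P univ e := by
    refine ⟨fun t => γ t * (R / max R ‖e t‖), fun t => gainVec G (g₀ t) (radialRetract R (e t)),
      ?_, hv.congr_deriv fun t _ => ?_⟩
    · filter_upwards [h.posγ] with t ht
      have : 0 < max R ‖e t‖ := lt_max_of_lt_left hR0
      positivity
    · simp only [hf]
      rw [radialRetract, correction_smul]
  refine ⟨e, hea, (hv.mono (subset_univ _)).congr_deriv fun t ht => ?_⟩
  have h1 := hC univ e hdamp a (mem_univ _) t (mem_univ _) ht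
  rw [hea] at h1
  simp only [hf]
  rw [errorField, radialRetract_of_norm_le hR0 (by linarith)]

/-- Uniqueness for the closed-loop error system. -/
theorem unique_solution (h : DissipativeLoop T A P Q γ g₀) {a : ℝ} {e f : ℝ → ι → ℂ}
    (he : VecPrimOn (Ici a) e fun t => errorField A P G γ g₀ t (e t))
    (hf : VecPrimOn (Ici a) f fun t => errorField A P G γ g₀ t (f t)) (haf : e a = f a) {b : ℝ}
    (hab : a ≤ b) : e b = f b := by
  obtain ⟨C, hC0, hC⟩ := h.exists_norm_le
  -- Both solutions stay in this ball by the a priori bound, so one Lipschitz constant serves for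
  -- all times.
  obtain ⟨k, hki, hk0, hk⟩ := h.exists_lipschitz G (C * ‖e a‖)
  have hbe : ∀ t ∈ Ici a, ‖e t‖ ≤ C * ‖e a‖ := fun t ht =>
    hC _ e (isDamped_of_errorField h.posγ he) a self_mem_Ici t ht ht
  have hbf : ∀ t ∈ Ici a, ‖f t‖ ≤ C * ‖e a‖ := fun t ht => by
    rw [haf]
    exact hC _ f (isDamped_of_errorField h.posγ hf) a self_mem_Ici t ht ht
  refine sub_eq_zero.1 ((he.isPrimitiveOn.sub hf.isPrimitiveOn).eq_zero_of_norm_le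
    (k := fun t => ∑ i, ∑ j, ‖cMat (A t) i j‖ + k t) (a := a) self_mem_Ici hab hab
    ((h.intervalIntegrable_normA a b).add (hki a b))
    (fun t => add_nonneg (by positivity) (hk0 t)) (ae_of_all _ fun t ht => ?_) (sub_eq_zero.2 haf))
  have h1 : errorField A P G γ g₀ t (e t) - errorField A P G γ g₀ t (f t) =
      cMat (A t) *ᵥ (e t - f t) - (correction (P t) G (γ t) (g₀ t) (e t) -
        correction (P t) G (γ t) (g₀ t) (f t)) := by
    rw [errorField, errorField, Matrix.mulVec_sub]
    abel
  rw [h1, add_mul]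
  exact (norm_sub_le _ _).trans (add_le_add (norm_mulVec_le _ _) (hk t _ _ (hbe t ht) (hbf t ht)))

/-- Solutions of the error system with real initial values are real. -/
theorem star_eq_self (h : DissipativeLoop T A P Q γ g₀) {a : ℝ} {e : ℝ → ι → ℂ}
    (he : VecPrimOn (Ici a) e fun t => errorField A P G γ g₀ t (e t)) (ha : star (e a) = e a)
    {b : ℝ} (hab : a ≤ b) : star (e b) = e b := by
  refine h.unique_solution (he.star.congr_deriv fun t _ => ?_) he ha hab
  rw [errorField, errorField, star_sub, star_correction, star_cMat_mulVec]

end DissipativeLoop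

end ClosedLoop

end HarmonicControl

namespace HarmonicControl

/-! ### Signals whose sliding Fourier decomposition solves a differential equation -/

section SlidingDynamics

open Set

variable {T : ℝ}

/-- A signal that is almost everywhere constant on almost every window is almost everywhere
constant. -/
theorem ae_eq_const_of_windows {E : Type*} (hT : 0 < T) {u : ℝ → E} {t₀ : ℝ}
    (h : ∀ᵐ t, t₀ < t → ∃ c, ∀ᵐ τ, τ ∈ Ioc (t - T) t → u τ = c) :
    ∃ c, ∀ᵐ τ, t₀ - T < τ → u τ = c := by
  have hdense := Measure.dense_of_ae h
  -- Good window ends are dense. The index `j` advances by quarter periods, so that consecutive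
  -- windows overlap; `m` lets the end approach `t₀` from the right, which is needed to reach times
  -- just after `t₀ - T`.
  have hpick : ∀ j m : ℕ, ∃ t, t₀ + j * (T / 4) < t ∧ t < t₀ + j * (T / 4) + T / 4 / (m + 1) ∧
      ∃ c, ∀ᵐ τ, τ ∈ Ioc (t - T) t → u τ = c := fun j m => by
    have hpos : 0 < T / 4 / (m + 1) := by positivity
    obtain ⟨t, ht, h1, h2⟩ := hdense.exists_between
      (show t₀ + j * (T / 4) < t₀ + j * (T / 4) + T / 4 / (m + 1) by linarith)
    have h3 : 0 ≤ j * (T / 4) := by positivity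
    exact ⟨t, h1, h2, ht (by linarith)⟩
  choose t ht1 ht2 c hc using hpick
  -- Windows whose ends are less than `T` apart overlap in an interval of positive length, which
  -- forces equal constants.
  have hglue : ∀ j m j' m', |t j m - t j' m'| < T → c j m = c j' m' := by
    intro j m j' m' hlt
    have h1 := abs_lt.1 hlt
    obtain ⟨τ, ⟨hτ1, hτ2⟩, h2, h3⟩ := (Measure.dense_of_ae ((hc j m).and (hc j' m'))).exists_between
      (show max (t j m) (t j' m') - T < min (t j m) (t j' m') by
        rw [sub_lt_iff_lt_add]
        refine max_lt ?_ ?_ <;> rw [← sub_lt_iff_lt_add] <;> refine lt_min ?_ ?_ <;> linarith)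
    have h4 := le_max_left (t j m) (t j' m')
    have h5 := le_max_right (t j m) (t j' m')
    have h6 := min_le_left (t j m) (t j' m')
    have h7 := min_le_right (t j m) (t j' m')
    rw [← hτ1 ⟨by linarith, by linarith⟩, ← hτ2 ⟨by linarith, by linarith⟩]
  have hm : ∀ m : ℕ, T / 4 / (m + 1) ≤ T / 4 := fun m =>
    div_le_self (by positivity) (by linarith [Nat.cast_nonneg (α := ℝ) m])
  have hall : ∀ j m, c j m = c 0 0 := by
    intro j
    induction j with
    | zero =>
      intro m
      refine hglue _ _ _ _ (abs_lt.2 ?_)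
      have := ht1 0 m; have := ht2 0 m; have := ht1 0 0; have := ht2 0 0
      have := hm m; have := hm 0
      constructor <;> linarith
    | succ j ih =>
      intro m
      rw [← ih 0]
      refine hglue _ _ _ _ (abs_lt.2 ?_)
      have h1 := ht1 (j + 1) m
      have h2 := ht2 (j + 1) m
      have := ht1 j 0; have := ht2 j 0
      have := hm m; have := hm 0
      push_cast at h1 h2
      constructor <;> linarith
  refine ⟨c 0 0, ?_⟩
  filter_upwards [ae_all_iff.2 fun j => ae_all_iff.2 fun m => hc j m] with τ hτ hτ0
  have hex : ∃ j m, τ ∈ Ioc (t j m - T) (t j m) := by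
    rcases le_or_gt τ t₀ with hle | hgt
    · obtain ⟨m, hm⟩ := exists_nat_gt (T / 4 / (τ - (t₀ - T)))
      refine ⟨0, m, ?_, ?_⟩
      · have h1 := ht2 0 m
        have h2 : T / 4 / (m + 1) < τ - (t₀ - T) := by
          rw [div_lt_iff₀ (by linarith)] at hm
          rw [div_lt_iff₀ (by positivity)]
          nlinarith
        rw [Nat.cast_zero, zero_mul, add_zero] at h1
        linarith
      · have h1 := ht1 0 m
        rw [Nat.cast_zero, zero_mul, add_zero] at h1
        linarith
    · refine ⟨⌈(τ - t₀) / (T / 4)⌉₊, 0, ?_, ?_⟩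
      · have h1 := Nat.ceil_lt_add_one (show 0 ≤ (τ - t₀) / (T / 4) from
          div_nonneg (by linarith) (by linarith))
        have h2 := ht2 ⌈(τ - t₀) / (T / 4)⌉₊ 0
        have h3 := hm 0
        have h4 : (⌈(τ - t₀) / (T / 4)⌉₊ : ℝ) * (T / 4) < τ - t₀ + T / 4 := by
          calc (⌈(τ - t₀) / (T / 4)⌉₊ : ℝ) * (T / 4)
              < ((τ - t₀) / (T / 4) + 1) * (T / 4) := by gcongr
            _ = _ := by field_simp
        linarith
      · have h1 := Nat.le_ceil ((τ - t₀) / (T / 4))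
        rw [div_le_iff₀ (by linarith)] at h1
        have h2 := ht1 ⌈(τ - t₀) / (T / 4)⌉₊ 0
        linarith
  obtain ⟨j, m, hjm⟩ := hex
  rw [hτ j m hjm, hall]

theorem ae_hasDerivAt_of_Ici {u u' : ℝ → ℂ} {a : ℝ} (h : IsPrimitiveOn (Ici a) u u') :
    ∀ᵐ t, a ≤ t → HasDerivAt u (u' t) t := by
  have h1 : ∀ n : ℕ, ∀ᵐ t, t ∈ uIcc a (a + n) → HasDerivAt u (u' t) t := fun n =>
    h.ae_hasDerivAt self_mem_Ici (by simp)
  filter_upwards [ae_all_iff.2 h1] with t ht hat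
  obtain ⟨n, hn⟩ := exists_nat_gt (t - a)
  refine ht n ?_
  rw [uIcc_of_le (by simp)]
  exact ⟨hat, by linarith⟩

/-- The phasors of a locally integrable signal are differentiable almost everywhere. -/
theorem ae_hasDerivAt_phasor (hT : 0 < T) {f : ℝ → ℂ} {t₀ : ℝ}
    (hf : ∀ b, IntegrableOn f (Icc (t₀ - T) b)) (k : ℤ) :
    ∀ᵐ t, t₀ < t → HasDerivAt (fun r => phasor T f r k)
      ((1 / (T : ℂ)) * ((f t - f (t - T)) * expo T k t)) t := by
  have hi : ∀ b ∈ Ici (t₀ - T), IntervalIntegrable (fun τ => f τ * expo T k τ) volume (t₀ - T) b :=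
    fun b hb => intervalIntegrable_mul_expo
      ((intervalIntegrable_iff_integrableOn_Icc_of_le hb).2 (hf b)) k
  have hF : IsPrimitiveOn (Ici (t₀ - T))
      (fun t => 0 + ∫ τ in (t₀ - T)..t, f τ * expo T k τ) fun τ => f τ * expo T k τ :=
    IsPrimitiveOn.of_integral hi 0
  have h1 := ae_hasDerivAt_of_Ici hF
  have h2 : ∀ᵐ t : ℝ, t₀ - T ≤ t - T → HasDerivAt
      (fun t => 0 + ∫ τ in (t₀ - T)..t, f τ * expo T k τ) (f (t - T) * expo T k (t - T)) (t - T) :=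
    (measurePreserving_sub_right volume T).quasiMeasurePreserving.ae h1
  filter_upwards [h1, h2] with t ht1 ht2 hlt
  -- The sliding integral is a primitive at `t` minus the same primitive at `t - T`; the exponential
  -- factors coincide by periodicity.
  have h3 := (ht1 (by linarith)).sub ((ht2 (by linarith)).comp_sub_const t T)
  have h4 := h3.const_mul (1 / (T : ℂ))
  have h5 : expo T k (t - T) = expo T k t := (expo_periodic hT.ne' k).sub_eq t
  rw [h5, ← sub_mul] at h4
  refine h4.congr_of_eventuallyEq ?_
  filter_upwards [Ioi_mem_nhds hlt] with r hr
  have hr' : t₀ < r := hr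
  rw [phasor_def]
  simp only [Pi.sub_apply, zero_add]
  rw [intervalIntegral.integral_interval_sub_left (hi r (by simp only [mem_Ici]; linarith))
    (hi (r - T) (by simp only [mem_Ici]; linarith))]

/-- If the sliding Fourier decomposition of `f` solves `ḟ_k = y_k - jωk f_k`, then `f` is almost
everywhere an indefinite integral of `y`. -/
theorem exists_primitive_of_phasor (hT : 0 < T) {f y : ℝ → ℂ} {t₀ : ℝ}
    (hf : ∀ b, MemLp f 2 (volume.restrict (Icc (t₀ - T) b)))
    (hy : ∀ b, IntegrableOn y (Icc (t₀ - T) b))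
    (h : ∀ᵐ t, t₀ < t → ∀ k : ℤ, HasDerivAt (fun r => phasor T f r k)
      (phasor T y t k - Complex.I * ((2 * Real.pi / T : ℝ) : ℂ) * (k : ℂ) * phasor T f t k) t) :
    ∃ u, IsPrimitiveOn (Ici (t₀ - T)) u y ∧ ∀ᵐ τ, t₀ - T < τ → f τ = u τ := by
  have hfi : ∀ b, IntegrableOn f (Icc (t₀ - T) b) := fun b => (hf b).integrable (by norm_num)
  have hyi : ∀ a ∈ Ici (t₀ - T), ∀ b ∈ Ici (t₀ - T), IntervalIntegrable y volume a b := by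
    have h0 : ∀ b ∈ Ici (t₀ - T), IntervalIntegrable y volume (t₀ - T) b := fun b hb =>
      (intervalIntegrable_iff_integrableOn_Icc_of_le hb).2 (hy b)
    exact fun a ha b hb => (h0 a ha).symm.trans (h0 b hb)
  have hwin : ∀ᵐ t, t₀ < t → ∃ c, ∀ᵐ τ, τ ∈ Ioc (t - T) t →
      f τ - ∫ r in (t₀ - T)..τ, y r = c := by
    filter_upwards [h, ae_all_iff.2 fun k => ae_hasDerivAt_phasor hT hfi k] with t ht1 ht2 hlt
    have hmem1 : t - T ∈ Ici (t₀ - T) := by simp only [mem_Ici]; linarith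
    have hmem2 : t ∈ Ici (t₀ - T) := by simp only [mem_Ici]; linarith
    have hfw : WindowL2 T t f := (hf t).mono_measure (Measure.restrict_mono
      (show Ioc (t - T) t ⊆ Icc (t₀ - T) t from fun τ hτ => ⟨by linarith [hτ.1], hτ.2⟩) le_rfl)
    -- At almost every `t` the phasor derivative is known twice: from the equation and as the jump
    -- `f t - f (t - T)`. Equating them is the integration-by-parts identity with `d` equal to that
    -- jump.
    obtain ⟨-, c, hc⟩ := exists_ae_eq_add_integral hT hfw (hyi _ hmem1 _ hmem2)
      (d := f t - f (t - T)) fun k => by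
        have := (ht1 hlt k).unique (ht2 k hlt)
        linear_combination this
    refine ⟨c - ∫ r in (t₀ - T)..(t - T), y r, ?_⟩
    filter_upwards [hc] with τ hτ hmem
    have hmem3 : τ ∈ Ici (t₀ - T) := by simp only [mem_Ici]; linarith [hmem.1]
    rw [hτ hmem, ← intervalIntegral.integral_add_adjacent_intervals
      (hyi _ self_mem_Ici _ hmem1) (hyi _ hmem1 _ hmem3)]
    ring
  obtain ⟨c, hc⟩ := ae_eq_const_of_windows hT hwin
  refine ⟨fun τ => c + ∫ r in (t₀ - T)..τ, y r,
    IsPrimitiveOn.of_integral (fun b hb => hyi _ self_mem_Ici b hb) c, ?_⟩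
  filter_upwards [hc] with τ hτ hlt
  rw [← hτ hlt]
  ring

end SlidingDynamics

end HarmonicControl

namespace HarmonicControl

/-! ### The harmonic feedback in the time domain -/

section HarmonicFeedback

open Set Matrix

variable {n m : ℕ} {T : ℝ} {σ : BilinearData n m}

namespace BilinearData

/-- The right-hand side of the bilinear affine system, for a complex state and control. -/
noncomputable def cField (σ : BilinearData n m) (s : ℂ) (w : Fin m → ℝ) (x : Fin n → ℂ) :
    Fin n → ℂ :=
  (cMat σ.Aind + s • cMat σ.Adep) *ᵥ x + (cMat σ.Bind + s • cMat σ.Bdep) *ᵥ cVec w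

/-- The vector `A_dep x + B_dep w`, for a complex state. -/
noncomputable def cGain (σ : BilinearData n m) (w : Fin m → ℝ) (x : Fin n → ℂ) : Fin n → ℂ :=
  cMat σ.Adep *ᵥ x + cMat σ.Bdep *ᵥ cVec w

/-- The time-domain state feedback, for a complex state. -/
noncomputable def cFeedback (σ : BilinearData n m) (w : ℝ → Fin m → ℝ) (γ : ℝ → ℝ)
    (P : ℝ → Matrix (Fin n) (Fin n) ℝ) (se : ℝ → ℝ) (xe : ℝ → Fin n → ℝ) (t : ℝ)
    (x : Fin n → ℂ) : ℂ :=
  se t - γ t * (star (σ.cGain (w t) x) ⬝ᵥ cMat (P t) *ᵥ (x - cVec (xe t)))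

theorem cField_ofReal (s : ℝ) (w : Fin m → ℝ) (x : Fin n → ℝ) :
    σ.cField s w (cVec x) = cVec (σ.field s w x) := by
  have h : ∀ u v : Fin n → ℝ, cVec (u + v) = cVec u + cVec v := fun u v => by
    ext i
    simp [cVec]
  rw [cField, field, h, cVec_mulVec, cVec_mulVec, cMat_add, cMat_add, cMat_smul, cMat_smul]

theorem cGain_eq_gainVec (w : Fin m → ℝ) (x : Fin n → ℂ) (xe : Fin n → ℝ) :
    σ.cGain w x = gainVec σ.Adep (σ.Adep *ᵥ xe + σ.Bdep *ᵥ w) (x - cVec xe) := by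
  have h : ∀ u v : Fin n → ℝ, cVec (u + v) = cVec u + cVec v := fun u v => by
    ext i
    simp [cVec]
  rw [gainVec, cGain, h, cVec_mulVec, cVec_mulVec, Matrix.mulVec_sub]
  abel

/-- The error of the closed loop solves the error system. -/
theorem cField_cFeedback_sub (w : ℝ → Fin m → ℝ) (γ : ℝ → ℝ)
    (P : ℝ → Matrix (Fin n) (Fin n) ℝ) (se : ℝ → ℝ) (xe : ℝ → Fin n → ℝ) (t : ℝ)
    (x : Fin n → ℂ) :
    σ.cField (σ.cFeedback w γ P se xe t x) (w t) x - cVec (σ.field (se t) (w t) (xe t)) =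
      errorField (fun t => σ.Aind + se t • σ.Adep) P σ.Adep γ
        (fun t => σ.Adep *ᵥ xe t + σ.Bdep *ᵥ w t) t (x - cVec (xe t)) := by
  rw [← cField_ofReal, errorField, correction, ← cGain_eq_gainVec, cFeedback]
  set z := (γ t : ℂ) * (star (σ.cGain (w t) x) ⬝ᵥ cMat (P t) *ᵥ (x - cVec (xe t)))
  simp only [cField, cGain, cMat_add, cMat_smul, Matrix.add_mulVec, Matrix.smul_mulVec,
    Matrix.mulVec_sub, Matrix.sub_mulVec, sub_smul, smul_add]
  abel

/-- The harmonic field is the decomposition of the time-domain field. -/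
theorem harmonicField_eq (hT : 0 < T) {w : ℝ → Fin m → ℝ} {W : ℤ → Fin m → ℂ} {t : ℝ}
    (hw : VecL2 T t fun τ => cVec (w τ)) (hW : W = slidingFourier T (fun τ => cVec (w τ)) t)
    {s : ℝ → ℂ} (hs : WindowL2 T t s) {S : Ell2 Unit}
    (hS : S.coords = slidingFourier T (fun τ _ => s τ) t) {x : ℝ → Fin n → ℂ} (hx : VecL2 T t x)
    {X : Ell2 (Fin n)} (hX : X.coords = slidingFourier T x t) (k : ℤ) (i : Fin n) :
    σ.harmonicField T W S X k i = phasor T (fun τ => σ.cField (s τ) (w τ) (x τ) i) t k -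
      Complex.I * ((2 * Real.pi / T : ℝ) : ℂ) * (k : ℂ) * phasor T (fun τ => x τ i) t k := by
  have hA : MatL2 T t fun τ => cMat σ.Aind + s τ • cMat σ.Adep := fun i j =>
    (memLp_const (cMat σ.Aind i j)).add (hs.mul_const (cMat σ.Adep i j))
  have hB : MatL2 T t fun τ => cMat σ.Bind + s τ • cMat σ.Bdep := fun i j =>
    (memLp_const (cMat σ.Bind i j)).add (hs.mul_const (cMat σ.Bdep i j))
  have h1 : X k i = phasor T (fun τ => x τ i) t k := congrFun (congrFun hX k) i
  rw [harmonicField, calA_eq_toeplitz σ hT hs hS, calB_eq_toeplitz σ hT hs hS, hX, hW,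
    toeplitz_act hT hA hx, toeplitz_act hT hB hw, h1]
  have h2 := phasor_add (intervalIntegrable_mulVec hT.le hA hx i)
    (intervalIntegrable_mulVec hT.le hB hw i) k
  have h3 : phasor T (fun τ => σ.cField (s τ) (w τ) (x τ) i) t k = _ := h2
  rw [h3, slidingFourier_apply, slidingFourier_apply]
  ring

theorem calG_eq (hT : 0 < T) {w : ℝ → Fin m → ℝ} {W : ℤ → Fin m → ℂ} {t : ℝ}
    (hw : VecL2 T t fun τ => cVec (w τ)) (hW : W = slidingFourier T (fun τ => cVec (w τ)) t)
    {x : ℝ → Fin n → ℂ} (hx : VecL2 T t x)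
    {X : Ell2 (Fin n)} (hX : X.coords = slidingFourier T x t) :
    σ.calG T W X = toeplitzOfSeq fun p => Matrix.replicateCol Unit
      (slidingFourier T (fun τ => σ.cGain (w τ) (x τ)) t p) := by
  funext k l
  have hc : ∀ {κ : Type} (M : Matrix (Fin n) κ ℂ),
      toeplitz T (fun _ => M) 0 = toeplitz T (fun _ => M) t := fun M =>
    toeplitz_eq_of_periodic hT.ne' (fun _ => rfl) 0 t
  have h1 := VecL2.mulVec_of_const (cMat σ.Adep) hx
  have h2 := VecL2.mulVec_of_const (cMat σ.Bdep) hw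
  rw [calG, hX, hW, hc, hc, toeplitz_mul_col hT (MatL2.const T t _) hx,
    toeplitz_mul_col hT (MatL2.const T t _) hw]
  have h3 : slidingFourier T (fun τ => σ.cGain (w τ) (x τ)) t = _ :=
    slidingFourier_add (fun i => (h1 i).intervalIntegrable hT.le)
      (fun i => (h2 i).intervalIntegrable hT.le)
  rw [h3]
  rfl

end BilinearData

/-- Conjugating a signal reverses the sign of the index, which matches the exchange of `k` and `l`
in the adjoint. -/
theorem adj_toeplitz_col {ι : Type} (g : ℝ → ι → ℂ) (t : ℝ) :
    (toeplitzOfSeq fun p => Matrix.replicateCol Unit (slidingFourier T g t p)).adj =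
      toeplitz T (fun τ => Matrix.replicateRow Unit (star (g τ))) t := by
  funext k l
  ext u i
  have h := phasor_conj (T := T) (fun τ => g τ i) t (k - l)
  rw [neg_sub] at h
  exact h.symm

/-- Standing assumptions on the equilibrium and on the Lyapunov function. -/
structure LoopSetup (σ : BilinearData n m) (T : ℝ) (w : ℝ → Fin m → ℝ) (W : ℤ → Fin m → ℂ)
    (se : ℝ → ℝ) (Se : Ell2 Unit) (xe : ℝ → Fin n → ℝ) (Xe : Ell2 (Fin n)) (γ : ℝ → ℝ)
    (P Q : ℝ → Matrix (Fin n) (Fin n) ℝ) (calP : Ell2 (Fin n) →L[ℂ] Ell2 (Fin n)) : Prop where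
  period_pos : 0 < T
  perw : Function.Periodic w T
  memw : ∀ i a b, MemLp (fun t => w t i) 2 (volume.restrict (Icc a b))
  W_eq : W = slidingFourier T (fun τ => cVec (w τ)) 0
  perse : Function.Periodic se T
  memse : ∀ a b, MemLp se 2 (volume.restrict (Icc a b))
  Se_eq : Se.coords = slidingFourier T (fun τ _ => (se τ : ℂ)) 0
  perxe : Function.Periodic xe T
  primxe : VecPrimOn univ xe fun t => σ.field (se t) (w t) (xe t)
  Xe_eq : Xe.coords = slidingFourier T (fun τ => cVec (xe τ)) 0
  perγ : Function.Periodic γ T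
  perP : Function.Periodic P T
  calP_eq : ∀ (X : Ell2 (Fin n)) (x : ℝ → Fin n → ℂ), VecL2 T 0 x →
    X.coords = slidingFourier T x 0 →
      (calP X).coords = slidingFourier T (fun τ => cMat (P τ) *ᵥ x τ) 0
  loop : DissipativeLoop T (fun t => σ.Aind + se t • σ.Adep) P Q γ
    fun t => σ.Adep *ᵥ xe t + σ.Bdep *ᵥ w t

namespace LoopSetup

variable {w : ℝ → Fin m → ℝ} {W : ℤ → Fin m → ℂ} {se : ℝ → ℝ} {Se : Ell2 Unit}
  {xe : ℝ → Fin n → ℝ} {Xe : Ell2 (Fin n)} {γ : ℝ → ℝ} {P Q : ℝ → Matrix (Fin n) (Fin n) ℝ}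
  {calP : Ell2 (Fin n) →L[ℂ] Ell2 (Fin n)}

theorem vecL2_w (h : LoopSetup σ T w W se Se xe Xe γ P Q calP) (L t : ℝ) :
    VecL2 L t fun τ => cVec (w τ) := fun i =>
  ((h.memw i (t - L) t).mono_measure (Measure.restrict_mono Ioc_subset_Icc_self le_rfl)).ofReal

theorem windowL2_se (h : LoopSetup σ T w W se Se xe Xe γ P Q calP) (L t : ℝ) :
    WindowL2 L t fun τ => (se τ : ℂ) :=
  ((h.memse (t - L) t).mono_measure (Measure.restrict_mono Ioc_subset_Icc_self le_rfl)).ofReal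

theorem continuous_cxe (h : LoopSetup σ T w W se Se xe Xe γ P Q calP) :
    Continuous fun t => cVec (xe t) :=
  continuous_pi fun i => (h.primxe.cVec i).continuous

theorem vecL2_xe (h : LoopSetup σ T w W se Se xe Xe γ P Q calP) (t : ℝ) :
    VecL2 T t fun τ => cVec (xe τ) := fun i =>
  WindowL2.of_continuousOn ((h.primxe.cVec i).continuous.continuousOn)

theorem W_eq_window (h : LoopSetup σ T w W se Se xe Xe γ P Q calP) (t : ℝ) :
    W = slidingFourier T (fun τ => cVec (w τ)) t := by
  rw [h.W_eq]
  exact slidingFourier_eq_of_periodic h.period_pos.ne' (fun τ => by simp only [h.perw τ]) 0 t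

theorem Se_eq_window (h : LoopSetup σ T w W se Se xe Xe γ P Q calP) (t : ℝ) :
    Se.coords = slidingFourier T (fun τ _ => (se τ : ℂ)) t := by
  rw [h.Se_eq]
  exact slidingFourier_eq_of_periodic h.period_pos.ne' (fun τ => by simp only [h.perse τ]) 0 t

theorem Xe_eq_window (h : LoopSetup σ T w W se Se xe Xe γ P Q calP) (t : ℝ) :
    Xe.coords = slidingFourier T (fun τ => cVec (xe τ)) t := by
  rw [h.Xe_eq]
  exact slidingFourier_eq_of_periodic h.period_pos.ne' (fun τ => by simp only [h.perxe τ]) 0 t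

/-- The operator is known through the window ending at `0`. A periodic representative of `X` carries
the formula to the window ending at `t`, where it agrees almost everywhere with the signal `x`,
periodic or not. -/
theorem calP_eq_window (h : LoopSetup σ T w W se Se xe Xe γ P Q calP) {X : Ell2 (Fin n)}
    {x : ℝ → Fin n → ℂ} {t : ℝ} (hx : VecL2 T t x) (hX : X.coords = slidingFourier T x t) :
    (calP X).coords = slidingFourier T (fun τ => cMat (P τ) *ᵥ x τ) t := by
  obtain ⟨y, hyper, hy, hY⟩ := exists_signal h.period_pos X
  rw [h.calP_eq X y (hy 0) (hY 0), slidingFourier_eq_of_periodic h.period_pos.ne'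
    (fun τ => by simp only [h.perP τ, hyper τ]) 0 t]
  refine slidingFourier_congr_ae h.period_pos.le ?_
  filter_upwards [ae_eq_of_slidingFourier_eq h.period_pos (hy t) hx ((hY t).symm.trans hX)]
    with τ hτ hm
  rw [hτ hm]

theorem error_eq_window (h : LoopSetup σ T w W se Se xe Xe γ P Q calP) {X : Ell2 (Fin n)}
    {x : ℝ → Fin n → ℂ} {t : ℝ} (hx : VecL2 T t x) (hX : X.coords = slidingFourier T x t) :
    (X - Xe).coords = slidingFourier T (fun τ => x τ - cVec (xe τ)) t := by
  rw [slidingFourier_sub (fun i => (hx i).intervalIntegrable h.period_pos.le)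
    (fun i => (h.vecL2_xe t i).intervalIntegrable h.period_pos.le), Ell2.coords_sub, hX,
    h.Xe_eq_window t]

theorem vecL2_cGain (h : LoopSetup σ T w W se Se xe Xe γ P Q calP) {x : ℝ → Fin n → ℂ} {L t : ℝ}
    (hx : VecL2 L t x) : VecL2 L t fun τ => σ.cGain (w τ) (x τ) := fun i =>
  (VecL2.mulVec_of_const (cMat σ.Adep) hx i).add
    (VecL2.mulVec_of_const (cMat σ.Bdep) (h.vecL2_w L t) i)

theorem continuousOn_P_error (h : LoopSetup σ T w W se Se xe Xe γ P Q calP)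
    {x : ℝ → Fin n → ℂ} {s : Set ℝ} (hx : ContinuousOn x s) (i : Fin n) :
    ContinuousOn (fun τ => (cMat (P τ) *ᵥ (x τ - cVec (xe τ))) i) s := by
  change ContinuousOn (fun τ => ∑ j, cMat (P τ) i j * (x τ - cVec (xe τ)) j) s
  refine continuousOn_finsetSum _ fun j _ => ?_
  refine ((h.loop.primP.cMat i j).continuous.continuousOn).mul ?_
  exact (continuous_apply j).comp_continuousOn (hx.sub h.continuous_cxe.continuousOn)

/-- The gain is only square integrable, through `w`, so continuity of `x` is what keeps its product
with `P (x - x^e)` in `L²`. -/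
theorem windowL2_gain_error (h : LoopSetup σ T w W se Se xe Xe γ P Q calP)
    {x : ℝ → Fin n → ℂ} {L t : ℝ} (hx : ContinuousOn x (Icc (t - L) t)) :
    WindowL2 L t fun τ => star (σ.cGain (w τ) (x τ)) ⬝ᵥ cMat (P τ) *ᵥ (x τ - cVec (xe τ)) := by
  have hxL : VecL2 L t x := fun i =>
    WindowL2.of_continuousOn ((continuous_apply i).comp_continuousOn hx)
  refine memLp_finsetSum _ fun i _ => ?_
  have h1 := ((h.vecL2_cGain hxL i).star).mul_continuousOn (h.continuousOn_P_error hx i)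
  exact h1.ae_eq (ae_of_all _ fun τ => mul_comm _ _)

theorem windowL2_cFeedback (h : LoopSetup σ T w W se Se xe Xe γ P Q calP)
    {x : ℝ → Fin n → ℂ} {L t : ℝ} (hx : ContinuousOn x (Icc (t - L) t)) :
    WindowL2 L t fun τ => σ.cFeedback w γ P se xe τ (x τ) :=
  (h.windowL2_se L t).sub (WindowL2.ofReal_of_bounded h.loop.memγ (h.windowL2_gain_error hx))

/-- The harmonic feedback is the decomposition of the time-domain feedback. -/
theorem harmonicFeedback_eq (h : LoopSetup σ T w W se Se xe Xe γ P Q calP)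
    {x : ℝ → Fin n → ℂ} {t : ℝ} (hx : ContinuousOn x (Icc (t - T) t)) {X : Ell2 (Fin n)}
    (hX : X.coords = slidingFourier T x t) :
    σ.harmonicFeedback T W (toeplitz T (fun τ => scalarMat (γ τ : ℂ)) 0) calP Se Xe X =
      slidingFourier T (fun τ _ => σ.cFeedback w γ P se xe τ (x τ)) t := by
  have hT := h.period_pos
  have hxL : VecL2 T t x := fun i =>
    WindowL2.of_continuousOn ((continuous_apply i).comp_continuousOn hx)
  have hPe : VecL2 T t fun τ => cMat (P τ) *ᵥ (x τ - cVec (xe τ)) := fun i =>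
    WindowL2.of_continuousOn (h.continuousOn_P_error hx i)
  have heL : VecL2 T t fun τ => x τ - cVec (xe τ) := fun i => (hxL i).sub (h.vecL2_xe t i)
  have hz := h.windowL2_gain_error hx
  have hgz := WindowL2.ofReal_of_bounded h.loop.memγ hz
  have hrow : MatL2 T t fun τ => Matrix.replicateRow Unit (star (σ.cGain (w τ) (x τ))) :=
    fun _ i => (h.vecL2_cGain hxL i).star
  have hγL : MatL2 T t fun τ => scalarMat (γ τ : ℂ) := fun _ _ => by
    have := WindowL2.ofReal_of_bounded (T := T) (t := t) (g := fun _ => 1) h.loop.memγ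
      (memLp_const 1)
    simp only [mul_one] at this
    exact this
  have h1 : (σ.calG T W X).adj.act (calP (X - Xe)).coords = slidingFourier T (fun τ _ =>
      star (σ.cGain (w τ) (x τ)) ⬝ᵥ cMat (P τ) *ᵥ (x τ - cVec (xe τ))) t := by
    rw [BilinearData.calG_eq hT (h.vecL2_w T t) (h.W_eq_window t) hxL hX, adj_toeplitz_col,
      h.calP_eq_window heL (h.error_eq_window hxL hX), toeplitz_act hT hrow hPe]
    rfl
  have h2 : (toeplitz T (fun τ => scalarMat (γ τ : ℂ)) 0).act (slidingFourier T (fun τ _ =>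
      star (σ.cGain (w τ) (x τ)) ⬝ᵥ cMat (P τ) *ᵥ (x τ - cVec (xe τ))) t) =
      slidingFourier T (fun τ _ => (γ τ : ℂ) *
        (star (σ.cGain (w τ) (x τ)) ⬝ᵥ cMat (P τ) *ᵥ (x τ - cVec (xe τ)))) t := by
    rw [toeplitz_eq_of_periodic hT.ne' (fun τ => by simp only [h.perγ τ]) 0 t,
      toeplitz_act hT hγL (fun _ => hz)]
    congr 1
    funext τ u
    simp [scalarMat, Matrix.mulVec, dotProduct]
  have h3 := slidingFourier_sub (T := T) (ι := Unit)
    (fun _ => (h.windowL2_se T t).intervalIntegrable hT.le) (fun _ => hgz.intervalIntegrable hT.le)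
  funext k u
  rw [BilinearData.harmonicFeedback, h1, h2]
  refine Eq.trans ?_ (congrFun (congrFun h3 k) u).symm
  have h4 := congrFun (congrFun (h.Se_eq_window t) k) u
  exact congrArg₂ (· - ·) h4 rfl

end LoopSetup

end HarmonicFeedback

end HarmonicControl

namespace HarmonicControl

/-! ### Trajectories of the harmonic closed loop -/

section HarmonicTrajectory

open Set Matrix

variable {n m : ℕ} {T : ℝ} {σ : BilinearData n m}

theorem memLp_Icc_of_windowL2 {f : ℝ → ℂ} {a b : ℝ} (hf : WindowL2 (b - a) b f) :
    MemLp f 2 (volume.restrict (Icc a b)) := by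
  rw [WindowL2, sub_sub_cancel] at hf
  rwa [Measure.restrict_congr_set Ioc_ae_eq_Icc] at hf

theorem Icc_window_subset {t₀ t : ℝ} (ht : t₀ ≤ t) : Icc (t - T) t ⊆ Ici (t₀ - T) :=
  fun τ hτ => by
    simp only [mem_Ici]
    linarith [hτ.1]

theorem windowL2_of_memLp_Icc {f : ℝ → ℂ} {t₀ t : ℝ}
    (hf : ∀ b, MemLp f 2 (volume.restrict (Icc (t₀ - T) b))) (ht : t₀ ≤ t) : WindowL2 T t f :=
  (hf t).mono_measure (Measure.restrict_mono
    (show Ioc (t - T) t ⊆ Icc (t₀ - T) t from fun τ hτ => ⟨by linarith [hτ.1], hτ.2⟩) le_rfl)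

theorem integrableOn_cField {w : ℝ → Fin m → ℝ} {s : ℝ → ℂ} {x : ℝ → Fin n → ℂ} {S : Set ℝ}
    [IsFiniteMeasure (volume.restrict S)]
    (hw : ∀ i, MemLp (fun t => w t i) 2 (volume.restrict S)) (hs : MemLp s 2 (volume.restrict S))
    (hx : ∀ i, MemLp (fun t => x t i) 2 (volume.restrict S)) (i : Fin n) :
    IntegrableOn (fun t => σ.cField (s t) (w t) (x t) i) S := by
  have h1 : IntegrableOn (fun t => ∑ j, (cMat σ.Aind i j + s t * cMat σ.Adep i j) * x t j) S :=
    integrable_finsetSum _ fun j _ => MemLp.integrable_mul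
      ((memLp_const (cMat σ.Aind i j)).add (hs.mul_const (cMat σ.Adep i j))) (hx j)
  have h2 : IntegrableOn
      (fun t => ∑ j, (cMat σ.Bind i j + s t * cMat σ.Bdep i j) * (w t j : ℂ)) S :=
    integrable_finsetSum _ fun j _ => MemLp.integrable_mul
      ((memLp_const (cMat σ.Bind i j)).add (hs.mul_const (cMat σ.Bdep i j))) (hw j).ofReal
  exact h1.add h2

namespace LoopSetup

variable {w : ℝ → Fin m → ℝ} {W : ℤ → Fin m → ℂ} {se : ℝ → ℝ} {Se : Ell2 Unit}
  {xe : ℝ → Fin n → ℝ} {Xe : Ell2 (Fin n)} {γ : ℝ → ℝ} {P Q : ℝ → Matrix (Fin n) (Fin n) ℝ}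
  {calP : Ell2 (Fin n) →L[ℂ] Ell2 (Fin n)}

/-- The state signal of a harmonic closed-loop trajectory has a continuous representative, whose
error solves the error system. -/
theorem exists_error_of_trajectory (h : LoopSetup σ T w W se Se xe Xe γ P Q calP) {t₀ : ℝ}
    {x : ℝ → Fin n → ℂ} {s : ℝ → ℂ} {X : ℝ → Ell2 (Fin n)} {S : ℝ → Ell2 Unit}
    (ht : σ.IsHarmonicTrajectory T W (σ.harmonicFeedback T W
      (toeplitz T (fun τ => scalarMat (γ τ : ℂ)) 0) calP Se Xe) t₀ x s X S) :
    ∃ e : ℝ → Fin n → ℂ, VecPrimOn (Ici (t₀ - T)) e (fun t =>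
      errorField (fun t => σ.Aind + se t • σ.Adep) P σ.Adep γ
        (fun t => σ.Adep *ᵥ xe t + σ.Bdep *ᵥ w t) t (e t)) ∧
      ∀ t, t₀ ≤ t → (X t - Xe).coords = slidingFourier T e t := by
  have hT := h.period_pos
  have hxm : ∀ i b, MemLp (fun t => x t i) 2 (volume.restrict (Icc (t₀ - T) b)) := fun i b =>
    (ht.memLp_state b).eval i
  have hxL : ∀ t, t₀ ≤ t → VecL2 T t x := fun t htt i => windowL2_of_memLp_Icc (hxm i) htt
  have hsL : ∀ t, t₀ ≤ t → WindowL2 T t s := fun t htt => windowL2_of_memLp_Icc ht.memLp_control htt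
  have hprim : ∀ i, ∃ u, IsPrimitiveOn (Ici (t₀ - T)) u
      (fun t => σ.cField (s t) (w t) (x t) i) ∧ ∀ᵐ τ, t₀ - T < τ → x τ i = u τ := by
    -- The harmonic equation is first solved with the given control signal: each coordinate of `x`
    -- has an absolutely continuous representative, before anything is known about `s`.
    intro i
    refine exists_primitive_of_phasor hT (hxm i) (fun b => integrableOn_cField
      (fun j => h.memw j _ _) (ht.memLp_control b) (fun j => hxm j b) i) ?_
    filter_upwards [ae_all_iff.2 ht.dynamics] with t hd hlt k
    have h1 := hasDerivAt_pi.1 (hd k hlt) i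
    rw [BilinearData.harmonicField_eq hT (h.vecL2_w T t) (h.W_eq_window t) (hsL t hlt.le)
      (ht.control_eq t hlt.le) (hxL t hlt.le) (ht.state_eq t hlt.le)] at h1
    refine h1.congr_of_eventuallyEq ?_
    filter_upwards [Ioi_mem_nhds hlt] with r hr
    exact (congrFun (congrFun (ht.state_eq r (le_of_lt hr)) k) i).symm
  choose u hu hxu using hprim
  set y : ℝ → Fin n → ℂ := fun t i => u i t with hy
  have hyp : VecPrimOn (Ici (t₀ - T)) y fun t => σ.cField (s t) (w t) (x t) := hu
  have hyc : ContinuousOn y (Ici (t₀ - T)) := continuousOn_pi.2 fun i => (hu i).continuousOn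
  have hxy : ∀ᵐ τ, t₀ - T < τ → x τ = y τ := by
    filter_upwards [ae_all_iff.2 hxu] with τ hτ hlt
    exact funext fun i => hτ i hlt
  have hXy : ∀ t, t₀ ≤ t → (X t).coords = slidingFourier T y t := fun t htt => by
    rw [ht.state_eq t htt]
    refine slidingFourier_congr_ae hT.le ?_
    filter_upwards [hxy] with τ hτ hm
    exact hτ (by linarith [hm.1])
  -- On each window equal coefficients give the time-domain law almost everywhere; the windows
  -- ending at `t₀ + jT` tile `(t₀ - T, ∞)`.
  have hsf : ∀ᵐ τ, t₀ - T < τ → s τ = σ.cFeedback w γ P se xe τ (y τ) := by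
    have h1 : ∀ j : ℕ, ∀ᵐ τ, τ ∈ Ioc (t₀ + j * T - T) (t₀ + j * T) →
        s τ = σ.cFeedback w γ P se xe τ (y τ) := fun j => by
      have hj : t₀ ≤ t₀ + j * T := by
        have : 0 ≤ j * T := by positivity
        linarith
      have hc := hyc.mono (Icc_window_subset (T := T) hj)
      have h2 := ae_eq_of_slidingFourier_eq hT (x := fun τ (_ : Unit) => s τ) (t := t₀ + j * T)
        (fun _ => hsL _ hj) (fun _ => h.windowL2_cFeedback hc)
        (((ht.control_eq _ hj).symm.trans (ht.feedback _ hj)).trans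
          (h.harmonicFeedback_eq hc (hXy _ hj)))
      filter_upwards [h2] with τ hτ hm
      exact congrFun (hτ hm) ()
    filter_upwards [ae_all_iff.2 h1] with τ hτ hlt
    have h0 : 0 ≤ (τ - (t₀ - T)) / T := div_nonneg (by linarith) hT.le
    -- The tiles are closed on the right, hence the ceiling minus one; the ceiling is positive since
    -- `τ > t₀ - T`.
    refine hτ (⌈(τ - (t₀ - T)) / T⌉₊ - 1) ?_
    have hpos : 0 < ⌈(τ - (t₀ - T)) / T⌉₊ := Nat.ceil_pos.2 (div_pos (by linarith) hT)
    have h2 := Nat.le_ceil ((τ - (t₀ - T)) / T)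
    have h3 := Nat.ceil_lt_add_one h0
    rw [div_le_iff₀ hT] at h2
    have h4 : (⌈(τ - (t₀ - T)) / T⌉₊ : ℝ) * T < τ - (t₀ - T) + T := by
      calc (⌈(τ - (t₀ - T)) / T⌉₊ : ℝ) * T < ((τ - (t₀ - T)) / T + 1) * T := by gcongr
        _ = _ := by field_simp
    rw [Nat.cast_sub hpos]
    push_cast
    constructor <;> linarith
  have hyp' : VecPrimOn (Ici (t₀ - T)) y fun t =>
      σ.cField (σ.cFeedback w γ P se xe t (y t)) (w t) (y t) := fun i => by
    refine (hyp i).congr (fun _ _ => rfl) ?_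
    have h1 : ∀ᵐ τ : ℝ, τ ≠ t₀ - T := by simp [ae_iff]
    filter_upwards [hxy, hsf, h1] with τ hτ1 hτ2 hne hm
    have hlt : t₀ - T < τ := lt_of_le_of_ne hm hne.symm
    rw [hτ1 hlt, hτ2 hlt]
  refine ⟨fun t => y t - cVec (xe t), fun i => ?_, fun t htt => ?_⟩
  · refine ((hyp' i).sub ((h.primxe.cVec i).mono (subset_univ _))).congr_deriv fun t _ => ?_
    exact congrFun (σ.cField_cFeedback_sub w γ P se xe t (y t)) i
  · exact h.error_eq_window (fun i => WindowL2.of_continuousOn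
      ((continuous_apply i).comp_continuousOn (hyc.mono (Icc_window_subset htt)))) (hXy t htt)

/-- Solutions of the error system give harmonic closed-loop trajectories. -/
theorem exists_trajectory_of_error (h : LoopSetup σ T w W se Se xe Xe γ P Q calP) {t₀ : ℝ}
    {e : ℝ → Fin n → ℂ} (he : VecPrimOn (Ici (t₀ - T)) e fun t =>
      errorField (fun t => σ.Aind + se t • σ.Adep) P σ.Adep γ
        (fun t => σ.Adep *ᵥ xe t + σ.Bdep *ᵥ w t) t (e t)) :
    ∃ s X S, σ.IsHarmonicTrajectory T W (σ.harmonicFeedback T W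
      (toeplitz T (fun τ => scalarMat (γ τ : ℂ)) 0) calP Se Xe) t₀
        (fun t => e t + cVec (xe t)) s X S := by
  have hT := h.period_pos
  set y : ℝ → Fin n → ℂ := fun t => e t + cVec (xe t) with hy
  set s : ℝ → ℂ := fun t => σ.cFeedback w γ P se xe t (y t) with hs
  have hyp : VecPrimOn (Ici (t₀ - T)) y fun t => σ.cField (s t) (w t) (y t) := fun i => by
    refine ((he i).add ((h.primxe.cVec i).mono (subset_univ _))).congr_deriv fun t _ => ?_
    have h1 := congrFun (σ.cField_cFeedback_sub w γ P se xe t (y t)) i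
    have h2 : y t - cVec (xe t) = e t := by simp [hy]
    rw [h2] at h1
    change errorField _ _ _ _ _ t (e t) i + _ = _
    rw [← h1, Pi.sub_apply, sub_add_cancel]
  have hyc : ContinuousOn y (Ici (t₀ - T)) := continuousOn_pi.2 fun i => (hyp i).continuousOn
  have hyL : ∀ t, t₀ ≤ t → VecL2 T t y := fun t htt i => WindowL2.of_continuousOn
    ((continuous_apply i).comp_continuousOn (hyc.mono (Icc_window_subset htt)))
  have hsL : ∀ t, t₀ ≤ t → WindowL2 T t s := fun t htt =>
    h.windowL2_cFeedback (hyc.mono (Icc_window_subset htt))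
  -- Before `t₀` the window leaves the domain of the solution; the value `0` there is irrelevant.
  have hX : ∀ t, ∃ X : Ell2 (Fin n), t₀ ≤ t → X.coords = slidingFourier T y t := fun t => by
    by_cases htt : t₀ ≤ t
    · exact ⟨ofSignal hT (hyL t htt), fun _ => coords_ofSignal hT (hyL t htt)⟩
    · exact ⟨0, fun h => absurd h htt⟩
  have hS : ∀ t, ∃ S : Ell2 Unit, t₀ ≤ t → S.coords = slidingFourier T (fun τ _ => s τ) t :=
    fun t => by
      by_cases htt : t₀ ≤ t
      · exact ⟨ofSignal hT (fun _ => hsL t htt), fun _ => coords_ofSignal hT (fun _ => hsL t htt)⟩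
      · exact ⟨0, fun h => absurd h htt⟩
  choose X hX using hX
  choose S hS using hS
  have hmono : ∀ b, Icc (b - (b - (t₀ - T))) b ⊆ Ici (t₀ - T) := fun b => by
    rw [sub_sub_cancel]
    exact Icc_subset_Ici_self
  have hym : ∀ i b, MemLp (fun t => y t i) 2 (volume.restrict (Icc (t₀ - T) b)) := fun i b =>
    memLp_Icc_of_windowL2 (WindowL2.of_continuousOn
      ((continuous_apply i).comp_continuousOn (hyc.mono (hmono b))))
  refine ⟨s, X, S, fun b => MemLp.of_eval fun i => hym i b, fun b =>
    memLp_Icc_of_windowL2 (h.windowL2_cFeedback (hyc.mono (hmono b))), hX, hS, fun k => ?_,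
    fun t htt => ?_⟩
  · have h1 : ∀ i, ∀ᵐ t, t₀ < t →
        HasDerivAt (fun r => phasor T (fun τ => y τ i) r k) _ t := fun i =>
      ae_hasDerivAt_phasor hT (fun b => (hym i b).integrable (by norm_num)) k
    filter_upwards [ae_all_iff.2 h1] with t h1 hlt
    refine hasDerivAt_pi.2 fun i => ?_
    rw [BilinearData.harmonicField_eq hT (h.vecL2_w T t) (h.W_eq_window t) (hsL t hlt.le)
      (hS t hlt.le) (hyL t hlt.le) (hX t hlt.le),
      phasor_deriv hT ((hyp i).mono (Icc_window_subset hlt.le)) k, add_sub_cancel_right]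
    refine (h1 i hlt).congr_of_eventuallyEq ?_
    filter_upwards [Ioi_mem_nhds hlt] with r hr
    exact congrFun (congrFun (hX r (le_of_lt hr)) k) i
  · rw [hS t htt, h.harmonicFeedback_eq (hyc.mono (Icc_window_subset htt)) (hX t htt)]

end LoopSetup

end HarmonicTrajectory

end HarmonicControl

namespace HarmonicControl

/-! ### Global asymptotic stability -/

section Stability

open Set Matrix

variable {n m : ℕ} {T : ℝ} {σ : BilinearData n m} {w : ℝ → Fin m → ℝ} {W : ℤ → Fin m → ℂ}
  {se : ℝ → ℝ} {Se : Ell2 Unit} {xe : ℝ → Fin n → ℝ} {Xe : Ell2 (Fin n)} {γ : ℝ → ℝ}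
  {P Q : ℝ → Matrix (Fin n) (Fin n) ℝ} {calP : Ell2 (Fin n) →L[ℂ] Ell2 (Fin n)}

/-- Each point of the later window is compared with its translate in the initial window, and the
squared bound is integrated. The factor `√card` passes between the sup norm and the Hermitian norm.
-/
theorem norm_le_of_window_shift {ι : Type} [Fintype ι] (hT : 0 < T) {e : ℝ → ι → ℂ} {t₀ t C : ℝ}
    (ht : t₀ ≤ t) (hC : 0 ≤ C) (he₀ : VecL2 T t₀ e) (he : VecL2 T t e)
    (hle : ∀ a b, t₀ - T ≤ a → a ≤ b → ‖e b‖ ≤ C * ‖e a‖) {E₀ E : Ell2 ι}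
    (hE₀ : E₀.coords = slidingFourier T e t₀) (hE : E.coords = slidingFourier T e t) :
    ‖E‖ ≤ √(Fintype.card ι) * C * ‖E₀‖ := by
  refine (sq_le_sq₀ (norm_nonneg _) (by positivity)).1 ?_
  rw [norm_sq_eq_integral hT he hE, mul_pow, norm_sq_eq_integral hT he₀ hE₀, mul_left_comm]
  refine mul_le_mul_of_nonneg_left ?_ (by positivity)
  have hshift := intervalIntegral.integral_comp_sub_right (a := t - T) (b := t)
    (fun τ => ∑ i, ‖e τ i‖ ^ 2) (t - t₀)
  have hi := (intervalIntegrable_sum_norm_sq hT.le he₀).comp_sub_right (t - t₀)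
  have e1 : t - T - (t - t₀) = t₀ - T := by ring
  have e2 : t - (t - t₀) = t₀ := by ring
  have e3 : t₀ - T + (t - t₀) = t - T := by ring
  have e4 : t₀ + (t - t₀) = t := by ring
  rw [e1, e2] at hshift
  rw [e3, e4] at hi
  rw [← hshift, ← intervalIntegral.integral_const_mul]
  refine intervalIntegral.integral_mono_on (by linarith)
    (intervalIntegrable_sum_norm_sq hT.le he) (hi.const_mul _) fun τ hτ => ?_
  have h1 := hle (τ - (t - t₀)) τ (by linarith [hτ.1]) (by linarith)
  calc ∑ i, ‖e τ i‖ ^ 2 ≤ Fintype.card ι * ‖e τ‖ ^ 2 := sum_norm_sq_le _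
    _ ≤ Fintype.card ι * (C * ‖e (τ - (t - t₀))‖) ^ 2 := by gcongr
    _ = (√(Fintype.card ι) * C) ^ 2 * ‖e (τ - (t - t₀))‖ ^ 2 := by
      rw [mul_pow, mul_pow, Real.sq_sqrt (by positivity)]
      ring
    _ ≤ _ := by gcongr; exact norm_sq_le_sum _

/-- One period after the signal has become small, the whole window lies in the region where it is
small. -/
theorem tendsto_of_window {ι : Type} [Fintype ι] (hT : 0 < T) {e : ℝ → ι → ℂ} {t₀ : ℝ}
    (he : ∀ t, t₀ ≤ t → VecL2 T t e) (hlim : Tendsto e atTop (𝓝 0)) {E : ℝ → Ell2 ι}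
    (hE : ∀ t, t₀ ≤ t → (E t).coords = slidingFourier T e t) : Tendsto E atTop (𝓝 0) := by
  rw [Metric.tendsto_atTop]
  intro ε hε
  obtain ⟨δ, hδ, hδε⟩ : ∃ δ > 0, √(Fintype.card ι) * δ < ε :=
    ⟨ε / (√(Fintype.card ι) + 1), by positivity, by
      rw [← mul_div_assoc, div_lt_iff₀ (by positivity)]
      nlinarith [Real.sqrt_nonneg (Fintype.card ι)]⟩
  obtain ⟨N, hN⟩ := Metric.tendsto_atTop.1 hlim δ hδ
  refine ⟨max t₀ (N + T), fun t ht => ?_⟩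
  have ht1 := (le_max_left _ _).trans ht
  have ht2 := (le_max_right _ _).trans ht
  rw [dist_zero_right]
  refine (Ell2.norm_le_of_signal hT (he t ht1) (hE t ht1) hδ.le fun τ hτ => ?_).trans_lt hδε
  have := hN τ (by linarith [hτ.1])
  rw [dist_zero_right] at this
  exact this.le

namespace LoopSetup

theorem harmonicGAS (h : LoopSetup σ T w W se Se xe Xe γ P Q calP) :
    σ.HarmonicGAS T W (σ.harmonicFeedback T W (toeplitz T (fun τ => scalarMat (γ τ : ℂ)) 0)
      calP Se Xe) Xe := by
  have hT := h.period_pos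
  have hL : ∀ {t₀ t : ℝ} {e e' : ℝ → Fin n → ℂ}, VecPrimOn (Ici (t₀ - T)) e e' → t₀ ≤ t →
      VecL2 T t e := fun he ht => (he.mono (Icc_window_subset ht)).vecL2
  obtain ⟨C, hC0, hC⟩ := h.loop.exists_norm_le
  refine ⟨fun t₀ ξ => ?_, fun t₀ x s X S y r Y R hx hy hXY t ht => ?_, fun ε hε => ?_,
    fun t₀ x s X S hx => ?_⟩
  · obtain ⟨e, hea, he⟩ := h.loop.exists_solution σ.Adep (t₀ - T) (ξ - cVec (xe (t₀ - T)))
    obtain ⟨s, X, S, ht⟩ := h.exists_trajectory_of_error he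
    refine ⟨_, s, X, S, ht, ?_, by simp [hea]⟩
    exact (continuousOn_pi.2 fun i => (he i).continuousOn).add h.continuous_cxe.continuousOn
  · obtain ⟨e, he, hXe⟩ := h.exists_error_of_trajectory hx
    obtain ⟨f, hf, hYf⟩ := h.exists_error_of_trajectory hy
    -- Equal states at `t₀` mean equal errors almost everywhere on the initial window; by continuity
    -- they agree at `t₀ - T`, and uniqueness for the error system starts from there.
    have h1 := ae_eq_of_slidingFourier_eq hT (hL he le_rfl) (hL hf le_rfl)
      ((hXe t₀ le_rfl).symm.trans ((congrArg (fun Z => Ell2.coords (Z - Xe)) hXY).trans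
        (hYf t₀ le_rfl)))
    have hd : VecPrimOn (Icc (t₀ - T) t₀) (fun t => e t - f t) _ := fun i =>
      ((he i).sub (hf i)).mono (Icc_window_subset le_rfl)
    have h2 := hd.eq_zero_of_ae hT (by
      filter_upwards [h1] with τ hτ hm
      rw [hτ hm, sub_self]) (t₀ - T) ⟨le_rfl, by linarith⟩
    have h3 : ∀ b, t₀ - T ≤ b → e b = f b := fun b hb =>
      h.loop.unique_solution he hf (sub_eq_zero.1 h2) hb
    have h4 : (X t - Xe).coords = (Y t - Xe).coords := by
      rw [hXe t ht, hYf t ht]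
      refine slidingFourier_congr_ae hT.le (ae_of_all _ fun τ hτ => h3 τ ?_)
      linarith [hτ.1]
    exact sub_left_injective (Ell2.ext_coords h4)
  -- The added `1` covers dimension zero, where the square root vanishes.
  · refine ⟨ε / (√(Fintype.card (Fin n)) * C + 1), by positivity,
      fun t₀ x s X S hx hδ t ht => ?_⟩
    obtain ⟨e, he, hXe⟩ := h.exists_error_of_trajectory hx
    have hdamp := isDamped_of_errorField h.loop.posγ he
    have h1 := norm_le_of_window_shift hT ht hC0.le (hL he le_rfl) (hL he ht)
      (fun a b ha hab => hC _ e hdamp a ha b (ha.trans hab) hab) (hXe t₀ le_rfl) (hXe t ht)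
    have h2 : 0 ≤ √(Fintype.card (Fin n)) * C := by positivity
    rw [lt_div_iff₀ (by positivity)] at hδ
    nlinarith [norm_nonneg (X t₀ - Xe)]
  · obtain ⟨e, he, hXe⟩ := h.exists_error_of_trajectory hx
    have h1 := tendsto_of_window hT (fun t ht => hL he ht)
      (h.loop.tendsto_zero (isDamped_of_errorField h.loop.posγ he)) (E := fun t => X t - Xe) hXe
    exact tendsto_sub_nhds_zero_iff.1 h1

theorem cFeedback_ofReal (t : ℝ) (x : Fin n → ℝ) :
    σ.cFeedback w γ P se xe t (cVec x) = (σ.feedback w γ P se xe t x : ℂ) := by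
  have h1 : ∀ u v : Fin n → ℝ, cVec (u + v) = cVec u + cVec v := fun u v => by
    ext i
    simp [cVec]
  have h2 : ∀ u v : Fin n → ℝ, cVec (u - v) = cVec u - cVec v := fun u v => by
    ext i
    simp [cVec]
  have h3 : ∀ u v : Fin n → ℝ, star (cVec u) ⬝ᵥ cVec v = ((u ⬝ᵥ v : ℝ) : ℂ) := fun u v => by
    simp [cVec, dotProduct]
  rw [BilinearData.cFeedback, BilinearData.feedback, BilinearData.cGain, BilinearData.g,
    ← h2, ← cVec_mulVec, ← cVec_mulVec, ← cVec_mulVec, ← h1, h3]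
  push_cast
  rfl

/-- Solutions of the real closed loop are the real solutions of the error system. -/
theorem isForwardSolution_iff (h : LoopSetup σ T w W se Se xe Xe γ P Q calP) {t₀ : ℝ}
    {x : ℝ → Fin n → ℝ} :
    IsForwardSolution (fun t x => σ.field (σ.feedback w γ P se xe t x) (w t) x) t₀ x ↔
      VecPrimOn (Ici t₀) (fun t => cVec (x t - xe t)) fun t =>
        errorField (fun t => σ.Aind + se t • σ.Adep) P σ.Adep γ
          (fun t => σ.Adep *ᵥ xe t + σ.Bdep *ᵥ w t) t (cVec (x t - xe t)) := by
  have h2 : ∀ u v : Fin n → ℝ, cVec (u - v) = cVec u - cVec v := fun u v => by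
    ext i
    simp [cVec]
  have key : ∀ t, errorField (fun t => σ.Aind + se t • σ.Adep) P σ.Adep γ
      (fun t => σ.Adep *ᵥ xe t + σ.Bdep *ᵥ w t) t (cVec (x t - xe t)) =
      cVec (σ.field (σ.feedback w γ P se xe t (x t)) (w t) (x t) -
        σ.field (se t) (w t) (xe t)) := fun t => by
    rw [h2, ← BilinearData.cField_cFeedback_sub, cFeedback_ofReal, BilinearData.cField_ofReal, h2]
  simp only [key]
  have hxe := h.primxe.mono (subset_univ (Ici t₀))
  constructor
  · intro hx
    have hp : IsPrimitiveOn (Ici t₀) x fun t =>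
        σ.field (σ.feedback w γ P se xe t (x t)) (w t) (x t) :=
      IsPrimitiveOn.of_base fun b hb => hx b hb
    exact VecPrimOn.cVec fun i => (vecPrimOn_of_isPrimitiveOn hp i).sub (hxe i)
  · intro hx t ht
    have h1 : VecPrimOn (Ici t₀) (fun t => x t - xe t) fun t =>
        σ.field (σ.feedback w γ P se xe t (x t)) (w t) (x t) - σ.field (se t) (w t) (xe t) :=
      fun i => (hx i).clm_comp Complex.reCLM
    have hp : VecPrimOn (Ici t₀) x fun t =>
        σ.field (σ.feedback w γ P se xe t (x t)) (w t) (x t) := fun i =>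
      ((h1 i).add (hxe i)).congr (fun t _ => by simp) (ae_of_all _ fun t _ => by simp)
    exact ⟨hp.isPrimitiveOn.intervalIntegrable self_mem_Ici ht,
      hp.isPrimitiveOn.eq_add self_mem_Ici ht⟩

theorem isGAS (h : LoopSetup σ T w W se Se xe Xe γ P Q calP) :
    IsGAS (fun t x => σ.field (σ.feedback w γ P se xe t x) (w t) x) xe := by
  obtain ⟨C, hC0, hC⟩ := h.loop.exists_norm_le
  refine ⟨fun t₀ ξ => ?_, fun t₀ x y hx hy hxy t ht => ?_, fun ε hε => ?_, fun t₀ x hx => ?_⟩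
  · obtain ⟨e, hea, he⟩ := h.loop.exists_solution σ.Adep t₀ (cVec (ξ - xe t₀))
    -- The complex error system has real coefficients, so a solution with real initial value equals
    -- its conjugate by uniqueness.
    have hreal : ∀ t ∈ Ici t₀, cVec (fun i => (e t i).re) = e t := fun t ht => by
      have h1 := h.loop.star_eq_self he (by rw [hea]; ext i; simp [cVec]) ht
      ext i
      exact Complex.conj_eq_iff_re.1 (congrFun h1 i)
    refine ⟨fun t => (fun i => (e t i).re) + xe t, h.isForwardSolution_iff.2 fun i => ?_, ?_⟩
    · refine (he i).congr (fun t ht => ?_) (ae_of_all _ fun t ht => ?_)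
      · simp only [add_sub_cancel_right]
        rw [hreal t ht]
      · simp only [add_sub_cancel_right]
        rw [hreal t ht]
    · ext i
      simp [hea, cVec]
  · have h1 := h.loop.unique_solution (h.isForwardSolution_iff.1 hx) (h.isForwardSolution_iff.1 hy)
      (by rw [hxy]) ht
    ext i
    have h2 := congrFun h1 i
    simpa [cVec] using h2
  · refine ⟨ε / C, by positivity, fun t₀ x hx hδ t ht => ?_⟩
    have h1 := hC _ _ (isDamped_of_errorField h.loop.posγ (h.isForwardSolution_iff.1 hx)) t₀
      self_mem_Ici t ht ht
    rw [norm_cVec, norm_cVec] at h1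
    rw [lt_div_iff₀ hC0] at hδ
    linarith
  · have h1 := h.loop.tendsto_zero
      (isDamped_of_errorField h.loop.posγ (h.isForwardSolution_iff.1 hx))
    rw [tendsto_zero_iff_norm_tendsto_zero] at h1 ⊢
    simpa only [norm_cVec] using h1

end LoopSetup

end Stability

end HarmonicControl

namespace HarmonicControl

/-! ### The equilibrium trajectory, the closed-loop data and the main theorem -/

section Assembly

open Set Matrix

variable {n m : ℕ} {T : ℝ} {σ : BilinearData n m} {w : ℝ → Fin m → ℝ} {W : ℤ → Fin m → ℂ}
  {se : ℝ → ℝ} {Se : Ell2 Unit} {Xe : Ell2 (Fin n)}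

theorem memLp_affine_entry {κ : Type} (A B : Matrix (Fin n) κ ℝ)
    (hse : ∀ a b, MemLp se 2 (volume.restrict (Icc a b))) (i : Fin n) (j : κ) (a b : ℝ) :
    MemLp (fun t => (A + se t • B) i j) 2 (volume.restrict (Icc a b)) :=
  (memLp_const (A i j)).add ((hse a b).mul_const (B i j))

theorem matL2_cMat {κ : Type} {A : ℝ → Matrix (Fin n) κ ℝ}
    (hA : ∀ i j a b, MemLp (fun t => A t i j) 2 (volume.restrict (Icc a b))) (t : ℝ) :
    MatL2 T t fun τ => cMat (A τ) := fun i j =>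
  ((hA i j (t - T) t).mono_measure (Measure.restrict_mono Ioc_subset_Icc_self le_rfl)).ofReal

theorem intervalIntegrable_of_memLp_two {f : ℝ → ℝ}
    (hf : ∀ a b, MemLp f 2 (volume.restrict (Icc a b))) (a b : ℝ) :
    IntervalIntegrable f volume a b := by
  rw [intervalIntegrable_iff]
  exact ((hf (min a b) (max a b)).integrable (by norm_num)).mono_measure
    (Measure.restrict_mono Ioc_subset_Icc_self le_rfl)

theorem cMat_affine {κ : Type} (A B : Matrix (Fin n) κ ℝ) (s : ℝ) :
    cMat (A + s • B) = cMat A + (s : ℂ) • cMat B := by rw [cMat_add, cMat_smul]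

/-- The equilibrium of the harmonic model is the decomposition of a periodic trajectory. -/
theorem exists_equilibrium_trajectory (hT : 0 < T) (hwper : Function.Periodic w T)
    (hw : ∀ i a b, MemLp (fun t => w t i) 2 (volume.restrict (Icc a b)))
    (hW : W = slidingFourier T (fun τ => cVec (w τ)) 0) (hseper : Function.Periodic se T)
    (hse : ∀ a b, MemLp se 2 (volume.restrict (Icc a b)))
    (hSe : Se.coords = slidingFourier T (fun τ _ => (se τ : ℂ)) 0)
    (hequi : σ.IsHarmonicEquilibrium T W Se Xe) {Φ Ψ : ℝ → Matrix (Fin n) (Fin n) ℝ}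
    (hΦ : IsFundamental (fun t => σ.Aind + se t • σ.Adep) Φ Ψ)
    (hM : Tendsto (fun k : ℕ => Φ T ^ k) atTop (𝓝 0))
    (h0 : InResolventSet T (σ.calA T Se) 0) :
    ∃ xe : ℝ → Fin n → ℝ, Function.Periodic xe T ∧
      VecPrimOn univ xe (fun t => σ.field (se t) (w t) (xe t)) ∧
      Xe.coords = slidingFourier T (fun τ => cVec (xe τ)) 0 := by
  have hseL : WindowL2 T 0 fun τ => (se τ : ℂ) :=
    ((hse (0 - T) 0).mono_measure (Measure.restrict_mono Ioc_subset_Icc_self le_rfl)).ofReal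
  have hwL : VecL2 T 0 fun τ => cVec (w τ) := fun i =>
    ((hw i (0 - T) 0).mono_measure (Measure.restrict_mono Ioc_subset_Icc_self le_rfl)).ofReal
  have hAm := memLp_affine_entry σ.Aind σ.Adep hse
  have hBm := memLp_affine_entry σ.Bind σ.Bdep hse
  have hbi : ∀ i u v, IntervalIntegrable
      (fun t => ((σ.Bind + se t • σ.Bdep) *ᵥ w t) i) volume u v := fun i u v => by
    rw [intervalIntegrable_iff]
    have h1 : IntegrableOn (fun t => ∑ j, (σ.Bind + se t • σ.Bdep) i j * w t j)
        (Icc (min u v) (max u v)) := integrable_finsetSum _ fun j _ =>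
      MemLp.integrable_mul (hBm i j (min u v) (max u v)) (hw j (min u v) (max u v))
    exact h1.mono_set Ioc_subset_Icc_self
  obtain ⟨xe, hper, hxe⟩ := hΦ.exists_periodic_solution (T := T)
    (fun t => by simp only [hseper t]) hM (b := fun t => (σ.Bind + se t • σ.Bdep) *ᵥ w t)
    (fun t => by simp only [hseper t, hwper t]) hbi
  refine ⟨xe, hper, hxe, ?_⟩
  have hAeq : σ.calA T Se = toeplitz T (fun τ => cMat (σ.Aind + se τ • σ.Adep)) 0 := by
    simp only [cMat_affine]
    exact σ.calA_eq_toeplitz hT hseL hSe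
  have hBeq : σ.calB T Se = toeplitz T (fun τ => cMat (σ.Bind + se τ • σ.Bdep)) 0 := by
    simp only [cMat_affine]
    exact σ.calB_eq_toeplitz hT hseL hSe
  rw [hAeq] at h0
  refine eq_of_harmonic_equilibrium hT (matL2_cMat hAm 0)
    (b := fun t => cMat (σ.Bind + se t • σ.Bdep) *ᵥ cVec (w t))
    (intervalIntegrable_mulVec hT.le (matL2_cMat hBm 0) hwL) ?_ ?_ h0 fun k i => ?_
  · refine (VecPrimOn.cVec hxe).mono (subset_univ _) |>.congr_deriv fun t _ => ?_
    rw [← cVec_mulVec, ← cVec_mulVec]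
    ext i
    simp [cVec]
  · rw [hper.sub_eq 0]
  · have h1 := congrFun (hequi k) i
    rw [BilinearData.harmonicField, hAeq, hBeq, hW, toeplitz_act hT (matL2_cMat hBm 0) hwL] at h1
    exact h1

theorem loopSetup (hT : 0 < T) (hwper : Function.Periodic w T)
    (hw : ∀ i a b, MemLp (fun t => w t i) 2 (volume.restrict (Icc a b)))
    (hW : W = slidingFourier T (fun τ => cVec (w τ)) 0) (hseper : Function.Periodic se T)
    (hse : ∀ a b, MemLp se 2 (volume.restrict (Icc a b)))
    (hSe : Se.coords = slidingFourier T (fun τ _ => (se τ : ℂ)) 0) {xe : ℝ → Fin n → ℝ}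
    (hxeper : Function.Periodic xe T)
    (hxe : VecPrimOn univ xe fun t => σ.field (se t) (w t) (xe t))
    (hXe : Xe.coords = slidingFourier T (fun τ => cVec (xe τ)) 0) {γ : ℝ → ℝ}
    (hγper : Function.Periodic γ T) (hγ : MemLp γ ⊤ volume) (hγpos : ∀ᵐ t, 0 < γ t)
    {P Q : ℝ → Matrix (Fin n) (Fin n) ℝ} (hPper : Function.Periodic P T)
    (hPpos : ∀ t, (P t).PosDef)
    (hP : MatPrimOn univ P fun t => -((σ.Aind + se t • σ.Adep)ᵀ * P t +
      P t * (σ.Aind + se t • σ.Adep) + Q t))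
    (hQper : Function.Periodic Q T) (hQ : ∀ i j, MemLp (fun t => Q t i j) ⊤ volume)
    (hQpos : ∀ᵐ t, (Q t).PosDef) {calP : Ell2 (Fin n) →L[ℂ] Ell2 (Fin n)}
    (hcalP : ∀ (X : Ell2 (Fin n)) (x : ℝ → Fin n → ℂ), VecL2 T 0 x →
      X.coords = slidingFourier T x 0 →
        (calP X).coords = slidingFourier T (fun τ => cMat (P τ) *ᵥ x τ) 0) :
    LoopSetup σ T w W se Se xe Xe γ P Q calP := by
  refine ⟨hT, hwper, hw, hW, hseper, hse, hSe, hxeper, hxe, hXe, hγper, hPper, hcalP, ?_⟩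
  refine ⟨hT, fun i j => intervalIntegrable_of_memLp_two
    (memLp_affine_entry σ.Aind σ.Adep hse i j), hPper, hPpos, hP, hQper, fun i j => (hQ i j).1,
    hQpos, hγ, hγpos, fun i a b => ?_⟩
  have hx2 : ∀ j, MemLp (fun t => xe t j) 2 (volume.restrict (Icc a b)) := fun j =>
    (memLp_Icc_of_windowL2 (WindowL2.of_continuousOn
      (VecPrimOn.cVec hxe j).continuous.continuousOn)).re
  have h1 : MemLp (fun t => ∑ j, σ.Adep i j * xe t j) 2 (volume.restrict (Icc a b)) :=
    memLp_finsetSum _ fun j _ => (hx2 j).const_mul _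
  have h2 : MemLp (fun t => ∑ j, σ.Bdep i j * w t j) 2 (volume.restrict (Icc a b)) :=
    memLp_finsetSum _ fun j _ => (hw j a b).const_mul _
  exact h1.add h2

end Assembly

end HarmonicControl

theorem mainTheorem11 {n m : ℕ} (σ : HarmonicControl.BilinearData n m) (T : ℝ) (hT : 0 < T)
    -- the periodic exogenous input
    (w : ℝ → Fin m → ℝ) (hw_per : Function.Periodic w T)
    (hw : MemLp w 2 (volume.restrict (Set.Icc 0 T)))
    -- the equilibrium control, and its sequence of Fourier coefficients
    (se : ℝ → ℝ) (hse_per : Function.Periodic se T)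
    (hse : MemLp se 2 (volume.restrict (Set.Icc 0 T)))
    (Se : HarmonicControl.Ell2 Unit)
    (hSe : Se.coords = HarmonicControl.slidingFourier T (fun τ _ => (se τ : ℂ)) 0)
    -- the input in the harmonic domain
    (W : ℤ → Fin m → ℂ)
    (hW : W = HarmonicControl.slidingFourier T (fun τ => HarmonicControl.cVec (w τ)) 0)
    (Xe : HarmonicControl.Ell2 (Fin n))
    (hequi : σ.IsHarmonicEquilibrium T W Se Xe)
    (hHurwitz : HarmonicControl.IsHurwitz T (σ.calA T Se))
    -- the gain and the weight
    (γ : ℝ → ℝ) (hγ_per : Function.Periodic γ T) (hγ : MemLp γ ⊤ volume)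
    (hγ_pos : ∀ᵐ t : ℝ, 0 < γ t)
    (Q : ℝ → Matrix (Fin n) (Fin n) ℝ) (hQ_per : Function.Periodic Q T)
    (hQ : ∀ i j, MemLp (fun t => Q t i j) ⊤ volume)
    (hQ_pos : ∀ᵐ t : ℝ, (Q t).PosDef) :
    -- the harmonic Lyapunov equation has a unique Hermitian positive definite solution
    (∃! P : HarmonicControl.Ell2 (Fin n) →L[ℂ] HarmonicControl.Ell2 (Fin n),
      HarmonicControl.IsLyapunovSolution T (σ.calA T Se)
        (HarmonicControl.toeplitz T (fun τ => HarmonicControl.cMat (Q τ)) 0) P) ∧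
    ∀ calP : HarmonicControl.Ell2 (Fin n) →L[ℂ] HarmonicControl.Ell2 (Fin n),
      HarmonicControl.IsLyapunovSolution T (σ.calA T Se)
        (HarmonicControl.toeplitz T (fun τ => HarmonicControl.cMat (Q τ)) 0) calP →
      -- the harmonic feedback stabilizes the harmonic model towards `Xe`
      σ.HarmonicGAS T W
        (σ.harmonicFeedback T W
          (HarmonicControl.toeplitz T (fun τ => HarmonicControl.scalarMat (γ τ : ℂ)) 0)
          calP Se Xe) Xe ∧
      -- `calP` and `Xe` have real continuous periodic representatives `P` and `xe`
      ∃ (P : ℝ → Matrix (Fin n) (Fin n) ℝ) (xe : ℝ → Fin n → ℝ),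
        Continuous P ∧ Function.Periodic P T ∧ (∀ t, (P t).PosDef) ∧
        (∀ X : HarmonicControl.Ell2 (Fin n), (calP X).coords =
          (HarmonicControl.toeplitz T (fun τ => HarmonicControl.cMat (P τ)) 0).act X.coords) ∧
        Continuous xe ∧ Function.Periodic xe T ∧
        Xe.coords = HarmonicControl.slidingFourier T (fun τ => HarmonicControl.cVec (xe τ)) 0 ∧
        -- `xe` is the trajectory of the bilinear affine system for the control `se`
        (∀ t₀, HarmonicControl.IsForwardSolution (fun t x => σ.field (se t) (w t) x) t₀ xe) ∧
        -- and the time-domain feedback stabilizes the bilinear affine system towards `xe`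
        HarmonicControl.IsGAS
          (fun t x => σ.field (σ.feedback w γ P se xe t x) (w t) x) xe := by
  have hwm : ∀ i a b, MemLp (fun t => w t i) 2 (volume.restrict (Set.Icc a b)) := fun i a b =>
    (HarmonicControl.memLp_two_of_periodic hT hw_per hw a b).eval i
  have hsem := HarmonicControl.memLp_two_of_periodic hT hse_per hse
  have hAm := HarmonicControl.memLp_affine_entry σ.Aind σ.Adep hsem
  have hA := fun t => HarmonicControl.matL2_cMat (T := T) hAm t
  have hAper : Function.Periodic (fun t => σ.Aind + se t • σ.Adep) T := fun t => by
    simp only [hse_per t]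
  have hseL : HarmonicControl.WindowL2 T 0 fun τ => (se τ : ℂ) :=
    ((hsem (0 - T) 0).mono_measure
      (Measure.restrict_mono Set.Ioc_subset_Icc_self le_rfl)).ofReal
  have hAeq : σ.calA T Se = HarmonicControl.toeplitz T
      (fun τ => HarmonicControl.cMat (σ.Aind + se τ • σ.Adep)) 0 := by
    simp only [HarmonicControl.cMat_affine]
    exact σ.calA_eq_toeplitz hT hseL hSe
  obtain ⟨Φ, Ψ, hΦ⟩ := HarmonicControl.exists_isFundamental
    (A := fun t => σ.Aind + se t • σ.Adep) fun i j =>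
      HarmonicControl.intervalIntegrable_of_memLp_two (hAm i j)
  have hM := hΦ.tendsto_pow hT hAper hA (hAeq ▸ hHurwitz)
  have hQint : ∀ i j a b, IntervalIntegrable (fun t => Q t i j) volume a b := fun i j a b =>
    intervalIntegrable_iff.2 ((((hQ i j).locallyIntegrable le_top).integrableOn_isCompact
      isCompact_uIcc).mono_set Set.uIoc_subset_uIcc)
  obtain ⟨P, hPper, hPpos, hP⟩ :=
    hΦ.exists_periodic_lyapunov hT hAper hM hQ_per hQint hQ_pos
  obtain ⟨L, hL, hLact⟩ := HarmonicControl.exists_lyapunovSolution hT (hA 0) hPper hPpos hP hQ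
  rw [← hAeq] at hL
  -- Uniqueness identifies an arbitrary solution `calP` with multiplication by the constructed `P`;
  -- this is what gives every solution a continuous periodic representative.
  have hunique : ∀ L', HarmonicControl.IsLyapunovSolution T (σ.calA T Se)
      (HarmonicControl.toeplitz T (fun τ => HarmonicControl.cMat (Q τ)) 0) L' → L' = L := by
    intro L' hL'
    rw [hAeq] at hL hL'
    exact hL'.unique hT hΦ hAper hA hM hL
  refine ⟨⟨L, hL, hunique⟩, fun calP hcalP => ?_⟩
  obtain rfl := hunique calP hcalP
  obtain ⟨xe, hxeper, hxe, hXe⟩ := HarmonicControl.exists_equilibrium_trajectory hT hw_per hwm hW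
    hse_per hsem hSe hequi hΦ hM (hHurwitz 0 le_rfl)
  have hset := HarmonicControl.loopSetup hT hw_per hwm hW hse_per hsem hSe hxeper hxe hXe hγ_per
    hγ hγ_pos hPper hPpos hP hQ_per hQ hQ_pos hLact
  refine ⟨hset.harmonicGAS, P, xe, hset.loop.continuous_P, hPper, hPpos, fun X => ?_,
    continuous_pi fun i => (hxe i).continuous, hxeper, hXe, fun t₀ t _ =>
      ⟨hxe.isPrimitiveOn.intervalIntegrable (Set.mem_univ _) (Set.mem_univ _),
        hxe.isPrimitiveOn.eq_add (Set.mem_univ _) (Set.mem_univ _)⟩, hset.isGAS⟩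
  -- The matrix form of `calP`: multiplication by `P` on a signal representing `X` is the action of
  -- the Toeplitz matrix of `P`.
  obtain ⟨x, -, hx, hX⟩ := HarmonicControl.exists_signal hT X
  have hPL : HarmonicControl.MatL2 T 0 fun τ => HarmonicControl.cMat (P τ) := fun i j =>
    HarmonicControl.WindowL2.of_continuousOn (hP.cMat i j).continuous.continuousOn
  rw [hLact X x (hx 0) (hX 0), hX 0, HarmonicControl.toeplitz_act hT hPL (hx 0)]
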